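/- Let $M$ be a $\mathrm{II}_1$ factor with separable predual and trace $\operatorname{tr}$. An $M$-$M$ bimodule $X$ here is a finitely generated projective right $\mathrm{W}^*$-correspondence from $M$ to $M$: it has an $M$-valued inner product $\langle\,\cdot\,|\,\cdot\,\rangle$ and a normal left action of $M$ by adjointable operators, and it has a finite $X_M$-basis, that is, a finite family $(b_i)$ in $X$ with $\sum_i b_i\langle b_i|x\rangle=x$ for all $x\in X$. Morphisms are the adjointable bimodule maps, $\dagger$ is the adjoint, the tensor product is the relative tensor product $\boxtimes=\boxtimes_M$, and $\|x\|_2:=\operatorname{tr}(\langle x|x\rangle)^{1/2}$; $|\eta\rangle\langle\xi|$ denotes the map $\zeta\mapsto\eta\langle\xi|\zeta\rangle$. * A central sequence of $M$ is a norm bounded sequence $(a_n)$ in $M$ with $\|a_nm-ma_n\|_2\to0$ for all $m\in M$, and $X$ is *centrally trivial* if $\|a_nx-xa_n\|_2\to0$ for all central sequences $(a_n)$ and all $x\in X$. * An *approximately inner $X_M$-basis* is a sequence of finite families $(b_i^{(n)})_{i\le k(n)}$ in $X$ with $\sup_n k(n)<\infty$ and $\sup_{i,n}\|\langle b^{(n)}_i|b^{(n)}_i\rangle\|<\infty$,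 such that $\|x-\sum_i b_i^{(n)}\langle b_i^{(n)}|x\rangle\|_2\to0$ for all $x\in X$ and $\max_i\|ab^{(n)}_i-b^{(n)}_ia\|_2\to0$ for all $a\in M$. The bimodule $X$ is *approximately inner* if it has such a basis. * $\tilde\chi(M)$ is the full subcategory of those bimodules that are approximately inner and centrally trivial and have two-sided duals that are again approximately inner and centrally trivial. Then $\tilde\chi(M)$ is closed under $\boxtimes$ and contains the trivial bimodule $M$, and this monoidal category admits a unitary braiding $u_{X,Y}\colon X\boxtimes Y\to Y\boxtimes X$ given as follows. For all $X,Y\in\tilde\chi(M)$, all $X_M$-bases $(b_i)$ and $Y_M$-bases $(c_j)$, and all approximately inner $X_M$-bases $(b_i^{(n)})$ and $Y_M$-bases $(c_j^{(n)})$, $$u_{X,Y}=\lim_n\sum_{i,j}|c_j\boxtimes b_i^{(n)}\rangle\langle b_i^{(n)}\boxtimes c_j|,\qquad u_{Y,X}^\dagger=\lim_n\sum_{i,j}|c_j^{(n)}\boxtimes b_i\rangle\langle b_i\boxtimes c_j^{(n)}|,$$ the limits existing in $\|\cdot\|_2$ on every vector (equivalently, since the operators are uniformly bounded, in the $\sigma$-strong*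 topology). Furthermore, if $N$ is another $\mathrm{II}_1$ factor with separable predual that is stably isomorphic to $M$ (that is, $N\cong p\,\mathrm{Mat}_n(M)\,p$ for some $n$ and some projection $p\in\mathrm{Mat}_n(M)$), then $\tilde\chi(M)$ and $\tilde\chi(N)$, each with this braiding, are equivalent as braided unitary tensor categories: there is an equivalence of categories consisting of $\mathbb{C}$-linear $\dagger$-functors with unitary unit and counit, whose functor $\tilde\chi(M)\to\tilde\chi(N)$ is braided monoidal with unitary structure isomorphisms. -/

import Mathlib

universe u

noncomputable section

open CategoryTheory

namespace PopaChi

variable {H : Type u} [NormedAddCommGroup H] [InnerProductSpace ℂ H] [CompleteSpace H]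

/-- The underlying unital `*`-algebra of a von Neumann algebra, as a type. -/
abbrev Alg (M : VonNeumannAlgebra H) : Type u := M.toStarSubalgebra

/-- Normal (that is, `σ`-weakly continuous linear) functionals on `M ⊆ B(H)`: those of the form
`a ↦ ∑ i, ⟪ξ i, a (η i)⟫` with `∑ i, ‖ξ i‖ ^ 2` and `∑ i, ‖η i‖ ^ 2` finite. -/
def IsNormal {M : VonNeumannAlgebra H} (φ : Alg M → ℂ) : Prop :=
  ∃ (ι : Type) (ξ η : ι → H), Summable (fun i => ‖ξ i‖ ^ 2) ∧ Summable (fun i => ‖η i‖ ^ 2) ∧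
    ∀ a : Alg M, HasSum (fun i => inner ℂ (ξ i) ((a : H →L[ℂ] H) (η i))) (φ a)

theorem IsNormal.add {M : VonNeumannAlgebra H} {φ ψ : Alg M → ℂ} (hφ : IsNormal φ)
    (hψ : IsNormal ψ) : IsNormal (fun a => φ a + ψ a) := by
  obtain ⟨ι, ξ, η, h1, h2, h3⟩ := hφ
  obtain ⟨κ, ξ', η', h1', h2', h3'⟩ := hψ
  refine ⟨ι ⊕ κ, Sum.elim ξ ξ', Sum.elim η η', ?_, ?_, fun a => ?_⟩
  · exact Summable.sum _ h1 h1'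
  · exact Summable.sum _ h2 h2'
  · exact HasSum.sum (h3 a) (h3' a)

theorem IsNormal.map_add {M : VonNeumannAlgebra H} {φ : Alg M → ℂ} (hφ : IsNormal φ) (a b : Alg M) :
    φ (a + b) = φ a + φ b := by
  obtain ⟨ι, ξ, η, -, -, h3⟩ := hφ
  refine (h3 (a + b)).unique ?_
  convert (h3 a).add (h3 b) using 2 with i
  simp

theorem IsNormal.map_zero {M : VonNeumannAlgebra H} {φ : Alg M → ℂ} (hφ : IsNormal φ) :
    φ 0 = 0 := by
  have := hφ.map_add 0 0
  simpa using this

theorem IsNormal.zero {M : VonNeumannAlgebra H} : IsNormal (fun _ : Alg M => (0 : ℂ)) :=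
  ⟨Empty, Empty.elim, Empty.elim, summable_empty, summable_empty, fun _ => by
    simp⟩

theorem IsNormal.mul_mul {M : VonNeumannAlgebra H} {φ : Alg M → ℂ} (hφ : IsNormal φ)
    (x y : Alg M) : IsNormal (fun a => φ (star x * (a * y))) := by
  obtain ⟨ι, ξ, η, h1, h2, h3⟩ := hφ
  have key : ∀ (z : Alg M) (ζ : ι → H), Summable (fun i => ‖ζ i‖ ^ 2) →
      Summable (fun i => ‖(z : H →L[ℂ] H) (ζ i)‖ ^ 2) := by
    intro z ζ hζ
    refine Summable.of_nonneg_of_le (fun i => by positivity) (fun i => ?_)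
      (hζ.mul_left (‖(z : H →L[ℂ] H)‖ ^ 2))
    rw [← mul_pow]
    exact pow_le_pow_left₀ (norm_nonneg _) ((z : H →L[ℂ] H).le_opNorm _) 2
  refine ⟨ι, fun i => (x : H →L[ℂ] H) (ξ i), fun i => (y : H →L[ℂ] H) (η i), key x ξ h1, key y η h2,
    fun a => ?_⟩
  have := h3 (star x * (a * y))
  convert this using 2 with i
  simp [ContinuousLinearMap.star_eq_adjoint, ContinuousLinearMap.adjoint_inner_right]

/-- `M` is a `II₁` factor and `tr` is its trace: `M` is an infinite-dimensional factor and `tr` is a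
faithful normal tracial state on it. -/
structure IsIIOneFactor (M : VonNeumannAlgebra H) (tr : Alg M →ₗ[ℂ] ℂ) : Prop where
  factor : ∀ a : Alg M, (∀ b : Alg M, a * b = b * a) → ∃ z : ℂ, a = z • (1 : Alg M)
  infinite : ¬ FiniteDimensional ℂ (Alg M)
  tr_one : tr 1 = 1
  tr_mul_comm : ∀ a b : Alg M, tr (a * b) = tr (b * a)
  tr_nonneg : ∀ a : Alg M, ∃ r : ℝ, 0 ≤ r ∧ tr (star a * a) = r
  tr_faithful : ∀ a : Alg M, tr (star a * a) = 0 → a = 0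
  tr_normal : IsNormal tr

/-- `M` and `N` are stably isomorphic: `N` is `*`-isomorphic to an amplification of `M`, that is,
to a corner `p (Mat_n M) p` for some `n` and some projection `p`; here `p = φ 1`. -/
def StablyIsomorphic {K : Type u} [NormedAddCommGroup K] [InnerProductSpace ℂ K] [CompleteSpace K]
    (M : VonNeumannAlgebra H) (N : VonNeumannAlgebra K) : Prop :=
  ∃ (n : ℕ) (φ : Alg N →⋆ₙₐ[ℂ] Matrix (Fin n) (Fin n) (Alg M)), Function.Injective φ ∧
    ∀ x : Matrix (Fin n) (Fin n) (Alg M), x ∈ Set.range φ ↔ φ 1 * x * φ 1 = x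

/-- A finitely generated projective right `W*`-correspondence from `M` to `M`.
`lact a x` is `a x`, `ract x a` is `x a`, and `inner x y` is the `M`-valued inner product
`⟨x | y⟩`, linear in the second variable. Being finitely generated projective is the existence of
a finite `X_M`-basis (then `x ↦ (⟨b i | x⟩)_i` identifies `X` with some `p M ^ n`; completeness
and the existence of a predual follow). -/
structure Bim (M : VonNeumannAlgebra H) where
  carrier : Type u
  [addCommGroup : AddCommGroup carrier]
  [module : Module ℂ carrier]
  lact : Alg M →ₗ[ℂ] carrier →ₗ[ℂ] carrier
  ract : carrier →ₗ[ℂ] Alg M →ₗ[ℂ] carrier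
  inner : carrier →ₗ⋆[ℂ] carrier →ₗ[ℂ] Alg M
  one_lact : ∀ x, lact 1 x = x
  mul_lact : ∀ a b x, lact (a * b) x = lact a (lact b x)
  ract_one : ∀ x, ract x 1 = x
  ract_mul : ∀ x a b, ract x (a * b) = ract (ract x a) b
  lact_ract : ∀ a x b, lact a (ract x b) = ract (lact a x) b
  inner_ract : ∀ x y a, inner x (ract y a) = inner x y * a
  star_inner : ∀ x y, star (inner x y) = inner y x
  inner_nonneg : ∀ x, 0 ≤ ((inner x x : Alg M) : H →L[ℂ] H)
  inner_definite : ∀ x, inner x x = 0 → x = 0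
  inner_lact : ∀ a x y, inner (lact a x) y = inner x (lact (star a) y)
  normal : ∀ (x y : carrier) (φ : Alg M → ℂ), IsNormal φ → IsNormal fun a => φ (inner x (lact a y))
  exists_basis : ∃ (n : ℕ) (b : Fin n → carrier), ∀ x, ∑ i, ract (b i) (inner (b i) x) = x

attribute [instance] Bim.addCommGroup Bim.module

variable {M : VonNeumannAlgebra H}

namespace Bim

instance : CoeSort (Bim M) (Type u) := ⟨Bim.carrier⟩

theorem inner_ract_left (X : Bim M) (x y : X) (a : Alg M) :
    X.inner (X.ract x a) y = star a * X.inner x y := by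
  rw [← X.star_inner, X.inner_ract, star_mul, X.star_inner]

theorem ext_inner (X : Bim M) {x y : X} (h : ∀ z, X.inner z x = X.inner z y) : x = y := by
  rw [← sub_eq_zero]
  apply X.inner_definite
  rw [map_sub, h, sub_self]

/-- Morphisms: adjointable maps commuting with both actions; `adj` is the adjoint. -/
structure Hom (X Y : Bim M) where
  toLin : X →ₗ[ℂ] Y
  adj : Y →ₗ[ℂ] X
  map_lact : ∀ a x, toLin (X.lact a x) = Y.lact a (toLin x)
  map_ract : ∀ x a, toLin (X.ract x a) = Y.ract (toLin x) a
  inner_adj : ∀ x y, Y.inner (toLin x) y = X.inner x (adj y)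

theorem Hom.ext' {X Y : Bim M} {f g : Hom X Y} (h : ∀ x, f.toLin x = g.toLin x) : f = g := by
  have h1 : f.toLin = g.toLin := LinearMap.ext h
  have h2 : f.adj = g.adj := LinearMap.ext fun y => X.ext_inner fun z => by
    rw [← f.inner_adj, ← g.inner_adj, h]
  cases f; cases g; cases h1; cases h2; rfl

theorem Hom.inner_adj' {X Y : Bim M} (f : Hom X Y) (x : X) (y : Y) :
    X.inner (f.adj y) x = Y.inner y (f.toLin x) := by
  rw [← X.star_inner, ← f.inner_adj, Y.star_inner]

instance : Category (Bim M) where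
  Hom := Hom
  id X := ⟨LinearMap.id, LinearMap.id, fun _ _ => rfl, fun _ _ => rfl, fun _ _ => rfl⟩
  comp f g := ⟨g.toLin ∘ₗ f.toLin, f.adj ∘ₗ g.adj,
    fun a x => by simp [f.map_lact, g.map_lact], fun x a => by simp [f.map_ract, g.map_ract],
    fun x y => by simp [f.inner_adj, g.inner_adj]⟩

/-- The underlying linear map of a morphism. -/
def lin {X Y : Bim M} (f : X ⟶ Y) : X →ₗ[ℂ] Y := Hom.toLin f

@[ext]
theorem hom_ext {X Y : Bim M} {f g : X ⟶ Y} (h : ∀ x, lin f x = lin g x) : f = g := Hom.ext' h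

@[simp] theorem lin_id (X : Bim M) (x : X) : lin (𝟙 X) x = x := rfl

@[simp] theorem lin_comp {X Y Z : Bim M} (f : X ⟶ Y) (g : Y ⟶ Z) (x : X) :
    lin (f ≫ g) x = lin g (lin f x) := rfl

/-- The adjoint `f†` of a morphism `f`. -/
def dagger {X Y : Bim M} (f : X ⟶ Y) : Y ⟶ X where
  toLin := f.adj
  adj := f.toLin
  map_lact a y := X.ext_inner fun z => by
    have h := X.inner_lact (star a) z (f.adj y)
    rw [star_star] at h
    rw [← f.inner_adj, ← h, ← f.inner_adj, f.map_lact, Y.inner_lact, star_star]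
  map_ract y a := X.ext_inner fun z => by
    rw [← f.inner_adj, X.inner_ract, Y.inner_ract, f.inner_adj]
  inner_adj y x := f.inner_adj' x y

instance {X Y : Bim M} : Add (X ⟶ Y) := ⟨fun f g => ⟨f.toLin + g.toLin, f.adj + g.adj,
  fun a x => by simp [f.map_lact, g.map_lact], fun x a => by simp [f.map_ract, g.map_ract],
  fun x y => by simp [f.inner_adj, g.inner_adj]⟩⟩

instance {X Y : Bim M} : Zero (X ⟶ Y) := ⟨⟨0, 0,
  fun a x => by simp, fun x a => by simp, fun x y => by simp⟩⟩

instance {X Y : Bim M} : SMul ℂ (X ⟶ Y) := ⟨fun z f => ⟨z • f.toLin, star z • f.adj,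
  fun a x => by simp [f.map_lact], fun x a => by simp [f.map_ract],
  fun x y => by simp [f.inner_adj]⟩⟩

instance {X Y : Bim M} : Neg (X ⟶ Y) := ⟨fun f => ⟨-f.toLin, -f.adj,
  fun a x => by simp [f.map_lact], fun x a => by simp [f.map_ract],
  fun x y => by simp [f.inner_adj]⟩⟩

@[simp] theorem lin_add {X Y : Bim M} (f g : X ⟶ Y) (x : X) : lin (f + g) x = lin f x + lin g x :=
  rfl

@[simp] theorem lin_zero {X Y : Bim M} (x : X) : lin (0 : X ⟶ Y) x = 0 := rfl

@[simp] theorem lin_neg {X Y : Bim M} (f : X ⟶ Y) (x : X) : lin (-f) x = -lin f x := rfl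

@[simp] theorem lin_smul {X Y : Bim M} (z : ℂ) (f : X ⟶ Y) (x : X) : lin (z • f) x = z • lin f x :=
  rfl

instance {X Y : Bim M} : AddCommGroup (X ⟶ Y) where
  add_assoc f g h := by ext x; simp [add_assoc]
  zero_add f := by ext x; simp
  add_zero f := by ext x; simp
  add_comm f g := by ext x; simp [add_comm]
  neg_add_cancel f := by ext x; simp
  nsmul := nsmulRec
  zsmul := zsmulRec

instance {X Y : Bim M} : Module ℂ (X ⟶ Y) where
  one_smul f := by ext x; simp
  mul_smul z w f := by ext x; simp [mul_smul]
  smul_zero z := by ext x; simp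
  zero_smul f := by ext x; simp
  smul_add z f g := by ext x; simp
  add_smul z w f := by ext x; simp [add_smul]

instance : Preadditive (Bim M) where
  add_comp _ _ _ f g h := by ext x; simp
  comp_add _ _ _ f g h := by ext x; simp

instance : Linear ℂ (Bim M) where
  smul_comp _ _ _ z f g := by ext x; simp
  comp_smul _ _ _ f z g := by ext x; simp

section Tensor

open TensorProduct

variable (X Y : Bim M)

/-- The relations `x a ⊗ y = x ⊗ a y`. -/
def rel : Submodule ℂ (X ⊗[ℂ] Y) :=
  Submodule.span ℂ {t | ∃ (x : X) (a : Alg M) (y : Y), t = X.ract x a ⊗ₜ y - x ⊗ₜ Y.lact a y}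

/-- The relative tensor product `X ⊠_M Y` as a vector space. For finitely generated projective
modules the algebraic tensor product over `M` is already complete. -/
def Rel : Type u := (X ⊗[ℂ] Y) ⧸ rel X Y

instance : AddCommGroup (Rel X Y) := inferInstanceAs (AddCommGroup ((X ⊗[ℂ] Y) ⧸ rel X Y))

instance : Module ℂ (Rel X Y) := inferInstanceAs (Module ℂ ((X ⊗[ℂ] Y) ⧸ rel X Y))

/-- The quotient map. -/
def relMk : X ⊗[ℂ] Y →ₗ[ℂ] Rel X Y := (rel X Y).mkQ

variable {X Y}

/-- The elementary tensor `x ⊠ y`. -/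
def tmul (x : X) (y : Y) : Rel X Y := relMk X Y (x ⊗ₜ y)

theorem tmul_balanced (x : X) (a : Alg M) (y : Y) :
    tmul (X.ract x a) y = tmul x (Y.lact a y) :=
  (Submodule.Quotient.eq _).2 (Submodule.subset_span ⟨x, a, y, rfl⟩)

theorem Rel.ind {p : Rel X Y → Prop} (h : ∀ x y, p (tmul x y)) (h0 : p 0)
    (ha : ∀ s t, p s → p t → p (s + t)) (t : Rel X Y) : p t := by
  obtain ⟨t, rfl⟩ : ∃ s, relMk X Y s = t := Submodule.Quotient.mk_surjective _ t
  induction t using TensorProduct.induction_on with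
  | zero => exact h0
  | tmul x y => exact h x y
  | add s t hs ht => rw [map_add]; exact ha _ _ hs ht

theorem tmul_add (x : X) (y y' : Y) : tmul x (y + y') = tmul x y + tmul x y' := by
  simp [tmul, TensorProduct.tmul_add]

theorem add_tmul (x x' : X) (y : Y) : tmul (x + x') y = tmul x y + tmul x' y := by
  simp [tmul, TensorProduct.add_tmul]

theorem tmul_smul (z : ℂ) (x : X) (y : Y) : tmul x (z • y) = z • tmul x y := by
  simp [tmul, TensorProduct.tmul_smul]

theorem smul_tmul (z : ℂ) (x : X) (y : Y) : tmul (z • x) y = z • tmul x y := rfl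

variable (X Y) in
/-- `tmul` as a bilinear map. -/
def mkL : X →ₗ[ℂ] Y →ₗ[ℂ] Rel X Y :=
  LinearMap.mk₂ ℂ tmul (fun x x' y => add_tmul x x' y) (fun z x y => smul_tmul z x y)
    (fun x y y' => tmul_add x y y') (fun z x y => tmul_smul z x y)

@[simp] theorem mkL_apply (x : X) (y : Y) : mkL X Y x y = tmul x y := rfl

@[simp] theorem tmul_zero (x : X) : tmul x (0 : Y) = 0 := map_zero (mkL X Y x)

@[simp] theorem zero_tmul (y : Y) : tmul (0 : X) y = 0 := by
  rw [← mkL_apply, map_zero, LinearMap.zero_apply]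

theorem tmul_sum {ι : Type*} (s : Finset ι) (x : X) (f : ι → Y) :
    tmul x (∑ i ∈ s, f i) = ∑ i ∈ s, tmul x (f i) := map_sum (mkL X Y x) f s

theorem sum_tmul {ι : Type*} (s : Finset ι) (f : ι → X) (y : Y) :
    tmul (∑ i ∈ s, f i) y = ∑ i ∈ s, tmul (f i) y := map_sum ((mkL X Y).flip y) f s

/-- The linear map out of `X ⊠_M Y` induced by a balanced bilinear map. -/
def liftR {V : Type*} [AddCommGroup V] [Module ℂ V] (f : X →ₗ[ℂ] Y →ₗ[ℂ] V)
    (hf : ∀ x a y, f (X.ract x a) y = f x (Y.lact a y)) : Rel X Y →ₗ[ℂ] V :=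
  (rel X Y).liftQ (TensorProduct.lift f) (Submodule.span_le.2 (by
    rintro _ ⟨x, a, y, rfl⟩
    simp [hf]))

@[simp] theorem liftR_tmul {V : Type*} [AddCommGroup V] [Module ℂ V] (f : X →ₗ[ℂ] Y →ₗ[ℂ] V)
    (hf : ∀ x a y, f (X.ract x a) y = f x (Y.lact a y)) (x : X) (y : Y) :
    liftR f hf (tmul x y) = f x y := rfl

/-- The conjugate-linear map out of `X ⊠_M Y` induced by a balanced map that is conjugate-linear in
both variables. -/
def liftS {V : Type*} [AddCommGroup V] [Module ℂ V] (f : X →ₗ⋆[ℂ] Y →ₗ⋆[ℂ] V)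
    (hf : ∀ x a y, f (X.ract x a) y = f x (Y.lact a y)) : Rel X Y →ₗ⋆[ℂ] V :=
  (rel X Y).liftQ (TensorProduct.lift f) (Submodule.span_le.2 (by
    rintro _ ⟨x, a, y, rfl⟩
    simp [hf]))

@[simp] theorem liftS_tmul {V : Type*} [AddCommGroup V] [Module ℂ V] (f : X →ₗ⋆[ℂ] Y →ₗ⋆[ℂ] V)
    (hf : ∀ x a y, f (X.ract x a) y = f x (Y.lact a y)) (x : X) (y : Y) :
    liftS f hf (tmul x y) = f x y := rfl

theorem rel_ext {V : Type*} [AddCommGroup V] [Module ℂ V] {f g : Rel X Y →ₗ[ℂ] V}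
    (h : ∀ x y, f (tmul x y) = g (tmul x y)) : f = g :=
  LinearMap.ext fun t => Rel.ind (p := fun t => f t = g t) h (by simp)
    (fun s t hs ht => by rw [map_add, map_add, hs, ht]) t

variable (X Y) in
/-- The left action on `X ⊠_M Y`. -/
def relLact : Alg M →ₗ[ℂ] Rel X Y →ₗ[ℂ] Rel X Y :=
  LinearMap.mk₂ ℂ (fun a t => liftR ((mkL X Y) ∘ₗ X.lact a)
      (fun x b y => by simp [X.lact_ract, tmul_balanced]) t)
    (fun a b t => by
      rw [← LinearMap.add_apply]; congr 1
      refine rel_ext fun x y => ?_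
      change tmul (X.lact (a + b) x) y = tmul (X.lact a x) y + tmul (X.lact b x) y
      rw [map_add, LinearMap.add_apply, add_tmul])
    (fun z a t => by
      rw [← LinearMap.smul_apply]; congr 1
      refine rel_ext fun x y => ?_
      change tmul (X.lact (z • a) x) y = z • tmul (X.lact a x) y
      rw [map_smul, LinearMap.smul_apply, smul_tmul])
    (fun a s t => map_add _ s t) (fun z a t => map_smul _ z t)

@[simp] theorem relLact_tmul (a : Alg M) (x : X) (y : Y) :
    relLact X Y a (tmul x y) = tmul (X.lact a x) y := rfl

variable (X Y) in
/-- The right action on `X ⊠_M Y`. -/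
def relRact : Rel X Y →ₗ[ℂ] Alg M →ₗ[ℂ] Rel X Y :=
  LinearMap.mk₂ ℂ (fun t a => liftR (LinearMap.compl₂ (mkL X Y) (Y.ract.flip a))
      (fun x b y => by simp [Y.lact_ract, tmul_balanced]) t)
    (fun s t a => map_add _ s t) (fun z t a => map_smul _ z t)
    (fun t a b => by
      rw [← LinearMap.add_apply]; congr 1
      refine rel_ext fun x y => ?_
      change tmul x (Y.ract y (a + b)) = tmul x (Y.ract y a) + tmul x (Y.ract y b)
      rw [map_add, tmul_add])
    (fun z t a => by
      rw [← LinearMap.smul_apply]; congr 1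
      refine rel_ext fun x y => ?_
      change tmul x (Y.ract y (z • a)) = z • tmul x (Y.ract y a)
      rw [map_smul, tmul_smul])

@[simp] theorem relRact_tmul (x : X) (y : Y) (a : Alg M) :
    relRact X Y (tmul x y) a = tmul x (Y.ract y a) := rfl

/-- The functional `x' ⊠ y' ↦ ⟨y | ⟨x | x'⟩ y'⟩`. -/
def relInnerAux (x : X) (y : Y) : Rel X Y →ₗ[ℂ] Alg M :=
  liftR (LinearMap.mk₂ ℂ (fun x' y' => Y.inner y (Y.lact (X.inner x x') y'))
    (fun _ _ _ => by simp) (fun _ _ _ => by simp) (fun _ _ _ => by simp) (fun _ _ _ => by simp))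
    (fun x' a y' => by simp [X.inner_ract, Y.mul_lact])

@[simp] theorem relInnerAux_tmul (x x' : X) (y y' : Y) :
    relInnerAux x y (tmul x' y') = Y.inner y (Y.lact (X.inner x x') y') := rfl

variable (X Y) in
/-- The `M`-valued inner product on `X ⊠_M Y`, determined by
`⟨x ⊠ y | x' ⊠ y'⟩ = ⟨y | ⟨x | x'⟩ y'⟩`. -/
def relInner : Rel X Y →ₗ⋆[ℂ] Rel X Y →ₗ[ℂ] Alg M :=
  liftS (LinearMap.mk₂'ₛₗ (starRingEnd ℂ) (starRingEnd ℂ) (fun x y => relInnerAux x y)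
    (fun _ _ _ => rel_ext fun _ _ => by simp) (fun _ _ _ => rel_ext fun _ _ => by simp)
    (fun _ _ _ => rel_ext fun _ _ => by simp) (fun _ _ _ => rel_ext fun _ _ => by simp))
    (fun x a y => rel_ext fun x' y' => by
      simp [X.inner_ract_left, Y.mul_lact, Y.inner_lact])

@[simp] theorem relInner_tmul (x x' : X) (y y' : Y) :
    relInner X Y (tmul x y) (tmul x' y') = Y.inner y (Y.lact (X.inner x x') y') := rfl

theorem relInner_eq_sum {n m : ℕ} {b : Fin n → X} {c : Fin m → Y}
    (hb : ∀ x, ∑ i, X.ract (b i) (X.inner (b i) x) = x)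
    (hc : ∀ y, ∑ j, Y.ract (c j) (Y.inner (c j) y) = y) (t : Rel X Y) :
    ∑ i, ∑ j, relRact X Y (tmul (b i) (c j)) (relInner X Y (tmul (b i) (c j)) t) = t := by
  refine Rel.ind (p := fun t => ∑ i, ∑ j, relRact X Y (tmul (b i) (c j))
    (relInner X Y (tmul (b i) (c j)) t) = t) (fun x y => ?_) (by simp) (fun s t hs ht => ?_) t
  · simp only [relInner_tmul, relRact_tmul]
    have h1 : ∀ i, ∑ j, tmul (b i) (Y.ract (c j) (Y.inner (c j) (Y.lact (X.inner (b i) x) y)))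
        = tmul (X.ract (b i) (X.inner (b i) x)) y := fun i => by
      rw [← tmul_sum, hc, tmul_balanced]
    rw [Finset.sum_congr rfl fun i _ => h1 i, ← sum_tmul, hb]
  · simp only [map_add, Finset.sum_add_distrib]
    rw [hs, ht]

theorem star_relInner (s t : Rel X Y) : star (relInner X Y s t) = relInner X Y t s := by
  refine Rel.ind (p := fun s => star (relInner X Y s t) = relInner X Y t s) (fun x y => ?_)
    (by simp) (fun s s' hs hs' => ?_) s
  · refine Rel.ind (p := fun t => star (relInner X Y (tmul x y) t) = relInner X Y t (tmul x y))
      (fun x' y' => ?_) (by simp) (fun t t' ht ht' => ?_) t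
    · simp only [relInner_tmul]
      rw [Y.star_inner, Y.inner_lact, X.star_inner]
    · rw [map_add, star_add, ht, ht', map_add, LinearMap.add_apply]
  · rw [map_add, LinearMap.add_apply, star_add, hs, hs', map_add]

theorem relInner_ract (s t : Rel X Y) (a : Alg M) :
    relInner X Y s (relRact X Y t a) = relInner X Y s t * a := by
  refine Rel.ind (p := fun s => relInner X Y s (relRact X Y t a) = relInner X Y s t * a)
    (fun x y => ?_) (by simp) (fun s s' hs hs' => ?_) s
  · refine Rel.ind (p := fun t => relInner X Y (tmul x y) (relRact X Y t a)
      = relInner X Y (tmul x y) t * a) (fun x' y' => ?_) (by simp) (fun t t' ht ht' => ?_) t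
    · simp only [relInner_tmul, relRact_tmul]
      rw [Y.lact_ract, Y.inner_ract]
    · rw [map_add, LinearMap.add_apply, map_add, ht, ht', map_add, add_mul]
  · rw [map_add, LinearMap.add_apply, hs, hs', LinearMap.add_apply, add_mul]

theorem relInner_lact (a : Alg M) (s t : Rel X Y) :
    relInner X Y (relLact X Y a s) t = relInner X Y s (relLact X Y (star a) t) := by
  refine Rel.ind (p := fun s => relInner X Y (relLact X Y a s) t
    = relInner X Y s (relLact X Y (star a) t)) (fun x y => ?_) (by simp) (fun s s' hs hs' => ?_) s
  · refine Rel.ind (p := fun t => relInner X Y (relLact X Y a (tmul x y)) t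
      = relInner X Y (tmul x y) (relLact X Y (star a) t)) (fun x' y' => ?_) (by simp)
      (fun t t' ht ht' => ?_) t
    · simp only [relInner_tmul, relLact_tmul]
      rw [X.inner_lact]
    · rw [map_add, ht, ht', map_add, map_add]
  · rw [map_add, map_add, LinearMap.add_apply, hs, hs', map_add, LinearMap.add_apply]

theorem relInner_self_eq_sum {n m : ℕ} {b : Fin n → X} {c : Fin m → Y}
    (hb : ∀ x, ∑ i, X.ract (b i) (X.inner (b i) x) = x)
    (hc : ∀ y, ∑ j, Y.ract (c j) (Y.inner (c j) y) = y) (t : Rel X Y) :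
    relInner X Y t t = ∑ i, ∑ j, star (relInner X Y (tmul (b i) (c j)) t)
      * relInner X Y (tmul (b i) (c j)) t := by
  conv_lhs => rw [show relInner X Y t t = relInner X Y t (∑ i, ∑ j, relRact X Y (tmul (b i) (c j))
    (relInner X Y (tmul (b i) (c j)) t)) from by rw [relInner_eq_sum hb hc]]
  simp only [map_sum, relInner_ract, star_relInner]

theorem star_mul_self_coe_nonneg (a : Alg M) : 0 ≤ ((star a * a : Alg M) : H →L[ℂ] H) :=
  star_mul_self_nonneg (a : H →L[ℂ] H)

theorem relNormal (φ : Alg M → ℂ) (hφ : IsNormal φ) (s t : Rel X Y) :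
    IsNormal fun a => φ (relInner X Y s (relLact X Y a t)) := by
  refine Rel.ind (p := fun s => IsNormal fun a => φ (relInner X Y s (relLact X Y a t)))
    (fun x y => ?_) ?_ (fun s s' hs hs' => ?_) s
  · refine Rel.ind (p := fun t => IsNormal fun a => φ (relInner X Y (tmul x y) (relLact X Y a t)))
      (fun x' y' => ?_) ?_ (fun t t' ht ht' => ?_) t
    · exact X.normal x x' _ (Y.normal y y' φ hφ)
    · simpa [hφ.map_zero] using IsNormal.zero
    · simp only [map_add, hφ.map_add]
      exact ht.add ht'
  · simpa [hφ.map_zero] using IsNormal.zero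
  · simp only [map_add, LinearMap.add_apply, hφ.map_add]
    exact hs.add hs'

variable (X Y) in
/-- The relative tensor product `X ⊠_M Y` of bimodules. -/
def tensor : Bim M where
  carrier := Rel X Y
  lact := relLact X Y
  ract := relRact X Y
  inner := relInner X Y
  one_lact t := Rel.ind (p := fun t => relLact X Y 1 t = t)
    (fun x y => by rw [relLact_tmul, X.one_lact]) (by simp)
    (fun s t hs ht => by rw [map_add, hs, ht]) t
  mul_lact a b t := Rel.ind (p := fun t => relLact X Y (a * b) t = relLact X Y a (relLact X Y b t))
    (fun x y => by simp only [relLact_tmul, X.mul_lact]) (by simp)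
    (fun s t hs ht => by simp only [map_add, hs, ht]) t
  ract_one t := Rel.ind (p := fun t => relRact X Y t 1 = t)
    (fun x y => by rw [relRact_tmul, Y.ract_one]) (by simp)
    (fun s t hs ht => by rw [map_add, LinearMap.add_apply, hs, ht]) t
  ract_mul t a b := Rel.ind
    (p := fun t => relRact X Y t (a * b) = relRact X Y (relRact X Y t a) b)
    (fun x y => by simp only [relRact_tmul, Y.ract_mul]) (by simp)
    (fun s t hs ht => by simp only [map_add, LinearMap.add_apply, hs, ht]) t
  lact_ract a t b := Rel.ind
    (p := fun t => relLact X Y a (relRact X Y t b) = relRact X Y (relLact X Y a t) b)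
    (fun x y => by simp only [relRact_tmul, relLact_tmul]) (by simp)
    (fun s t hs ht => by simp only [map_add, LinearMap.add_apply, hs, ht]) t
  inner_ract := relInner_ract
  star_inner := star_relInner
  inner_nonneg t := by
    obtain ⟨n, b, hb⟩ := X.exists_basis
    obtain ⟨m, c, hc⟩ := Y.exists_basis
    rw [relInner_self_eq_sum hb hc]
    push_cast
    exact Finset.sum_nonneg fun i _ => Finset.sum_nonneg fun j _ => star_mul_self_nonneg _
  inner_definite t ht := by
    obtain ⟨n, b, hb⟩ := X.exists_basis
    obtain ⟨m, c, hc⟩ := Y.exists_basis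
    have h0 : ((relInner X Y t t : Alg M) : H →L[ℂ] H) = 0 := by rw [ht]; rfl
    rw [relInner_self_eq_sum hb hc] at h0
    push_cast at h0
    have hz : ∀ i j, relInner X Y (tmul (b i) (c j)) t = 0 := by
      intro i j
      have h1 := (Finset.sum_eq_zero_iff_of_nonneg (fun i _ =>
        Finset.sum_nonneg fun j _ => star_mul_self_nonneg _)).1 h0 i (Finset.mem_univ i)
      have h2 := (Finset.sum_eq_zero_iff_of_nonneg (fun j _ =>
        star_mul_self_nonneg _)).1 h1 j (Finset.mem_univ j)
      exact Subtype.ext (CStarRing.star_mul_self_eq_zero_iff _ |>.1 h2)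
    rw [← relInner_eq_sum hb hc t]
    simp [hz]
  inner_lact := relInner_lact
  normal s t φ hφ := relNormal φ hφ s t
  exists_basis := by
    obtain ⟨n, b, hb⟩ := X.exists_basis
    obtain ⟨m, c, hc⟩ := Y.exists_basis
    refine ⟨n * m, fun k => tmul (b (finProdFinEquiv.symm k).1) (c (finProdFinEquiv.symm k).2),
      fun t => ?_⟩
    rw [← finProdFinEquiv.sum_comp, Fintype.sum_prod_type]
    simp only [Equiv.symm_apply_apply]
    exact relInner_eq_sum hb hc t

end Tensor

/-- The trivial bimodule `M`, with `⟨a | b⟩ = a* b`. -/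
def unit (M : VonNeumannAlgebra H) : Bim M where
  carrier := Alg M
  lact := LinearMap.mul ℂ (Alg M)
  ract := LinearMap.mul ℂ (Alg M)
  inner := LinearMap.mk₂'ₛₗ (starRingEnd ℂ) (RingHom.id ℂ) (fun a b => star a * b)
    (fun _ _ _ => by simp [add_mul]) (fun _ _ _ => by simp) (fun _ _ _ => by simp [mul_add])
    (fun _ _ _ => by simp)
  one_lact x := one_mul x
  mul_lact a b x := mul_assoc a b x
  ract_one x := mul_one x
  ract_mul x a b := (mul_assoc x a b).symm
  lact_ract a x b := (mul_assoc a x b).symm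
  inner_ract x y a := (mul_assoc (star x) y a).symm
  star_inner x y := by simp
  inner_nonneg x := star_mul_self_coe_nonneg x
  inner_definite x hx := Subtype.ext (CStarRing.star_mul_self_eq_zero_iff (x : H →L[ℂ] H) |>.1
    (congrArg Subtype.val hx))
  inner_lact a x y := by simp [mul_assoc]
  normal x y φ hφ := hφ.mul_mul x y
  exists_basis := ⟨1, fun _ => 1, fun x => by simp⟩

section Monoidal

variable {X Y Z W X' Y' : Bim M}

/-- The elementary tensor as an element of the bimodule `X ⊠_M Y`. -/
def tm (x : X) (y : Y) : tensor X Y := tmul x y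

theorem tm_balanced (x : X) (a : Alg M) (y : Y) : tm (X.ract x a) y = tm x (Y.lact a y) :=
  tmul_balanced x a y

theorem lact_tm (a : Alg M) (x : X) (y : Y) : (tensor X Y).lact a (tm x y) = tm (X.lact a x) y :=
  rfl

theorem ract_tm (x : X) (y : Y) (a : Alg M) : (tensor X Y).ract (tm x y) a = tm x (Y.ract y a) :=
  rfl

theorem inner_tm (x x' : X) (y y' : Y) :
    (tensor X Y).inner (tm x y) (tm x' y') = Y.inner y (Y.lact (X.inner x x') y') := rfl

variable (X Y) in
/-- `tm` as a bilinear map. -/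
def tmL : X →ₗ[ℂ] Y →ₗ[ℂ] tensor X Y := mkL X Y

theorem tm_add (x : X) (y y' : Y) : tm x (y + y') = tm x y + tm x y' := tmul_add x y y'

theorem add_tm (x x' : X) (y : Y) : tm (x + x') y = tm x y + tm x' y := add_tmul x x' y

theorem tm_smul (z : ℂ) (x : X) (y : Y) : tm x (z • y) = z • tm x y := tmul_smul z x y

theorem smul_tm (z : ℂ) (x : X) (y : Y) : tm (z • x) y = z • tm x y := smul_tmul z x y

@[simp] theorem tm_zero (x : X) : tm x (0 : Y) = 0 := tmul_zero x

@[simp] theorem zero_tm (y : Y) : tm (0 : X) y = 0 := zero_tmul y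

theorem ind2 {p : tensor X Y → Prop} (h : ∀ x y, p (tm x y)) (h0 : p 0)
    (ha : ∀ s t, p s → p t → p (s + t)) (t : tensor X Y) : p t := Rel.ind h h0 ha t

theorem ind3 {p : tensor (tensor X Y) Z → Prop} (h : ∀ x y z, p (tm (tm x y) z)) (h0 : p 0)
    (ha : ∀ s t, p s → p t → p (s + t)) (t : tensor (tensor X Y) Z) : p t :=
  ind2 (fun s z => ind2 (p := fun s => p (tm s z)) (fun x y => h x y z) (by simpa using h0)
    (fun s s' hs hs' => by rw [add_tm]; exact ha _ _ hs hs') s) h0 ha t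

theorem ind3' {p : tensor X (tensor Y Z) → Prop} (h : ∀ x y z, p (tm x (tm y z))) (h0 : p 0)
    (ha : ∀ s t, p s → p t → p (s + t)) (t : tensor X (tensor Y Z)) : p t :=
  ind2 (fun x s => ind2 (p := fun s => p (tm x s)) (fun y z => h x y z) (by simpa using h0)
    (fun s s' hs hs' => by rw [tm_add]; exact ha _ _ hs hs') s) h0 ha t

theorem ind4 {p : tensor (tensor (tensor X Y) Z) W → Prop}
    (h : ∀ x y z w, p (tm (tm (tm x y) z) w)) (h0 : p 0)
    (ha : ∀ s t, p s → p t → p (s + t)) (t : tensor (tensor (tensor X Y) Z) W) : p t :=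
  ind2 (fun s w => ind3 (p := fun s => p (tm s w)) (fun x y z => h x y z w) (by simpa using h0)
    (fun s s' hs hs' => by rw [add_tm]; exact ha _ _ hs hs') s) h0 ha t

/-- The linear map out of `X ⊠_M Y` induced by a balanced bilinear map. -/
def liftT {V : Type u} [AddCommGroup V] [Module ℂ V] (f : X → Y → V)
    (h1 : ∀ x x' y, f (x + x') y = f x y + f x' y) (h2 : ∀ (z : ℂ) x y, f (z • x) y = z • f x y)
    (h3 : ∀ x y y', f x (y + y') = f x y + f x y') (h4 : ∀ (z : ℂ) x y, f x (z • y) = z • f x y)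
    (hf : ∀ x a y, f (X.ract x a) y = f x (Y.lact a y)) : tensor X Y →ₗ[ℂ] V :=
  liftR (LinearMap.mk₂ ℂ f h1 h2 h3 h4) hf

theorem liftT_tm {V : Type u} [AddCommGroup V] [Module ℂ V] (f : X → Y → V)
    (h1 : ∀ x x' y, f (x + x') y = f x y + f x' y) (h2 : ∀ (z : ℂ) x y, f (z • x) y = z • f x y)
    (h3 : ∀ x y y', f x (y + y') = f x y + f x y') (h4 : ∀ (z : ℂ) x y, f x (z • y) = z • f x y)
    (hf : ∀ x a y, f (X.ract x a) y = f x (Y.lact a y)) (x : X) (y : Y) :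
    liftT f h1 h2 h3 h4 hf (tm x y) = f x y := rfl

/-- The linear map `f ⊠ g`. -/
def mapT (f : X →ₗ[ℂ] X') (g : Y →ₗ[ℂ] Y') (hf : ∀ x a, f (X.ract x a) = X'.ract (f x) a)
    (hg : ∀ a y, g (Y.lact a y) = Y'.lact a (g y)) : tensor X Y →ₗ[ℂ] tensor X' Y' :=
  liftT (fun x y => tm (f x) (g y)) (fun _ _ _ => by rw [map_add, add_tm])
    (fun _ _ _ => by rw [map_smul, smul_tm]) (fun _ _ _ => by rw [map_add, tm_add])
    (fun _ _ _ => by rw [map_smul, tm_smul]) (fun _ _ _ => by rw [hf, hg, tm_balanced])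

/-- The morphism `f ⊠ g`. -/
def tensorMap (f : X ⟶ X') (g : Y ⟶ Y') : tensor X Y ⟶ tensor X' Y' where
  toLin := mapT (Hom.toLin f) (Hom.toLin g) f.map_ract g.map_lact
  adj := mapT (Hom.adj f) (Hom.adj g) (dagger f).map_ract (dagger g).map_lact
  map_lact a t := ind2 (p := fun t => mapT (Hom.toLin f) (Hom.toLin g) f.map_ract g.map_lact
      ((tensor X Y).lact a t) = (tensor X' Y').lact a
        (mapT (Hom.toLin f) (Hom.toLin g) f.map_ract g.map_lact t))
    (fun x y => by simp only [mapT, lact_tm, liftT_tm, f.map_lact]) (by simp)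
    (fun s t hs ht => by simp only [map_add, hs, ht]) t
  map_ract t a := ind2 (p := fun t => mapT (Hom.toLin f) (Hom.toLin g) f.map_ract g.map_lact
      ((tensor X Y).ract t a) = (tensor X' Y').ract
        (mapT (Hom.toLin f) (Hom.toLin g) f.map_ract g.map_lact t) a)
    (fun x y => by simp only [mapT, ract_tm, liftT_tm, g.map_ract]) (by simp)
    (fun s t hs ht => by simp only [map_add, LinearMap.add_apply, hs, ht]) t
  inner_adj s t := by
    refine ind2 (p := fun s => (tensor X' Y').inner
      (mapT (Hom.toLin f) (Hom.toLin g) f.map_ract g.map_lact s) t = (tensor X Y).inner s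
      (mapT (Hom.adj f) (Hom.adj g) (dagger f).map_ract (dagger g).map_lact t))
      (fun x y => ?_) (by simp) (fun s s' hs hs' => by
        simp only [map_add, LinearMap.add_apply, hs, hs']) s
    refine ind2 (p := fun t => (tensor X' Y').inner
      (mapT (Hom.toLin f) (Hom.toLin g) f.map_ract g.map_lact (tm x y)) t
      = (tensor X Y).inner (tm x y)
      (mapT (Hom.adj f) (Hom.adj g) (dagger f).map_ract (dagger g).map_lact t))
      (fun x' y' => ?_) (by simp) (fun s s' hs hs' => by simp only [map_add, hs, hs']) t
    simp only [mapT, liftT_tm, inner_tm]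
    rw [g.inner_adj, f.inner_adj]
    congr 1
    exact (dagger g).map_lact _ _

@[simp] theorem lin_tensorMap (f : X ⟶ X') (g : Y ⟶ Y') (x : X) (y : Y) :
    lin (tensorMap f g) (tm x y) = tm (lin f x) (lin g y) := rfl

/-- `(x ⊠ y) ⊠ z ↦ x ⊠ (y ⊠ z)`. -/
def assocL (X Y Z : Bim M) : tensor (tensor X Y) Z →ₗ[ℂ] tensor X (tensor Y Z) :=
  liftT (fun t z => liftT (fun x y => tm x (tm y z)) (fun _ _ _ => by rw [add_tm])
      (fun _ _ _ => by rw [smul_tm]) (fun _ _ _ => by rw [add_tm, tm_add])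
      (fun _ _ _ => by rw [smul_tm, tm_smul])
      (fun _ _ _ => by rw [tm_balanced, lact_tm]) t)
    (fun _ _ _ => map_add _ _ _) (fun _ _ _ => map_smul _ _ _)
    (fun t z z' => ind2 (p := fun t => liftT _ _ _ _ _ _ t = liftT _ _ _ _ _ _ t
        + liftT _ _ _ _ _ _ t) (fun x y => by simp only [liftT_tm, tm_add]) (by simp)
      (fun s t hs ht => by simp only [map_add, hs, ht]; abel) t)
    (fun c t z => ind2 (p := fun t => liftT _ _ _ _ _ _ t = c • liftT _ _ _ _ _ _ t)
      (fun x y => by simp only [liftT_tm, tm_smul]) (by simp)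
      (fun s t hs ht => by simp only [map_add, hs, ht, smul_add]) t)
    (fun t a z => ind2 (p := fun t => liftT _ _ _ _ _ _ ((tensor X Y).ract t a)
        = liftT _ _ _ _ _ _ t)
      (fun x y => by simp only [ract_tm, liftT_tm, tm_balanced]) (by simp)
      (fun s t hs ht => by simp only [map_add, LinearMap.add_apply, hs, ht]) t)

theorem assocL_tm (x : X) (y : Y) (z : Z) : assocL X Y Z (tm (tm x y) z) = tm x (tm y z) := rfl

/-- `x ⊠ (y ⊠ z) ↦ (x ⊠ y) ⊠ z`. -/
def assocR (X Y Z : Bim M) : tensor X (tensor Y Z) →ₗ[ℂ] tensor (tensor X Y) Z :=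
  liftT (fun x t => liftT (fun y z => tm (tm x y) z) (fun _ _ _ => by rw [tm_add, add_tm])
      (fun _ _ _ => by rw [tm_smul, smul_tm]) (fun _ _ _ => by rw [tm_add])
      (fun _ _ _ => by rw [tm_smul])
      (fun _ _ _ => by rw [← ract_tm, tm_balanced]) t)
    (fun x x' t => ind2 (p := fun t => liftT _ _ _ _ _ _ t = liftT _ _ _ _ _ _ t
        + liftT _ _ _ _ _ _ t) (fun x y => by simp only [liftT_tm, add_tm]) (by simp)
      (fun s t hs ht => by simp only [map_add, hs, ht]; abel) t)
    (fun c x t => ind2 (p := fun t => liftT _ _ _ _ _ _ t = c • liftT _ _ _ _ _ _ t)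
      (fun x y => by simp only [liftT_tm, smul_tm]) (by simp)
      (fun s t hs ht => by simp only [map_add, hs, ht, smul_add]) t)
    (fun _ _ _ => map_add _ _ _) (fun _ _ _ => map_smul _ _ _)
    (fun x a t => ind2 (p := fun t => liftT _ _ _ _ _ _ t
        = liftT _ _ _ _ _ _ ((tensor Y Z).lact a t))
      (fun y z => by simp only [lact_tm, liftT_tm, tm_balanced]) (by simp)
      (fun s t hs ht => by simp only [map_add, hs, ht]) t)

theorem assocR_tm (x : X) (y : Y) (z : Z) : assocR X Y Z (tm x (tm y z)) = tm (tm x y) z := rfl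

/-- The associator; its adjoint is its inverse. -/
def assocHom (X Y Z : Bim M) : tensor (tensor X Y) Z ⟶ tensor X (tensor Y Z) where
  toLin := assocL X Y Z
  adj := assocR X Y Z
  map_lact a t := ind3 (p := fun t => assocL X Y Z ((tensor (tensor X Y) Z).lact a t)
      = (tensor X (tensor Y Z)).lact a (assocL X Y Z t))
    (fun x y z => by simp only [lact_tm, assocL_tm]) (by simp)
    (fun s t hs ht => by simp only [map_add, hs, ht]) t
  map_ract t a := ind3 (p := fun t => assocL X Y Z ((tensor (tensor X Y) Z).ract t a)
      = (tensor X (tensor Y Z)).ract (assocL X Y Z t) a)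
    (fun x y z => by simp only [ract_tm, assocL_tm]) (by simp)
    (fun s t hs ht => by simp only [map_add, LinearMap.add_apply, hs, ht]) t
  inner_adj s t := by
    refine ind3 (p := fun s => (tensor X (tensor Y Z)).inner (assocL X Y Z s) t
      = (tensor (tensor X Y) Z).inner s (assocR X Y Z t)) (fun x y z => ?_) (by simp)
      (fun s s' hs hs' => by simp only [map_add, LinearMap.add_apply, hs, hs']) s
    refine ind3' (p := fun t => (tensor X (tensor Y Z)).inner (assocL X Y Z (tm (tm x y) z)) t
      = (tensor (tensor X Y) Z).inner (tm (tm x y) z) (assocR X Y Z t))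
      (fun x' y' z' => ?_) (by simp) (fun s s' hs hs' => by simp only [map_add, hs, hs']) t
    simp only [assocL_tm, assocR_tm, inner_tm, lact_tm]

/-- `a ⊠ x ↦ a x`. -/
def leftUL (X : Bim M) : tensor (unit M) X →ₗ[ℂ] X :=
  liftT (X := unit M) (fun (a : Alg M) x => X.lact a x)
    (fun a b x => LinearMap.congr_fun (map_add X.lact (show Alg M from a) b) x)
    (fun z a x => LinearMap.congr_fun (map_smul X.lact z (show Alg M from a)) x)
    (fun _ _ _ => map_add _ _ _) (fun _ _ _ => map_smul _ _ _) (fun a b x => X.mul_lact a b x)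

theorem leftUL_tm (X : Bim M) (a : Alg M) (x : X) :
    leftUL X (tm (X := unit M) a x) = X.lact a x := rfl

/-- `x ↦ 1 ⊠ x`. -/
def leftUR (X : Bim M) : X →ₗ[ℂ] tensor (unit M) X := tmL (unit M) X (1 : Alg M)

theorem leftUR_apply (X : Bim M) (x : X) : leftUR X x = tm (X := unit M) (1 : Alg M) x := rfl

theorem leftUR_leftUL (X : Bim M) (a : Alg M) (x : X) :
    leftUR X (X.lact a x) = tm (X := unit M) a x :=
  (tm_balanced (X := unit M) (1 : Alg M) a x).symm.trans
    (congrArg (fun b : Alg M => tm (X := unit M) b x) (one_mul a))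

/-- The left unitor; its adjoint is its inverse. -/
def leftUnitorHom (X : Bim M) : tensor (unit M) X ⟶ X where
  toLin := leftUL X
  adj := leftUR X
  map_lact a t := ind2 (p := fun t => leftUL X ((tensor (unit M) X).lact a t) = X.lact a (leftUL X t))
    (fun b x => X.mul_lact a b x) (by simp) (fun s t hs ht => by simp only [map_add, hs, ht]) t
  map_ract t a := ind2 (p := fun t => leftUL X ((tensor (unit M) X).ract t a) = X.ract (leftUL X t) a)
    (fun b x => X.lact_ract b x a) (by simp)
    (fun s t hs ht => by simp only [map_add, LinearMap.add_apply, hs, ht]) t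
  inner_adj t y := ind2 (p := fun t => X.inner (leftUL X t) y
      = (tensor (unit M) X).inner t (leftUR X y))
    (fun b x => (X.inner_lact b x y).trans
      (congrArg (fun c : Alg M => X.inner x (X.lact c y)) (mul_one (star (show Alg M from b))).symm))
    (by simp) (fun s t hs ht => by simp only [map_add, LinearMap.add_apply, hs, ht]) t

/-- `x ⊠ a ↦ x a`. -/
def rightUL (X : Bim M) : tensor X (unit M) →ₗ[ℂ] X :=
  liftT (Y := unit M) (fun x (a : Alg M) => X.ract x a)
    (fun x x' a => LinearMap.congr_fun (map_add X.ract x x') a)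
    (fun z x a => LinearMap.congr_fun (map_smul X.ract z x) a)
    (fun x a b => map_add (X.ract x) (show Alg M from a) b)
    (fun z x a => map_smul (X.ract x) z (show Alg M from a))
    (fun x a b => (X.ract_mul x a b).symm)

theorem rightUL_tm (X : Bim M) (x : X) (a : Alg M) :
    rightUL X (tm (Y := unit M) x a) = X.ract x a := rfl

/-- `x ↦ x ⊠ 1`. -/
def rightUR (X : Bim M) : X →ₗ[ℂ] tensor X (unit M) := (tmL X (unit M)).flip (1 : Alg M)

theorem rightUR_apply (X : Bim M) (x : X) : rightUR X x = tm (Y := unit M) x (1 : Alg M) := rfl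

theorem rightUR_rightUL (X : Bim M) (x : X) (a : Alg M) :
    rightUR X (X.ract x a) = tm (Y := unit M) x a :=
  (tm_balanced (Y := unit M) x a (1 : Alg M)).trans
    (congrArg (fun b : Alg M => tm (Y := unit M) x b) (mul_one a))

/-- The right unitor; its adjoint is its inverse. -/
def rightUnitorHom (X : Bim M) : tensor X (unit M) ⟶ X where
  toLin := rightUL X
  adj := rightUR X
  map_lact a t := ind2 (p := fun t => rightUL X ((tensor X (unit M)).lact a t)
      = X.lact a (rightUL X t))
    (fun x b => (X.lact_ract a x b).symm) (by simp)
    (fun s t hs ht => by simp only [map_add, hs, ht]) t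
  map_ract t a := ind2 (p := fun t => rightUL X ((tensor X (unit M)).ract t a)
      = X.ract (rightUL X t) a)
    (fun x b => X.ract_mul x b a) (by simp)
    (fun s t hs ht => by simp only [map_add, LinearMap.add_apply, hs, ht]) t
  inner_adj t y := ind2 (p := fun t => X.inner (rightUL X t) y
      = (tensor X (unit M)).inner t (rightUR X y))
    (fun x b => (X.inner_ract_left x y b).trans
      (congrArg (fun c : Alg M => star (show Alg M from b) * c) (mul_one (X.inner x y)).symm))
    (by simp) (fun s t hs ht => by simp only [map_add, LinearMap.add_apply, hs, ht]) t

/-- A morphism whose adjoint is a two-sided inverse, as an isomorphism. -/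
def unitaryIso (f : X ⟶ Y) (h1 : ∀ x, lin (dagger f) (lin f x) = x)
    (h2 : ∀ y, lin f (lin (dagger f) y) = y) : X ≅ Y where
  hom := f
  inv := dagger f
  hom_inv_id := hom_ext h1
  inv_hom_id := hom_ext h2

/-- The associator as a unitary isomorphism. -/
def assocIso (X Y Z : Bim M) : tensor (tensor X Y) Z ≅ tensor X (tensor Y Z) :=
  unitaryIso (assocHom X Y Z)
    (fun t => ind3 (p := fun t => assocR X Y Z (assocL X Y Z t) = t) (fun _ _ _ => rfl) (by simp)
      (fun s t hs ht => by simp only [map_add, hs, ht]) t)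
    (fun t => ind3' (p := fun t => assocL X Y Z (assocR X Y Z t) = t) (fun _ _ _ => rfl) (by simp)
      (fun s t hs ht => by simp only [map_add, hs, ht]) t)

/-- The left unitor as a unitary isomorphism. -/
def leftUnitorIso (X : Bim M) : tensor (unit M) X ≅ X :=
  unitaryIso (leftUnitorHom X)
    (fun t => ind2 (p := fun t => leftUR X (leftUL X t) = t) (fun a x => leftUR_leftUL X a x)
      (by simp) (fun s t hs ht => by simp only [map_add, hs, ht]) t)
    (fun x => X.one_lact x)

/-- The right unitor as a unitary isomorphism. -/
def rightUnitorIso (X : Bim M) : tensor X (unit M) ≅ X :=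
  unitaryIso (rightUnitorHom X)
    (fun t => ind2 (p := fun t => rightUR X (rightUL X t) = t) (fun x a => rightUR_rightUL X x a)
      (by simp) (fun s t hs ht => by simp only [map_add, hs, ht]) t)
    (fun x => X.ract_one x)

theorem hom_ext2 {f g : tensor X Y ⟶ Z} (h : ∀ x y, lin f (tm x y) = lin g (tm x y)) : f = g :=
  hom_ext fun t => ind2 (p := fun t => lin f t = lin g t) h (by simp)
    (fun s t hs ht => by simp only [map_add, hs, ht]) t

theorem hom_ext3 {f g : tensor (tensor X Y) Z ⟶ W}
    (h : ∀ x y z, lin f (tm (tm x y) z) = lin g (tm (tm x y) z)) : f = g :=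
  hom_ext fun t => ind3 (p := fun t => lin f t = lin g t) h (by simp)
    (fun s t hs ht => by simp only [map_add, hs, ht]) t

theorem hom_ext4 {f g : tensor (tensor (tensor X Y) Z) W ⟶ X'}
    (h : ∀ x y z w, lin f (tm (tm (tm x y) z) w) = lin g (tm (tm (tm x y) z) w)) : f = g :=
  hom_ext fun t => ind4 (p := fun t => lin f t = lin g t) h (by simp)
    (fun s t hs ht => by simp only [map_add, hs, ht]) t

end Monoidal

instance : MonoidalCategoryStruct (Bim M) where
  tensorObj X Y := tensor X Y
  whiskerLeft X _ _ f := tensorMap (𝟙 X) f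
  whiskerRight f Y := tensorMap f (𝟙 Y)
  tensorHom f g := tensorMap f g
  tensorUnit := unit M
  associator X Y Z := assocIso X Y Z
  leftUnitor X := leftUnitorIso X
  rightUnitor X := rightUnitorIso X

/-- The monoidal category of finitely generated projective `M`-`M` correspondences under the
relative tensor product; its associators and unitors are unitary. -/
instance : MonoidalCategory (Bim M) where
  tensorHom_def _ _ := hom_ext2 fun _ _ => rfl
  id_tensorHom_id _ _ := hom_ext2 fun _ _ => rfl
  tensorHom_comp_tensorHom _ _ _ _ := hom_ext2 fun _ _ => rfl
  whiskerLeft_id _ _ := hom_ext2 fun _ _ => rfl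
  id_whiskerRight _ _ := hom_ext2 fun _ _ => rfl
  associator_naturality _ _ _ := hom_ext3 fun _ _ _ => rfl
  leftUnitor_naturality f := hom_ext2 fun a x => (f.map_lact a x).symm
  rightUnitor_naturality f := hom_ext2 fun x a => (f.map_ract x a).symm
  pentagon _ _ _ _ := hom_ext4 fun _ _ _ _ => rfl
  triangle _ _ := hom_ext3 fun x a y => (tm_balanced x a y).symm

end Bim

open MonoidalCategory Filter Topology

variable (tr : Alg M →ₗ[ℂ] ℂ)

/-- The `2`-norm on `M`: `‖a‖₂ = tr(a* a) ^ (1/2)`. -/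
def algTwoNorm (a : Alg M) : ℝ := Real.sqrt (tr (star a * a)).re

/-- The `2`-norm of a vector `x` of a bimodule: `‖x‖₂ = tr(⟨x | x⟩) ^ (1/2)`. -/
def twoNorm (X : Bim M) (x : X) : ℝ := Real.sqrt (tr (X.inner x x)).re

/-- Central sequences of `M`: norm bounded sequences that asymptotically commute with every element
of `M`, in the `2`-norm (which on bounded sets gives the `σ`-strong* topology). -/
def IsCentralSequence (a : ℕ → Alg M) : Prop :=
  (∃ C : ℝ, ∀ n, ‖(a n : H →L[ℂ] H)‖ ≤ C) ∧
    ∀ m : Alg M, Tendsto (fun n => algTwoNorm tr (a n * m - m * a n)) atTop (𝓝 0)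

/-- `X` is centrally trivial: `‖a_n x - x a_n‖₂ → 0` for all central sequences `(a_n)` and all
`x ∈ X`. -/
def CentrallyTrivial (X : Bim M) : Prop :=
  ∀ a : ℕ → Alg M, IsCentralSequence tr a → ∀ x : X,
    Tendsto (fun n => twoNorm tr X (X.lact (a n) x - X.ract x (a n))) atTop (𝓝 0)

/-- A finite `X_M`-basis: `∑ i, b_i ⟨b_i | x⟩ = x` for all `x`. -/
def IsBasis (X : Bim M) {k : ℕ} (b : Fin k → X) : Prop :=
  ∀ x : X, ∑ i, X.ract (b i) (X.inner (b i) x) = x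

/-- An approximately inner `X_M`-basis: a sequence of finite families `b^{(n)}` in `X`, bounded in
cardinality and in norm, such that `‖x - ∑ i, b_i^{(n)} ⟨b_i^{(n)} | x⟩‖₂ → 0` for all `x ∈ X` and
`‖a b_i^{(n)} - b_i^{(n)} a‖₂ → 0` for all `a ∈ M`. -/
structure IsApproxInnerBasis (X : Bim M) (k : ℕ → ℕ) (b : ∀ n, Fin (k n) → X) : Prop where
  card_bdd : ∃ K : ℕ, ∀ n, k n ≤ K
  norm_bdd : ∃ C : ℝ, ∀ n i, ‖((X.inner (b n i) (b n i) : Alg M) : H →L[ℂ] H)‖ ≤ C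
  approx_basis : ∀ x : X,
    Tendsto (fun n => twoNorm tr X (x - ∑ i, X.ract (b n i) (X.inner (b n i) x))) atTop (𝓝 0)
  approx_comm : ∀ a : Alg M,
    Tendsto (fun n => ∑ i, twoNorm tr X (X.lact a (b n i) - X.ract (b n i) a)) atTop (𝓝 0)

/-- `X` is approximately inner: it has an approximately inner `X_M`-basis. -/
def ApproximatelyInner (X : Bim M) : Prop :=
  ∃ (k : ℕ → ℕ) (b : ∀ n, Fin (k n) → X), IsApproxInnerBasis tr X k b

/-- `X` is local: approximately inner and centrally trivial. -/
def IsLocal (X : Bim M) : Prop := ApproximatelyInner tr X ∧ CentrallyTrivial tr X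

/-- The objects of `χ̃(M)`: the local bimodules having a right and a left dual among the local
bimodules. -/
def chiProp : ObjectProperty (Bim M) := fun X =>
  IsLocal tr X ∧ (∃ Y : Bim M, IsLocal tr Y ∧ Nonempty (ExactPairing X Y)) ∧
    ∃ Z : Bim M, IsLocal tr Z ∧ Nonempty (ExactPairing Z X)

/-- The category `χ̃(M)`, a full subcategory of the category of bimodules. -/
abbrev Chi : Type (u + 1) := (chiProp tr).FullSubcategory

variable {tr}

/-- The underlying vectors of an object of `χ̃(M)`. -/
instance : CoeSort (Chi tr) (Type u) := ⟨fun X => X.obj.carrier⟩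

/-- The adjoint of a morphism of `χ̃(M)`. -/
def Chi.dagger {X Y : Chi tr} (f : X ⟶ Y) : Y ⟶ X := ObjectProperty.homMk (Bim.dagger f.hom)

/-- An isomorphism in `χ̃(M)` is unitary if its adjoint is its inverse. -/
def Chi.IsUnitary {X Y : Chi tr} (f : X ≅ Y) : Prop := Chi.dagger f.hom = f.inv

/-- A braiding on `χ̃(M)` is the canonical one if it is unitary and its components `u_{X,Y}` are
given, for all `X_M`-bases `b`, `Y_M`-bases `c` and all approximately inner such bases `b^{(n)}`,
`c^{(n)}`, by the limits
`u_{X,Y} = lim_n ∑_{i,j} |c_j ⊠ b_i^{(n)}⟩⟨b_i^{(n)} ⊠ c_j|` and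
`u_{Y,X}† = lim_n ∑_{i,j} |c_j^{(n)} ⊠ b_i⟩⟨b_i ⊠ c_j^{(n)}|`,
taken in the `2`-norm on every vector `t` (for norm bounded sequences of right `M`-linear maps between
finitely generated projective modules this is convergence in the `2`-norm given by the commutant
trace, that is, `σ`-strong* convergence). Here `|η⟩⟨ξ|` is the map `t ↦ η ⟨ξ | t⟩`. -/
structure IsCanonicalBraiding [(chiProp tr).IsMonoidal] (β : BraidedCategory (Chi tr)) : Prop where
  unitary : ∀ X Y : Chi tr, Chi.IsUnitary (β.braiding X Y)
  formula : ∀ (X Y : Chi tr) (k : ℕ → ℕ) (b : ∀ n, Fin (k n) → X) (l : ℕ) (c : Fin l → Y),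
    IsApproxInnerBasis tr X.obj k b → IsBasis Y.obj c → ∀ t : Bim.tensor X.obj Y.obj,
      Tendsto (fun n => twoNorm tr (Bim.tensor Y.obj X.obj)
        (Bim.lin (β.braiding X Y).hom.hom t - ∑ i, ∑ j,
          (Bim.tensor Y.obj X.obj).ract (Bim.tm (c j) (b n i))
            ((Bim.tensor X.obj Y.obj).inner (Bim.tm (b n i) (c j)) t))) atTop (𝓝 0)
  formula_dagger : ∀ (X Y : Chi tr) (k : ℕ) (b : Fin k → X) (l : ℕ → ℕ) (c : ∀ n, Fin (l n) → Y),
    IsBasis X.obj b → IsApproxInnerBasis tr Y.obj l c → ∀ t : Bim.tensor X.obj Y.obj,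
      Tendsto (fun n => twoNorm tr (Bim.tensor Y.obj X.obj)
        (Bim.lin (Chi.dagger (β.braiding Y X).hom).hom t - ∑ i, ∑ j,
          (Bim.tensor Y.obj X.obj).ract (Bim.tm (c n j) (b i))
            ((Bim.tensor X.obj Y.obj).inner (Bim.tm (b i) (c n j)) t))) atTop (𝓝 0)

/-- A unitary braided monoidal equivalence of `χ̃(M)` and `χ̃(N)` with given braidings: an
equivalence of categories consisting of `ℂ`-linear `†`-functors with unitary unit and counit, whose
functor is braided monoidal with unitary structure isomorphisms. -/
def UnitarilyBraidedEquivalent {K : Type u} [NormedAddCommGroup K] [InnerProductSpace ℂ K]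
    [CompleteSpace K] {N : VonNeumannAlgebra K} {tr' : Alg N →ₗ[ℂ] ℂ}
    [(chiProp tr).IsMonoidal] [(chiProp tr').IsMonoidal]
    (β : BraidedCategory (Chi tr)) (γ : BraidedCategory (Chi tr')) : Prop :=
  ∃ (e : Chi tr ≌ Chi tr') (_ : e.functor.Braided),
    (∀ {X Y : Chi tr} (f g : X ⟶ Y), e.functor.map (f + g) = e.functor.map f + e.functor.map g) ∧
    (∀ {X Y : Chi tr} (z : ℂ) (f : X ⟶ Y), e.functor.map (z • f) = z • e.functor.map f) ∧
    (∀ {X Y : Chi tr} (f : X ⟶ Y), e.functor.map (Chi.dagger f) = Chi.dagger (e.functor.map f)) ∧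
    (∀ {X Y : Chi tr'} (f : X ⟶ Y), e.inverse.map (Chi.dagger f) = Chi.dagger (e.inverse.map f)) ∧
    (∀ X : Chi tr, Chi.IsUnitary (e.unitIso.app X)) ∧
    (∀ X : Chi tr', Chi.IsUnitary (e.counitIso.app X)) ∧
    Chi.IsUnitary (Functor.Monoidal.εIso e.functor) ∧
    ∀ X Y : Chi tr, Chi.IsUnitary (Functor.Monoidal.μIso e.functor X Y)

end PopaChi

end

noncomputable section

open CategoryTheory

namespace PopaChi

variable {H : Type u} [NormedAddCommGroup H] [InnerProductSpace ℂ H] [CompleteSpace H]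
variable {M : VonNeumannAlgebra H}

open Filter Topology

/-! ### A von Neumann algebra as a C*-algebra -/

theorem isClosed_alg (M : VonNeumannAlgebra H) :
    IsClosed (M.toStarSubalgebra : Set (H →L[ℂ] H)) := by
  rw [VonNeumannAlgebra.coe_toStarSubalgebra, ← M.centralizer_centralizer]
  exact Set.isClosed_centralizer _

scoped instance : CompleteSpace (Alg M) := (isClosed_alg M).completeSpace_coe

scoped instance : CStarAlgebra (Alg M) where

theorem mem_alg_of_commute {T : H →L[ℂ] H} (h : ∀ y ∈ M.commutant, Commute T y) :
    T ∈ M.toStarSubalgebra := by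
  have : T ∈ M.commutant.commutant :=
    VonNeumannAlgebra.mem_commutant_iff.2 fun g hg => (h g hg).eq.symm
  rwa [VonNeumannAlgebra.commutant_commutant] at this

theorem commute_of_mem_commutant (a : Alg M) {y : H →L[ℂ] H} (hy : y ∈ M.commutant) :
    Commute (a : H →L[ℂ] H) y :=
  VonNeumannAlgebra.mem_commutant_iff.1 hy a a.2

scoped instance : StarOrderedRing (Alg M) :=
  StarOrderedRing.of_nonneg_iff'
    (fun {x y} h z => show ((z + x : Alg M) : H →L[ℂ] H) ≤ ((z + y : Alg M) : H →L[ℂ] H) by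
      have h' : (x : H →L[ℂ] H) ≤ y := h
      push_cast; gcongr)
    (fun x => by
      constructor
      · intro h
        have h' : 0 ≤ (x : H →L[ℂ] H) := h
        refine ⟨⟨CFC.sqrt (x : H →L[ℂ] H), mem_alg_of_commute fun y hy => ?_⟩, ?_⟩
        · rw [CFC.sqrt_eq_real_sqrt _ h']
          have hc := commute_of_mem_commutant x hy
          refine Commute.cfcₙ_real hc _
        · apply Subtype.ext
          change (x : H →L[ℂ] H) = star (CFC.sqrt (x : H →L[ℂ] H)) * CFC.sqrt (x : H →L[ℂ] H)
          rw [(CFC.sqrt_nonneg (x : H →L[ℂ] H)).isSelfAdjoint.star_eq, CFC.sqrt_mul_sqrt_self _ h']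
      · rintro ⟨s, rfl⟩
        exact Bim.star_mul_self_coe_nonneg s)

/-! ### Positive tracial functionals -/

/-- A positive tracial functional. -/
structure IsPosTrace (τ : Alg M →ₗ[ℂ] ℂ) : Prop where
  mul_comm : ∀ a b : Alg M, τ (a * b) = τ (b * a)
  nonneg : ∀ a : Alg M, ∃ r : ℝ, 0 ≤ r ∧ τ (star a * a) = r

theorem IsIIOneFactor.isPosTrace {tr : Alg M →ₗ[ℂ] ℂ} (hM : IsIIOneFactor M tr) : IsPosTrace tr :=
  ⟨hM.tr_mul_comm, hM.tr_nonneg⟩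

/-- The squared `2`-norm of a functional. -/
def twoSq (τ : Alg M →ₗ[ℂ] ℂ) (a : Alg M) : ℝ := (τ (star a * a)).re

section PosTrace

variable {τ : Alg M →ₗ[ℂ] ℂ}

theorem IsPosTrace.apply_nonneg (hτ : IsPosTrace τ) {x : Alg M} (hx : 0 ≤ x) : ∃ r : ℝ, 0 ≤ r ∧ τ x = r := by
  obtain ⟨s, rfl⟩ := CStarAlgebra.nonneg_iff_eq_star_mul_self.1 hx
  exact hτ.nonneg s

theorem IsPosTrace.re_nonneg (hτ : IsPosTrace τ) {x : Alg M} (hx : 0 ≤ x) : 0 ≤ (τ x).re := by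
  obtain ⟨r, hr, h⟩ := hτ.apply_nonneg hx
  simpa [h] using hr

theorem IsPosTrace.eq_re (hτ : IsPosTrace τ) {x : Alg M} (hx : 0 ≤ x) : τ x = ((τ x).re : ℂ) := by
  obtain ⟨r, hr, h⟩ := hτ.apply_nonneg hx
  simp [h]

theorem IsPosTrace.re_mono (hτ : IsPosTrace τ) {x y : Alg M} (h : x ≤ y) : (τ x).re ≤ (τ y).re := by
  have := hτ.re_nonneg (sub_nonneg.2 h)
  rw [map_sub, Complex.sub_re] at this
  linarith

theorem IsPosTrace.twoSq_nonneg (hτ : IsPosTrace τ) (a : Alg M) : 0 ≤ twoSq τ a :=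
  hτ.re_nonneg (star_mul_self_nonneg a)

theorem IsPosTrace.twoSq_star (hτ : IsPosTrace τ) (a : Alg M) : twoSq τ (star a) = twoSq τ a := by
  rw [twoSq, twoSq, star_star, hτ.mul_comm]

theorem star_mul_self_le_norm (a : Alg M) : star a * a ≤ ((‖a‖ ^ 2 : ℝ) : ℂ) • (1 : Alg M) := by
  have h := CStarAlgebra.star_mul_le_algebraMap_norm_sq (a := a)
  rw [Algebra.algebraMap_eq_smul_one] at h
  exact h.trans_eq (Complex.coe_smul _ _).symm

theorem IsPosTrace.twoSq_mul_le (hτ : IsPosTrace τ) (a b : Alg M) : twoSq τ (a * b) ≤ ‖a‖ ^ 2 * twoSq τ b := by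
  have h := star_left_conjugate_le_conjugate (star_mul_self_le_norm a) b
  have h2 := hτ.re_mono h
  have e1 : star b * (star a * a) * b = star (a * b) * (a * b) := by
    simp only [star_mul, mul_assoc]
  rw [e1] at h2
  refine h2.trans_eq ?_
  rw [mul_smul_comm, smul_mul_assoc, mul_one, map_smul, smul_eq_mul, Complex.re_ofReal_mul]
  rfl

theorem IsPosTrace.twoSq_add_le (hτ : IsPosTrace τ) (a b : Alg M) :
    twoSq τ (a + b) ≤ 2 * twoSq τ a + 2 * twoSq τ b := by
  have h : star (a + b) * (a + b) + star (a - b) * (a - b)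
      = (2 : ℂ) • (star a * a) + (2 : ℂ) • (star b * b) := by
    rw [two_smul, two_smul, star_add, star_sub]
    noncomm_ring
  have h2 := congrArg (fun x => (τ x).re) h
  simp only [map_add, map_smul, Complex.add_re, smul_eq_mul] at h2
  have h3 := hτ.twoSq_nonneg (a - b)
  simp only [twoSq] at *
  simp only [Complex.mul_re, Complex.re_ofNat, Complex.im_ofNat, zero_mul, sub_zero] at h2
  linarith

theorem twoSq_neg (a : Alg M) : twoSq τ (-a) = twoSq τ a := by simp [twoSq]

theorem twoSq_zero : twoSq τ (0 : Alg M) = 0 := by simp [twoSq]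

end PosTrace

/-! ### Strong convergence and completeness -/

/-- Bounded families of operators have limits along ultrafilters in the weak operator topology. -/
theorem exists_weak_limit {ι : Type*} (U : Ultrafilter ι) (T : ι → H →L[ℂ] H) {C : ℝ}
    (hT : ∀ i, ‖T i‖ ≤ C) :
    ∃ S : H →L[ℂ] H, ∀ ξ η, Tendsto (fun i => inner ℂ ξ (T i η)) U (𝓝 (inner ℂ ξ (S η))) := by
  have hbd : ∀ ξ η i, ‖inner ℂ (T i ξ) η‖ ≤ C * ‖ξ‖ * ‖η‖ := fun ξ η i =>
    (norm_inner_le_norm _ _).trans (mul_le_mul_of_nonneg_right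
      ((T i).le_of_opNorm_le (hT i) ξ) (norm_nonneg _))
  have hex : ∀ ξ η : H, ∃ z : ℂ, Tendsto (fun i => inner ℂ (T i ξ) η) U (𝓝 z) := fun ξ η => by
    obtain ⟨z, -, hz⟩ := (isCompact_closedBall (0 : ℂ) (C * ‖ξ‖ * ‖η‖)).ultrafilter_le_nhds
      (U.map fun i => inner ℂ (T i ξ) η) (by
        rw [le_principal_iff]
        exact Filter.mem_map.2 (Filter.univ_mem' fun i => by
          simpa using hbd ξ η i))
    exact ⟨z, hz⟩
  choose L hL using hex
  have hLb : ∀ ξ η, ‖L ξ η‖ ≤ C * ‖ξ‖ * ‖η‖ := fun ξ η =>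
    le_of_tendsto (hL ξ η).norm (Eventually.of_forall (hbd ξ η))
  let B : H →ₗ⋆[ℂ] H →ₗ[ℂ] ℂ := LinearMap.mk₂'ₛₗ (starRingEnd ℂ) (RingHom.id ℂ) L
    (fun x y z => tendsto_nhds_unique (hL (x + y) z) (((hL x z).add (hL y z)).congr fun i => by
      rw [map_add, inner_add_left]))
    (fun c x z => tendsto_nhds_unique (hL (c • x) z) (((hL x z).const_mul _).congr fun i => by
      rw [map_smul, inner_smul_left]))
    (fun x y z => tendsto_nhds_unique (hL x (y + z)) (((hL x y).add (hL x z)).congr fun i => by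
      rw [inner_add_right]))
    (fun c x z => tendsto_nhds_unique (hL x (c • z)) (((hL x z).const_mul _).congr fun i => by
      rw [inner_smul_right]; rfl))
  refine ⟨InnerProductSpace.continuousLinearMapOfBilin (B.mkContinuous₂ C hLb), fun ξ η => ?_⟩
  rw [← inner_conj_symm, InnerProductSpace.continuousLinearMapOfBilin_apply]
  refine ((Complex.continuous_conj.tendsto _).comp (hL η ξ)).congr fun i => ?_
  simp

theorem IsNormal.tendsto_of_weak {ι : Type*} {l : Filter ι} {φ : Alg M → ℂ} (hφ : IsNormal φ)
    {a : ι → Alg M} {b : Alg M} {C : ℝ} (hC : ∀ i, ‖a i‖ ≤ C)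
    (h : ∀ ξ η : H, Tendsto (fun i => inner ℂ ξ ((a i : H →L[ℂ] H) η)) l
      (𝓝 (inner ℂ ξ ((b : H →L[ℂ] H) η)))) :
    Tendsto (fun i => φ (a i)) l (𝓝 (φ b)) := by
  obtain ⟨κ, ξ, η, h1, h2, h3⟩ := hφ
  simp only [← fun a => (h3 a).tsum_eq]
  refine tendsto_tsum_of_dominated_convergence (bound := fun k => C * (‖ξ k‖ ^ 2 + ‖η k‖ ^ 2))
    ((h1.add h2).mul_left C) (fun k => h (ξ k) (η k)) (Eventually.of_forall fun i k => ?_)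
  have hC0 : 0 ≤ C := (norm_nonneg _).trans (hC i)
  calc ‖inner ℂ (ξ k) ((a i : H →L[ℂ] H) (η k))‖ ≤ ‖ξ k‖ * (C * ‖η k‖) :=
        (norm_inner_le_norm _ _).trans (mul_le_mul_of_nonneg_left
          ((a i : H →L[ℂ] H).le_of_opNorm_le (hC i) _) (norm_nonneg _))
    _ ≤ C * (‖ξ k‖ ^ 2 + ‖η k‖ ^ 2) := by
        nlinarith [mul_nonneg hC0 (sq_nonneg (‖ξ k‖ - ‖η k‖)),
          mul_nonneg hC0 (add_nonneg (sq_nonneg ‖ξ k‖) (sq_nonneg ‖η k‖))]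

variable {tr : Alg M →ₗ[ℂ] ℂ}

theorem IsIIOneFactor.eq_zero_of_tr_eq_zero (hM : IsIIOneFactor M tr) {x : Alg M} (hx : 0 ≤ x)
    (h : tr x = 0) : x = 0 := by
  obtain ⟨s, rfl⟩ := CStarAlgebra.nonneg_iff_eq_star_mul_self.1 hx
  rw [hM.tr_faithful s h, mul_zero]

theorem inner_star_mul_self (a : Alg M) (ξ : H) :
    inner ℂ ξ (((star a * a : Alg M) : H →L[ℂ] H) ξ) = ((‖(a : H →L[ℂ] H) ξ‖ ^ 2 : ℝ) : ℂ) := by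
  refine Eq.trans (b := inner ℂ ((a : H →L[ℂ] H) ξ) ((a : H →L[ℂ] H) ξ)) ?_ ?_
  · simp [ContinuousLinearMap.star_eq_adjoint, ContinuousLinearMap.adjoint_inner_right]
  · rw [inner_self_eq_norm_sq_to_K, Complex.ofReal_pow]
    rfl

theorem IsIIOneFactor.tendsto_strong (hM : IsIIOneFactor M tr) {a : ℕ → Alg M} {C : ℝ}
    (hC : ∀ n, ‖a n‖ ≤ C) (h0 : Tendsto (fun n => twoSq tr (a n)) atTop (𝓝 0)) (ξ : H) :
    Tendsto (fun n => (a n : H →L[ℂ] H) ξ) atTop (𝓝 0) := by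
  have hC' : ∀ n, ‖star (a n) * a n‖ ≤ C ^ 2 := fun n => by
    rw [CStarRing.norm_star_mul_self, ← sq]
    exact pow_le_pow_left₀ (norm_nonneg _) (hC n) 2
  suffices h : Tendsto (fun n => inner ℂ ξ (((star (a n) * a n : Alg M) : H →L[ℂ] H) ξ)) atTop
      (𝓝 0) by
    rw [tendsto_zero_iff_norm_tendsto_zero]
    have h2 := h.norm.sqrt
    rw [norm_zero, Real.sqrt_zero] at h2
    refine h2.congr fun n => ?_
    rw [inner_star_mul_self, Complex.norm_real, Real.norm_of_nonneg (sq_nonneg _), Real.sqrt_sq (norm_nonneg _)]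
  rw [tendsto_iff_ultrafilter]
  intro U hU
  obtain ⟨S, hS⟩ := exists_weak_limit U (fun n => ((star (a n) * a n : Alg M) : H →L[ℂ] H)) hC'
  have hSM : S ∈ M.toStarSubalgebra := mem_alg_of_commute fun y hy => by
    ext η
    refine ext_inner_left ℂ fun ζ => ?_
    refine tendsto_nhds_unique (hS ζ (y η)) ?_
    have := hS (ContinuousLinearMap.adjoint y ζ) η
    rw [ContinuousLinearMap.adjoint_inner_left] at this
    refine this.congr fun n => ?_
    rw [ContinuousLinearMap.adjoint_inner_left]
    exact congrArg (fun T : H →L[ℂ] H => inner ℂ ζ (T η))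
      (commute_of_mem_commutant (star (a n) * a n) hy).eq.symm
  have hS0 : 0 ≤ S := by
    rw [ContinuousLinearMap.nonneg_iff_isPositive, ContinuousLinearMap.isPositive_iff_complex]
    intro η
    have h1 : ∃ r : ℝ, 0 ≤ r ∧ inner ℂ η (S η) = r := by
      have h2 : Tendsto (fun n => ((‖(a n : H →L[ℂ] H) η‖ ^ 2 : ℝ) : ℂ)) U
          (𝓝 (inner ℂ η (S η))) := (hS η η).congr fun n => inner_star_mul_self (a n) η
      have h3 := (Complex.continuous_re.tendsto _).comp h2
      have h4 := (Complex.continuous_im.tendsto _).comp h2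
      refine ⟨_, ge_of_tendsto h3 (Eventually.of_forall fun n => by
        simp only [Function.comp_apply, Complex.ofReal_re]; positivity),
        Complex.ext (by simp) ?_⟩
      refine tendsto_nhds_unique h4 ?_
      simp only [Function.comp_def, Complex.ofReal_im]
      exact tendsto_const_nhds
    obtain ⟨r, hr, e⟩ := h1
    have h3 : inner ℂ (S η) η = r := by
      rw [← inner_conj_symm, e, Complex.conj_ofReal]
    rw [h3]
    simpa using hr
  have htr : tr ⟨S, hSM⟩ = 0 := by
    refine tendsto_nhds_unique (hM.tr_normal.tendsto_of_weak (l := (U : Filter ℕ))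
      (b := ⟨S, hSM⟩) hC' hS) ?_
    have := (Complex.continuous_ofReal.tendsto 0).comp (h0.mono_left hU)
    rw [Complex.ofReal_zero] at this
    refine this.congr fun n => ?_
    exact (hM.isPosTrace.eq_re (star_mul_self_nonneg (a n))).symm
  have hz : S = 0 := congrArg Subtype.val (hM.eq_zero_of_tr_eq_zero (x := ⟨S, hSM⟩) hS0 htr)
  simpa [hz] using hS ξ ξ

theorem IsIIOneFactor.tendsto_twoSq_of_strong (hM : IsIIOneFactor M tr) {a : ℕ → Alg M} {C : ℝ}
    (hC : ∀ n, ‖a n‖ ≤ C) (h : ∀ ξ, Tendsto (fun n => (a n : H →L[ℂ] H) ξ) atTop (𝓝 0)) :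
    Tendsto (fun n => twoSq tr (a n)) atTop (𝓝 0) := by
  have hC' : ∀ n, ‖star (a n) * a n‖ ≤ C ^ 2 := fun n => by
    rw [CStarRing.norm_star_mul_self, ← sq]
    exact pow_le_pow_left₀ (norm_nonneg _) (hC n) 2
  have h1 := hM.tr_normal.tendsto_of_weak (l := atTop) (b := 0) hC' (fun ξ η => by
    have := (h ξ).inner (𝕜 := ℂ) (h η)
    refine (this.congr fun n => ?_).trans (by simp)
    simp [ContinuousLinearMap.star_eq_adjoint, ContinuousLinearMap.adjoint_inner_right])
  have h2 := (Complex.continuous_re.tendsto _).comp h1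
  simpa [Function.comp_def, twoSq] using h2

/-- Normal functionals are continuous along bounded `2`-norm null sequences. -/
theorem IsIIOneFactor.tendsto_normal (hM : IsIIOneFactor M tr) {φ : Alg M → ℂ} (hφ : IsNormal φ)
    {a : ℕ → Alg M} {C : ℝ} (hC : ∀ n, ‖a n‖ ≤ C)
    (h0 : Tendsto (fun n => twoSq tr (a n)) atTop (𝓝 0)) :
    Tendsto (fun n => φ (a n)) atTop (𝓝 0) := by
  have h := hφ.tendsto_of_weak (l := atTop) (b := 0) hC (fun ξ η => by
    have := (tendsto_const_nhds (x := ξ)).inner (𝕜 := ℂ) (hM.tendsto_strong hC h0 η)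
    simpa using this)
  rwa [hφ.map_zero] at h

/-- The unit ball of `M` is complete in the `2`-norm. -/
theorem IsIIOneFactor.exists_limit (hM : IsIIOneFactor M tr) {a : ℕ → Alg M} {C : ℝ}
    (hC : ∀ n, ‖a n‖ ≤ C)
    (h : ∀ s t : ℕ → ℕ, Tendsto s atTop atTop → Tendsto t atTop atTop →
      Tendsto (fun n => twoSq tr (a (s n) - a (t n))) atTop (𝓝 0)) :
    ∃ b : Alg M, ‖b‖ ≤ C ∧ Tendsto (fun n => twoSq tr (a n - b)) atTop (𝓝 0) := by
  have hcau : ∀ ξ, CauchySeq fun n => (a n : H →L[ℂ] H) ξ := fun ξ => by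
    rw [cauchySeq_iff_tendsto_dist_atTop_0, tendsto_iff_seq_tendsto]
    intro p hp
    rw [← prod_atTop_atTop_eq] at hp
    have h1 := h (fun n => (p n).1) (fun n => (p n).2) (tendsto_fst.comp hp) (tendsto_snd.comp hp)
    have h2 := hM.tendsto_strong (C := C + C) (fun n => (norm_sub_le _ _).trans
      (add_le_add (hC _) (hC _))) h1 ξ
    refine (tendsto_zero_iff_norm_tendsto_zero.1 h2).congr fun n => ?_
    simp [dist_eq_norm]
  choose L hL using fun ξ => cauchySeq_tendsto_of_complete (hcau ξ)
  let T : H →ₗ[ℂ] H :=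
    { toFun := L
      map_add' := fun x y => tendsto_nhds_unique (hL _) (((hL x).add (hL y)).congr fun n => by simp)
      map_smul' := fun c x => tendsto_nhds_unique (hL _)
        (((hL x).const_smul c).congr fun n => by simp) }
  have hTb : ∀ ξ, ‖T ξ‖ ≤ C * ‖ξ‖ := fun ξ =>
    le_of_tendsto (hL ξ).norm (Eventually.of_forall fun n =>
      (a n : H →L[ℂ] H).le_of_opNorm_le (hC n) ξ)
  let S : H →L[ℂ] H := T.mkContinuous C hTb
  have hSM : S ∈ M.toStarSubalgebra := mem_alg_of_commute fun y hy => by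
    ext η
    refine tendsto_nhds_unique (hL (y η)) ?_
    refine ((y.continuous.tendsto _).comp (hL η)).congr fun n => ?_
    exact congrArg (fun T : H →L[ℂ] H => T η) (commute_of_mem_commutant (a n) hy).eq.symm
  have hSC : ‖S‖ ≤ C := T.mkContinuous_norm_le ((norm_nonneg _).trans (hC 0)) hTb
  refine ⟨⟨S, hSM⟩, hSC, hM.tendsto_twoSq_of_strong (C := C + C) (fun n => (norm_sub_le _ _).trans
    (add_le_add (hC n) hSC)) fun ξ => ?_⟩
  have := (hL ξ).sub_const (L ξ)
  rw [sub_self] at this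
  exact this

section

open Filter Topology
variable {tr : Alg M →ₗ[ℂ] ℂ}

/-! ### Bounded and null sequences -/

/-- Norm bounded sequences in `M`. -/
def BddA (a : ℕ → Alg M) : Prop := ∃ C : ℝ, ∀ n, ‖a n‖ ≤ C

variable (tr) in
/-- Sequences in `M` converging to `0` in the `2`-norm. -/
def NullA (a : ℕ → Alg M) : Prop := Tendsto (fun n => twoSq tr (a n)) atTop (𝓝 0)

theorem BddA.const (a : Alg M) : BddA fun _ => a := ⟨‖a‖, fun _ => le_rfl⟩

theorem BddA.add {a b : ℕ → Alg M} : BddA a → BddA b → BddA fun n => a n + b n :=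
  fun ⟨C, hC⟩ ⟨D, hD⟩ => ⟨C + D, fun n => (norm_add_le _ _).trans (add_le_add (hC n) (hD n))⟩

theorem BddA.neg {a : ℕ → Alg M} : BddA a → BddA fun n => -a n :=
  fun ⟨C, hC⟩ => ⟨C, fun n => by simpa using hC n⟩

theorem BddA.sub {a b : ℕ → Alg M} (ha : BddA a) (hb : BddA b) : BddA fun n => a n - b n := by
  simpa only [sub_eq_add_neg] using ha.add hb.neg

theorem BddA.mul {a b : ℕ → Alg M} : BddA a → BddA b → BddA fun n => a n * b n :=
  fun ⟨C, hC⟩ ⟨D, hD⟩ => ⟨C * D, fun n => (norm_mul_le _ _).trans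
    (mul_le_mul (hC n) (hD n) (norm_nonneg _) ((norm_nonneg _).trans (hC n)))⟩

theorem BddA.star {a : ℕ → Alg M} : BddA a → BddA fun n => star (a n) :=
  fun ⟨C, hC⟩ => ⟨C, fun n => by simpa using hC n⟩

theorem BddA.sum {ι : Type*} (s : Finset ι) {a : ι → ℕ → Alg M} (h : ∀ i, BddA (a i)) :
    BddA fun n => ∑ i ∈ s, a i n := by
  choose C hC using h
  exact ⟨∑ i ∈ s, C i, fun n => norm_sum_le_of_le _ fun i _ => hC i n⟩

theorem NullA.of_le {a : ℕ → Alg M} {f : ℕ → ℝ} (hτ : IsPosTrace tr)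
    (hf : Tendsto f atTop (𝓝 0)) (h : ∀ n, twoSq tr (a n) ≤ f n) : NullA tr a :=
  tendsto_of_tendsto_of_tendsto_of_le_of_le tendsto_const_nhds hf
    (fun n => hτ.twoSq_nonneg (a n)) h

theorem NullA.zero : NullA tr fun _ => 0 := by simp [NullA, twoSq_zero]

theorem NullA.add {a b : ℕ → Alg M} (hτ : IsPosTrace tr) (ha : NullA tr a) (hb : NullA tr b) :
    NullA tr fun n => a n + b n := by
  refine NullA.of_le hτ (f := fun n => 2 * twoSq tr (a n) + 2 * twoSq tr (b n)) ?_
    fun n => hτ.twoSq_add_le _ _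
  simpa using (Tendsto.const_mul 2 ha).add (Tendsto.const_mul 2 hb)

theorem NullA.neg {a : ℕ → Alg M} (ha : NullA tr a) : NullA tr fun n => -a n := by
  simpa only [NullA, twoSq_neg] using ha

theorem NullA.sum {ι : Type*} (s : Finset ι) {a : ι → ℕ → Alg M} (hτ : IsPosTrace tr)
    (h : ∀ i, NullA tr (a i)) : NullA tr fun n => ∑ i ∈ s, a i n := by
  classical
  induction s using Finset.induction_on with
  | empty => simpa using NullA.zero
  | insert i s hi ih => simpa only [Finset.sum_insert hi] using (h i).add hτ ih

theorem NullA.mul_left {a b : ℕ → Alg M} (hτ : IsPosTrace tr) (ha : BddA a) (hb : NullA tr b) :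
    NullA tr fun n => a n * b n := by
  obtain ⟨C, hC⟩ := ha
  refine NullA.of_le hτ (f := fun n => C ^ 2 * twoSq tr (b n)) (by simpa using Tendsto.const_mul _ hb)
    fun n => (hτ.twoSq_mul_le _ _).trans ?_
  exact mul_le_mul_of_nonneg_right (pow_le_pow_left₀ (norm_nonneg _) (hC n) 2) (hτ.twoSq_nonneg _)

theorem NullA.star {a : ℕ → Alg M} (hτ : IsPosTrace tr) (ha : NullA tr a) :
    NullA tr fun n => star (a n) := by
  simpa only [NullA, hτ.twoSq_star] using ha

theorem NullA.mul_right {a b : ℕ → Alg M} (hτ : IsPosTrace tr) (ha : NullA tr a) (hb : BddA b) :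
    NullA tr fun n => a n * b n := by
  simpa using (NullA.mul_left hτ hb.star (ha.star hτ)).star hτ

theorem nullA_iff (hτ : IsPosTrace tr) {a : ℕ → Alg M} :
    NullA tr a ↔ Tendsto (fun n => algTwoNorm tr (a n)) atTop (𝓝 0) := by
  constructor
  · intro h
    simpa [algTwoNorm, twoSq] using h.sqrt
  · intro h
    have := h.pow 2
    simp only [algTwoNorm] at this
    refine (this.congr fun n => Real.sq_sqrt (hτ.twoSq_nonneg (a n))).trans (by simp)

section Bimodule

variable (X : Bim M)

/-- Norm bounded sequences in a bimodule. -/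
def BddX (x : ℕ → X) : Prop := ∀ y, BddA fun n => X.inner y (x n)

variable (tr) in
/-- Sequences in a bimodule converging to `0` in the `2`-norm. -/
def NullX (x : ℕ → X) : Prop := ∀ y, NullA tr fun n => X.inner y (x n)

variable {X}

theorem IsBasis.inner_eq_sum {k : ℕ} {b : Fin k → X} (hb : IsBasis X b) (x y : X) :
    X.inner x y = ∑ i, X.inner x (b i) * X.inner (b i) y := by
  conv_lhs => rw [← hb y, map_sum]
  simp only [X.inner_ract]

theorem IsBasis.inner_self_eq_sum {k : ℕ} {b : Fin k → X} (hb : IsBasis X b) (x : X) :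
    X.inner x x = ∑ i, star (X.inner (b i) x) * X.inner (b i) x := by
  rw [hb.inner_eq_sum x x]
  simp only [X.star_inner]

theorem IsBasis.star_mul_inner_le {k : ℕ} {b : Fin k → X} (hb : IsBasis X b) (x : X) (i : Fin k) :
    star (X.inner (b i) x) * X.inner (b i) x ≤ X.inner x x := by
  rw [hb.inner_self_eq_sum x]
  exact Finset.single_le_sum (f := fun i => star (X.inner (b i) x) * X.inner (b i) x)
    (fun i _ => star_mul_self_nonneg _) (Finset.mem_univ i)

theorem IsBasis.norm_inner_sq_le {k : ℕ} {b : Fin k → X} (hb : IsBasis X b) (x : X) (i : Fin k) :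
    ‖X.inner (b i) x‖ ^ 2 ≤ ‖X.inner x x‖ := by
  rw [sq, ← CStarRing.norm_star_mul_self]
  exact CStarAlgebra.norm_le_norm_of_nonneg_of_le (star_mul_self_nonneg _) (hb.star_mul_inner_le x i)

theorem IsBasis.twoSq_inner_le (hτ : IsPosTrace tr) {k : ℕ} {b : Fin k → X} (hb : IsBasis X b)
    (x : X) (i : Fin k) : twoSq tr (X.inner (b i) x) ≤ (tr (X.inner x x)).re :=
  hτ.re_mono (hb.star_mul_inner_le x i)

theorem Bim.inner_lact_self_le (X : Bim M) (a : Alg M) (x : X) :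
    X.inner (X.lact a x) (X.lact a x) ≤ ((‖a‖ ^ 2 : ℝ) : ℂ) • X.inner x x := by
  obtain ⟨c, hc⟩ := CStarAlgebra.nonneg_iff_eq_star_mul_self.1
    (sub_nonneg.2 (star_mul_self_le_norm a))
  rw [← sub_nonneg]
  have h : 0 ≤ X.inner (X.lact c x) (X.lact c x) := X.inner_nonneg _
  rw [X.inner_lact, ← X.mul_lact, ← hc] at h
  rw [X.inner_lact, ← X.mul_lact]
  simpa [X.one_lact] using h

theorem IsBasis.bddX {k : ℕ} {b : Fin k → X} (hb : IsBasis X b) {x : ℕ → X}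
    (h : ∀ i, BddA fun n => X.inner (b i) (x n)) : BddX X x := fun y => by
  rw [show (fun n => X.inner y (x n)) = fun n => ∑ i, X.inner y (b i) * X.inner (b i) (x n) from
    funext fun n => hb.inner_eq_sum y (x n)]
  exact BddA.sum _ fun i => (BddA.const _).mul (h i)

theorem IsBasis.nullX (hτ : IsPosTrace tr) {k : ℕ} {b : Fin k → X} (hb : IsBasis X b) {x : ℕ → X}
    (h : ∀ i, NullA tr fun n => X.inner (b i) (x n)) : NullX tr X x := fun y => by
  rw [show (fun n => X.inner y (x n)) = fun n => ∑ i, X.inner y (b i) * X.inner (b i) (x n) from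
    funext fun n => hb.inner_eq_sum y (x n)]
  exact NullA.sum _ hτ fun i => (NullA.mul_left hτ (BddA.const _) (h i))

theorem bddX_iff {x : ℕ → X} : BddX X x ↔ ∃ C : ℝ, ∀ n, ‖X.inner (x n) (x n)‖ ≤ C := by
  obtain ⟨k, b, hb⟩ := X.exists_basis
  have hb : IsBasis X b := hb
  constructor
  · intro h
    simp only [hb.inner_self_eq_sum]
    exact BddA.sum _ fun i => (h (b i)).star.mul (h (b i))
  · rintro ⟨C, hC⟩
    refine hb.bddX fun i => ⟨√C, fun n => Real.le_sqrt_of_sq_le ?_⟩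
    exact (hb.norm_inner_sq_le _ _).trans (hC n)

theorem nullX_iff (hτ : IsPosTrace tr) {x : ℕ → X} :
    NullX tr X x ↔ Tendsto (fun n => twoNorm tr X (x n)) atTop (𝓝 0) := by
  obtain ⟨k, b, hb⟩ := X.exists_basis
  have hb : IsBasis X b := hb
  have h0 : ∀ x : X, 0 ≤ (tr (X.inner x x)).re := fun x => hτ.re_nonneg (X.inner_nonneg x)
  constructor
  · intro h
    have h1 : Tendsto (fun n => ∑ i, twoSq tr (X.inner (b i) (x n))) atTop (𝓝 0) := by
      simpa using tendsto_finsetSum Finset.univ fun i _ => h (b i)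
    have h2 := h1.sqrt
    rw [Real.sqrt_zero] at h2
    refine h2.congr fun n => ?_
    rw [twoNorm, hb.inner_self_eq_sum, map_sum, Complex.re_sum]
    rfl
  · intro h
    have h1 := h.pow 2
    simp only [twoNorm, Real.sq_sqrt (h0 _)] at h1
    refine hb.nullX hτ fun i => NullA.of_le hτ (by simpa using h1)
      fun n => hb.twoSq_inner_le hτ _ i

theorem BddX.const (x : X) : BddX X fun _ => x := fun _ => BddA.const _

theorem BddX.add {x y : ℕ → X} (hx : BddX X x) (hy : BddX X y) : BddX X fun n => x n + y n :=
  fun z => by simpa only [map_add] using (hx z).add (hy z)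

theorem BddX.neg {x : ℕ → X} (hx : BddX X x) : BddX X fun n => -x n :=
  fun z => by simpa only [map_neg] using (hx z).neg

theorem BddX.sub {x y : ℕ → X} (hx : BddX X x) (hy : BddX X y) : BddX X fun n => x n - y n :=
  fun z => by simpa only [map_sub] using (hx z).sub (hy z)

theorem BddX.sum {ι : Type*} (s : Finset ι) {x : ι → ℕ → X} (h : ∀ i, BddX X (x i)) :
    BddX X fun n => ∑ i ∈ s, x i n :=
  fun z => by simpa only [map_sum] using BddA.sum s fun i => h i z

theorem NullX.add (hτ : IsPosTrace tr) {x y : ℕ → X} (hx : NullX tr X x) (hy : NullX tr X y) :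
    NullX tr X fun n => x n + y n :=
  fun z => by simpa only [map_add] using (hx z).add hτ (hy z)

theorem NullX.neg {x : ℕ → X} (hx : NullX tr X x) : NullX tr X fun n => -x n :=
  fun z => by simpa only [map_neg] using (hx z).neg

theorem BddX.inner {x y : ℕ → X} (hx : BddX X x) (hy : BddX X y) :
    BddA fun n => X.inner (x n) (y n) := by
  obtain ⟨k, b, hb⟩ := X.exists_basis
  have hb : IsBasis X b := hb
  rw [show (fun n => X.inner (x n) (y n)) = fun n => ∑ i, X.inner (x n) (b i) * X.inner (b i) (y n)
    from funext fun n => hb.inner_eq_sum (x n) (y n)]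
  refine BddA.sum _ fun i => BddA.mul ?_ (hy (b i))
  simpa only [X.star_inner] using (hx (b i)).star

theorem NullX.inner_left (hτ : IsPosTrace tr) {x y : ℕ → X} (hx : NullX tr X x) (hy : BddX X y) :
    NullA tr fun n => X.inner (x n) (y n) := by
  obtain ⟨k, b, hb⟩ := X.exists_basis
  have hb : IsBasis X b := hb
  rw [show (fun n => X.inner (x n) (y n)) = fun n => ∑ i, X.inner (x n) (b i) * X.inner (b i) (y n)
    from funext fun n => hb.inner_eq_sum (x n) (y n)]
  refine NullA.sum _ hτ fun i => NullA.mul_right hτ ?_ (hy (b i))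
  simpa only [X.star_inner] using (hx (b i)).star hτ

theorem NullX.inner_right (hτ : IsPosTrace tr) {x y : ℕ → X} (hx : BddX X x) (hy : NullX tr X y) :
    NullA tr fun n => X.inner (x n) (y n) := by
  simpa only [X.star_inner] using (hy.inner_left hτ hx).star hτ

theorem BddX.ract {x : ℕ → X} {a : ℕ → Alg M} (hx : BddX X x) (ha : BddA a) :
    BddX X fun n => X.ract (x n) (a n) :=
  fun z => by simpa only [X.inner_ract] using (hx z).mul ha

theorem NullX.ract_left (hτ : IsPosTrace tr) {x : ℕ → X} {a : ℕ → Alg M} (hx : NullX tr X x)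
    (ha : BddA a) : NullX tr X fun n => X.ract (x n) (a n) :=
  fun z => by simpa only [X.inner_ract] using NullA.mul_right hτ (hx z) ha

theorem NullX.ract_right (hτ : IsPosTrace tr) {x : ℕ → X} {a : ℕ → Alg M} (hx : BddX X x)
    (ha : NullA tr a) : NullX tr X fun n => X.ract (x n) (a n) :=
  fun z => by simpa only [X.inner_ract] using NullA.mul_left hτ (hx z) ha

theorem BddA.lact_const {a : ℕ → Alg M} (ha : BddA a) (x : X) : BddX X fun n => X.lact (a n) x := by
  obtain ⟨C, hC⟩ := ha
  refine bddX_iff.2 ⟨C ^ 2 * ‖X.inner x x‖, fun n => ?_⟩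
  refine (CStarAlgebra.norm_le_norm_of_nonneg_of_le (A := Alg M) (X.inner_nonneg _)
    (X.inner_lact_self_le (a n) x)).trans ?_
  rw [norm_smul, Complex.norm_real, Real.norm_of_nonneg (sq_nonneg _)]
  exact mul_le_mul_of_nonneg_right (pow_le_pow_left₀ (norm_nonneg _) (hC n) 2) (norm_nonneg _)

theorem BddX.lact {x : ℕ → X} {a : ℕ → Alg M} (ha : BddA a) (hx : BddX X x) :
    BddX X fun n => X.lact (a n) (x n) := fun z => by
  have h : ∀ n, X.inner z (X.lact (a n) (x n)) = X.inner (X.lact (star (a n)) z) (x n) := fun n => by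
    rw [X.inner_lact, star_star]
  simpa only [h] using (ha.star.lact_const z).inner hx

theorem NullA.lact_const (hM : IsIIOneFactor M tr) {a : ℕ → Alg M} (hb : BddA a) (ha : NullA tr a)
    (x : X) : NullX tr X fun n => X.lact (a n) x := by
  obtain ⟨k, b, hbs⟩ := X.exists_basis
  have hbs : IsBasis X b := hbs
  have hτ := hM.isPosTrace
  obtain ⟨C, hC⟩ := hb.star.mul hb
  have h1 := hM.tendsto_normal (X.normal x x tr hM.tr_normal) hC (NullA.mul_left hτ hb.star ha)
  have h2 := (Complex.continuous_re.tendsto _).comp h1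
  refine hbs.nullX hτ fun i => NullA.of_le hτ h2 fun n => ?_
  refine (hbs.twoSq_inner_le hτ _ i).trans_eq ?_
  rw [X.inner_lact, ← X.mul_lact]
  rfl

theorem NullX.lact_left (hM : IsIIOneFactor M tr) {x : ℕ → X} {a : ℕ → Alg M} (hb : BddA a)
    (ha : NullA tr a) (hx : BddX X x) : NullX tr X fun n => X.lact (a n) (x n) := fun z => by
  have h : ∀ n, X.inner z (X.lact (a n) (x n)) = X.inner (X.lact (star (a n)) z) (x n) := fun n => by
    rw [X.inner_lact, star_star]
  simpa only [h] using
    (NullA.lact_const hM hb.star (ha.star hM.isPosTrace) z).inner_left hM.isPosTrace hx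

theorem NullX.lact_right (hτ : IsPosTrace tr) {x : ℕ → X} {a : ℕ → Alg M} (ha : BddA a)
    (hx : NullX tr X x) : NullX tr X fun n => X.lact (a n) (x n) := fun z => by
  have h : ∀ n, X.inner z (X.lact (a n) (x n)) = X.inner (X.lact (star (a n)) z) (x n) := fun n => by
    rw [X.inner_lact, star_star]
  simpa only [h] using NullX.inner_right hτ (ha.star.lact_const z) hx

variable {Y : Bim M}

theorem BddX.tm {x : ℕ → X} {y : ℕ → Y} (hx : BddX X x) (hy : BddX Y y) :
    BddX (Bim.tensor X Y) fun n => Bim.tm (x n) (y n) := fun t =>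
  Bim.ind2 (p := fun t => BddA fun n => (Bim.tensor X Y).inner t (Bim.tm (x n) (y n)))
    (fun x' y' => by simpa only [Bim.inner_tm] using hy.lact (hx x') y')
    (by simpa using BddA.const 0)
    (fun s t hs ht => by simpa only [map_add, LinearMap.add_apply] using hs.add ht) t

theorem NullX.tm_left (hM : IsIIOneFactor M tr) {x : ℕ → X} {y : ℕ → Y} (hb : BddX X x)
    (hx : NullX tr X x) (hy : BddX Y y) :
    NullX tr (Bim.tensor X Y) fun n => Bim.tm (x n) (y n) := fun t =>
  Bim.ind2 (p := fun t => NullA tr fun n => (Bim.tensor X Y).inner t (Bim.tm (x n) (y n)))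
    (fun x' y' => by simpa only [Bim.inner_tm] using NullX.lact_left hM (hb x') (hx x') hy y')
    (by simpa using NullA.zero)
    (fun s t hs ht => by simpa only [map_add, LinearMap.add_apply] using hs.add hM.isPosTrace ht) t

theorem NullX.tm_right (hτ : IsPosTrace tr) {x : ℕ → X} {y : ℕ → Y} (hx : BddX X x)
    (hy : NullX tr Y y) :
    NullX tr (Bim.tensor X Y) fun n => Bim.tm (x n) (y n) := fun t =>
  Bim.ind2 (p := fun t => NullA tr fun n => (Bim.tensor X Y).inner t (Bim.tm (x n) (y n)))
    (fun x' y' => by simpa only [Bim.inner_tm] using NullX.lact_right hτ (hx x') hy y')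
    (by simpa using NullA.zero)
    (fun s t hs ht => by simpa only [map_add, LinearMap.add_apply] using hs.add hτ ht) t

theorem Bim.inner_lin (f : X ⟶ Y) (x : X) (y : Y) :
    Y.inner y (Bim.lin f x) = X.inner (Bim.lin (Bim.dagger f) y) x :=
  (Bim.Hom.inner_adj' f x y).symm

theorem BddX.map (f : X ⟶ Y) {x : ℕ → X} (hx : BddX X x) : BddX Y fun n => Bim.lin f (x n) :=
  fun y => by simpa only [Bim.inner_lin] using hx _

theorem NullX.map (f : X ⟶ Y) {x : ℕ → X} (hx : NullX tr X x) :
    NullX tr Y fun n => Bim.lin f (x n) :=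
  fun y => by simpa only [Bim.inner_lin] using hx _

theorem IsIIOneFactor.exists_limitX (hM : IsIIOneFactor M tr) {x : ℕ → X} (hx : BddX X x)
    (h : ∀ s t : ℕ → ℕ, Tendsto s atTop atTop → Tendsto t atTop atTop →
      NullX tr X fun n => x (s n) - x (t n)) :
    ∃ y : X, NullX tr X fun n => x n - y := by
  obtain ⟨k, b, hb⟩ := X.exists_basis
  have h1 : ∀ i, ∃ a : Alg M, NullA tr fun n => X.inner (b i) (x n) - a := fun i => by
    obtain ⟨C, hC⟩ := hx (b i)
    obtain ⟨a, -, ha⟩ := hM.exists_limit hC (fun s t hs ht => by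
      simpa only [NullA, map_sub] using h s t hs ht (b i))
    exact ⟨a, ha⟩
  choose a ha using h1
  refine ⟨∑ i, X.ract (b i) (a i), fun z => ?_⟩
  have : ∀ n, X.inner z (x n - ∑ i, X.ract (b i) (a i))
      = ∑ i, X.inner z (b i) * (X.inner (b i) (x n) - a i) := fun n => by
    rw [map_sub, IsBasis.inner_eq_sum (X := X) hb z (x n), map_sum, ← Finset.sum_sub_distrib]
    simp only [X.inner_ract, mul_sub]
  simp only [this]
  exact NullA.sum _ hM.isPosTrace fun i => NullA.mul_left hM.isPosTrace (BddA.const _) (ha i)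

end Bimodule

namespace Asy

variable {X : Bim M}

/-- A finite family of sequences read off a sequence of families of bounded size. -/
def pad {k : ℕ → ℕ} (b : ∀ n, Fin (k n) → X) {K : ℕ} (i : Fin K) (n : ℕ) : X :=
  if h : (i : ℕ) < k n then b n ⟨i, h⟩ else 0

theorem sum_pad {V : Type*} [AddCommMonoid V] {k : ℕ → ℕ} (b : ∀ n, Fin (k n) → X) {K : ℕ}
    (hK : ∀ n, k n ≤ K) (f : X → V) (h0 : f 0 = 0) (n : ℕ) :
    ∑ i : Fin K, f (pad b i n) = ∑ i, f (b n i) := by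
  have h1 : ∑ i : Fin K, f (pad b i n)
      = ∑ i ∈ Finset.range K, f (if h : i < k n then b n ⟨i, h⟩ else 0) :=
    Fin.sum_univ_eq_sum_range (fun i => f (if h : i < k n then b n ⟨i, h⟩ else 0)) K
  have h2 : ∑ i, f (b n i) = ∑ i : Fin (k n), f (if h : (i : ℕ) < k n then b n ⟨i, h⟩ else 0) :=
    Finset.sum_congr rfl fun i _ => by rw [dif_pos i.2]
  rw [h1, h2, Fin.sum_univ_eq_sum_range (fun i => f (if h : i < k n then b n ⟨i, h⟩ else 0)) (k n)]
  refine (Finset.sum_subset (Finset.range_subset_range.2 (hK n)) fun i _ hi => ?_).symm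
  rw [dif_neg (by simpa using hi), h0]

theorem bddX_pad {k : ℕ → ℕ} {b : ∀ n, Fin (k n) → X} (hb : IsApproxInnerBasis tr X k b) {K : ℕ}
    (i : Fin K) : BddX X (pad b i) := by
  obtain ⟨C, hC⟩ := hb.norm_bdd
  refine bddX_iff.2 ⟨max C 0, fun n => ?_⟩
  by_cases h : (i : ℕ) < k n
  · rw [pad, dif_pos h]
    exact (hC n _).trans (le_max_left _ _)
  · rw [pad, dif_neg h]
    simp

end Asy

theorem IsApproxInnerBasis.comp {X : Bim M} {k : ℕ → ℕ} {b : ∀ n, Fin (k n) → X}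
    (hb : IsApproxInnerBasis tr X k b) {s : ℕ → ℕ} (hs : Tendsto s atTop atTop) :
    IsApproxInnerBasis tr X (fun n => k (s n)) (fun n => b (s n)) where
  card_bdd := hb.card_bdd.imp fun _ h n => h (s n)
  norm_bdd := hb.norm_bdd.imp fun _ h n => h (s n)
  approx_basis x := (hb.approx_basis x).comp hs
  approx_comm a := (hb.approx_comm a).comp hs

end

section

open Filter Topology
variable {tr : Alg M →ₗ[ℂ] ℂ}

/-! ### Bounded sequences modulo null sequences -/

variable (M) in
/-- The ring of bounded sequences in `M`. -/
def bddRing : Subring (ℕ → Alg M) where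
  carrier := {a | BddA a}
  mul_mem' ha hb := ha.mul hb
  one_mem' := BddA.const 1
  add_mem' ha hb := ha.add hb
  zero_mem' := BddA.const 0
  neg_mem' ha := ha.neg

variable (tr) [hM : Fact (IsIIOneFactor M tr)]

/-- Equality of bounded sequences up to null sequences. -/
def nullCon : RingCon (bddRing M) where
  r a b := NullA tr fun n => a.1 n - b.1 n
  iseqv :=
    { refl := fun a => by simpa using NullA.zero
      symm := fun h => by simpa using h.neg
      trans := fun h h' => by simpa using h.add hM.out.isPosTrace h' }
  add' h h' := by
    refine (h.add hM.out.isPosTrace h').congr fun n => ?_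
    congr 1
    simp only [Subring.coe_add, Pi.add_apply]
    abel
  mul' {w x y z} h h' := by
    refine ((NullA.mul_right hM.out.isPosTrace h y.2).add hM.out.isPosTrace
      (NullA.mul_left hM.out.isPosTrace x.2 h')).congr fun n => ?_
    congr 1
    simp only [Subring.coe_mul, Pi.mul_apply]
    noncomm_ring

/-- The asymptotic sequence algebra of `M`. -/
def AsyAlg : Type u := (nullCon tr).Quotient

instance : Ring (AsyAlg tr) := inferInstanceAs (Ring (nullCon tr).Quotient)

variable {tr}

/-- The class of a bounded sequence. -/
def AsyAlg.mk (a : ℕ → Alg M) (ha : BddA a) : AsyAlg tr := Quotient.mk _ (⟨a, ha⟩ : bddRing M)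

theorem AsyAlg.ind {p : AsyAlg tr → Prop} (h : ∀ a ha, p (AsyAlg.mk a ha)) (x : AsyAlg tr) : p x :=
  Quotient.ind (fun a => h a.1 a.2) x

theorem AsyAlg.mk_eq {a b : ℕ → Alg M} {ha : BddA a} {hb : BddA b} :
    (AsyAlg.mk a ha : AsyAlg tr) = AsyAlg.mk b hb ↔ NullA tr fun n => a n - b n :=
  Quotient.eq

theorem AsyAlg.mk_congr {a b : ℕ → Alg M} {ha : BddA a} {hb : BddA b} (h : ∀ n, a n = b n) :
    (AsyAlg.mk a ha : AsyAlg tr) = AsyAlg.mk b hb := by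
  obtain rfl : a = b := funext h
  rfl

theorem AsyAlg.mk_add {a b : ℕ → Alg M} (ha : BddA a) (hb : BddA b) :
    (AsyAlg.mk a ha : AsyAlg tr) + AsyAlg.mk b hb = AsyAlg.mk _ (ha.add hb) := rfl

theorem AsyAlg.mk_mul {a b : ℕ → Alg M} (ha : BddA a) (hb : BddA b) :
    (AsyAlg.mk a ha : AsyAlg tr) * AsyAlg.mk b hb = AsyAlg.mk _ (ha.mul hb) := rfl

instance : Star (AsyAlg tr) where
  star := Quotient.map (fun a => ⟨fun n => star (a.1 n), BddA.star a.2⟩) (fun a b h => by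
    have := NullA.star hM.out.isPosTrace h
    simp only [star_sub] at this
    exact this)

instance : StarRing (AsyAlg tr) where
  star_involutive x := AsyAlg.ind (p := fun x => star (star x) = x) (fun a _ =>
    AsyAlg.mk_congr fun n => star_star (a n)) x
  star_mul x y := AsyAlg.ind (p := fun x => star (x * y) = star y * star x) (fun a _ =>
    AsyAlg.ind (p := fun y => star (AsyAlg.mk a _ * y) = star y * star (AsyAlg.mk a _)) (fun b _ =>
      AsyAlg.mk_congr fun n => star_mul (a n) (b n)) y) x
  star_add x y := AsyAlg.ind (p := fun x => star (x + y) = star x + star y) (fun a _ =>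
    AsyAlg.ind (p := fun y => star (AsyAlg.mk a _ + y) = star (AsyAlg.mk a _) + star y) (fun b _ =>
      AsyAlg.mk_congr fun n => star_add (a n) (b n)) y) x

variable (tr) in
/-- Constant sequences. -/
def constA : Alg M →+* AsyAlg tr where
  toFun a := AsyAlg.mk _ (BddA.const a)
  map_one' := rfl
  map_mul' _ _ := rfl
  map_zero' := rfl
  map_add' _ _ := rfl

theorem star_constA (a : Alg M) : star (constA tr a) = constA tr (star a) := rfl

/-- The bounded sequences in a bimodule. -/
def bddGrp (X : Bim M) : AddSubgroup (ℕ → X) where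
  carrier := {x | BddX X x}
  add_mem' hx hy := hx.add hy
  zero_mem' := BddX.const 0
  neg_mem' hx := hx.neg

variable (tr) in
/-- The null sequences among the bounded sequences in a bimodule. -/
def nullGrp (X : Bim M) : AddSubgroup (bddGrp X) where
  carrier := {x | NullX tr X x.1}
  add_mem' hx hy := NullX.add hM.out.isPosTrace hx hy
  zero_mem' := fun z => by simpa using NullA.zero
  neg_mem' hx := NullX.neg hx

variable (tr) in
/-- Bounded sequences in a bimodule modulo null sequences. -/
def Asy (X : Bim M) : Type u := bddGrp X ⧸ nullGrp tr X

instance (X : Bim M) : AddCommGroup (Asy tr X) :=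
  inferInstanceAs (AddCommGroup (bddGrp X ⧸ nullGrp tr X))

namespace Asy

variable {X Y Z W : Bim M}

/-- The class of a bounded sequence. -/
def mk (x : ℕ → X) (hx : BddX X x) : Asy tr X := QuotientAddGroup.mk (⟨x, hx⟩ : bddGrp X)

theorem ind {p : Asy tr X → Prop} (h : ∀ x hx, p (mk x hx)) (x : Asy tr X) : p x :=
  Quotient.ind (fun a => h a.1 a.2) x

theorem mk_eq {x y : ℕ → X} {hx : BddX X x} {hy : BddX X y} :
    (mk x hx : Asy tr X) = mk y hy ↔ NullX tr X fun n => x n - y n := by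
  refine eq_comm.trans (QuotientAddGroup.eq.trans ?_)
  change NullX tr X (fun n => -y n + x n) ↔ _
  simp only [neg_add_eq_sub]

theorem mk_congr {x y : ℕ → X} {hx : BddX X x} {hy : BddX X y} (h : ∀ n, x n = y n) :
    (mk x hx : Asy tr X) = mk y hy := by
  obtain rfl : x = y := funext h
  rfl

theorem mk_add {x y : ℕ → X} (hx : BddX X x) (hy : BddX X y) :
    (mk x hx : Asy tr X) + mk y hy = mk _ (hx.add hy) := rfl

theorem mk_sum {ι : Type*} (s : Finset ι) {x : ι → ℕ → X} (hx : ∀ i, BddX X (x i)) :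
    ∑ i ∈ s, (mk (x i) (hx i) : Asy tr X) = mk _ (BddX.sum s hx) := by
  classical
  induction s using Finset.induction_on with
  | empty => exact mk_congr (tr := tr) fun n => by simp
  | insert i s hi ih =>
    rw [Finset.sum_insert hi, ih, mk_add]
    exact mk_congr fun n => by simp [Finset.sum_insert hi]

theorem rel_iff {x y : bddGrp X} :
    (QuotientAddGroup.leftRel (nullGrp tr X)) x y ↔ NullX tr X fun n => x.1 n - y.1 n := by
  rw [QuotientAddGroup.leftRel_apply]
  change NullX tr X (fun n => -x.1 n + y.1 n) ↔ _
  constructor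
  · intro h; simpa [sub_eq_add_neg, add_comm] using h.neg
  · intro h; simpa [sub_eq_add_neg, add_comm] using h.neg

instance : SMul (AsyAlg tr) (Asy tr X) where
  smul := Quotient.map₂ (fun a x => ⟨fun n => X.lact (a.1 n) (x.1 n), BddX.lact a.2 x.2⟩)
    (fun a b (hab : NullA tr fun n => a.1 n - b.1 n) x y hxy => by
      have h := (NullX.lact_left hM.out (a.2.sub b.2) hab x.2).add hM.out.isPosTrace
        (NullX.lact_right hM.out.isPosTrace b.2 (rel_iff.1 hxy))
      refine rel_iff.2 ?_
      simpa using h)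

theorem smul_mk {a : ℕ → Alg M} {x : ℕ → X} (ha : BddA a) (hx : BddX X x) :
    (AsyAlg.mk a ha : AsyAlg tr) • (mk x hx : Asy tr X) = mk _ (hx.lact ha) := rfl

/-- The right action as a function. -/
def ractFun : Asy tr X → AsyAlg tr → Asy tr X :=
  Quotient.map₂ (fun x a => (⟨fun n => X.ract (x.1 n) (a.1 n), BddX.ract x.2 a.2⟩ : bddGrp X))
    (fun x y hxy a b (hab : NullA tr fun n => a.1 n - b.1 n) => by
      have h := (NullX.ract_right hM.out.isPosTrace x.2 hab).add hM.out.isPosTrace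
        (NullX.ract_left hM.out.isPosTrace (rel_iff.1 hxy) b.2)
      refine rel_iff.2 ?_
      simpa using h)

instance : SMul (AsyAlg tr)ᵐᵒᵖ (Asy tr X) where
  smul a x := ractFun x a.unop

open scoped RightActions

theorem mk_smul {a : ℕ → Alg M} {x : ℕ → X} (ha : BddA a) (hx : BddX X x) :
    (mk x hx : Asy tr X) <• (AsyAlg.mk a ha : AsyAlg tr) = mk _ (hx.ract ha) := rfl

instance : Module (AsyAlg tr) (Asy tr X) where
  one_smul x := ind (p := fun x => (1 : AsyAlg tr) • x = x) (fun x _ =>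
    mk_congr fun n => X.one_lact (x n)) x
  mul_smul a b x := ind (p := fun x => (a * b) • x = a • b • x) (fun x hx =>
    AsyAlg.ind (p := fun a => (a * b) • mk x hx = a • b • mk x hx) (fun a ha =>
    AsyAlg.ind (p := fun b => (AsyAlg.mk a ha * b) • mk x hx = AsyAlg.mk a ha • b • mk x hx)
    (fun b _ => mk_congr fun n => X.mul_lact (a n) (b n) (x n)) b) a) x
  smul_zero a := AsyAlg.ind (p := fun a => a • (0 : Asy tr X) = 0)
    (fun a _ => mk_congr fun n => map_zero (X.lact (a n))) a
  zero_smul x := ind (p := fun x => (0 : AsyAlg tr) • x = 0) (fun x _ =>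
    mk_congr fun n => by simp) x
  smul_add a x y := ind (p := fun x => a • (x + y) = a • x + a • y) (fun x hx =>
    AsyAlg.ind (p := fun a => a • (mk x hx + y) = a • mk x hx + a • y) (fun a ha =>
    ind (p := fun y => AsyAlg.mk a ha • (mk x hx + y) = AsyAlg.mk a ha • mk x hx
      + AsyAlg.mk a ha • y) (fun y _ => mk_congr fun n => map_add (X.lact (a n)) _ _) y) a) x
  add_smul a b x := ind (p := fun x => (a + b) • x = a • x + b • x) (fun x hx =>
    AsyAlg.ind (p := fun a => (a + b) • mk x hx = a • mk x hx + b • mk x hx) (fun a ha =>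
    AsyAlg.ind (p := fun b => (AsyAlg.mk a ha + b) • mk x hx = AsyAlg.mk a ha • mk x hx
      + b • mk x hx) (fun b _ => mk_congr fun n => by simp) b) a) x

instance : Module (AsyAlg tr)ᵐᵒᵖ (Asy tr X) where
  one_smul x := ind (p := fun x => x <• (1 : AsyAlg tr) = x) (fun x _ =>
    mk_congr fun n => X.ract_one (x n)) x
  mul_smul a b x := ind (p := fun x => x <• (b.unop * a.unop) = x <• b.unop <• a.unop) (fun x hx =>
    AsyAlg.ind (p := fun a => mk x hx <• (b.unop * a) = mk x hx <• b.unop <• a) (fun a ha =>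
    AsyAlg.ind (p := fun b => mk x hx <• (b * AsyAlg.mk a ha) = mk x hx <• b <• AsyAlg.mk a ha)
    (fun b _ => mk_congr fun n => X.ract_mul (x n) (b n) (a n)) b.unop) a.unop) x
  smul_zero a := AsyAlg.ind (p := fun a => (0 : Asy tr X) <• a = 0)
    (fun a _ => mk_congr fun n => LinearMap.congr_fun (map_zero X.ract) (a n)) a.unop
  zero_smul x := ind (p := fun x => x <• (0 : AsyAlg tr) = 0) (fun x _ =>
    mk_congr fun n => map_zero (X.ract (x n))) x
  smul_add a x y := ind (p := fun x => (x + y) <• a.unop = x <• a.unop + y <• a.unop) (fun x hx =>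
    AsyAlg.ind (p := fun a => (mk x hx + y) <• a = mk x hx <• a + y <• a) (fun a ha =>
    ind (p := fun y => (mk x hx + y) <• AsyAlg.mk a ha = mk x hx <• AsyAlg.mk a ha
      + y <• AsyAlg.mk a ha) (fun y _ => mk_congr fun n =>
        LinearMap.congr_fun (map_add X.ract (x n) (y n)) (a n)) y) a.unop) x
  add_smul a b x := ind (p := fun x => x <• (a.unop + b.unop) = x <• a.unop + x <• b.unop)
    (fun x hx =>
    AsyAlg.ind (p := fun a => mk x hx <• (a + b.unop) = mk x hx <• a + mk x hx <• b.unop)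
    (fun a ha =>
    AsyAlg.ind (p := fun b => mk x hx <• (AsyAlg.mk a ha + b) = mk x hx <• AsyAlg.mk a ha
      + mk x hx <• b) (fun b _ => mk_congr fun n => map_add (X.ract (x n)) (a n) (b n))
        b.unop) a.unop) x

theorem smul_ract (a : AsyAlg tr) (x : Asy tr X) (b : AsyAlg tr) : a • (x <• b) = (a • x) <• b :=
  ind (p := fun x => a • (x <• b) = (a • x) <• b) (fun x hx =>
    AsyAlg.ind (p := fun a => a • (mk x hx <• b) = (a • mk x hx) <• b) (fun a ha =>
    AsyAlg.ind (p := fun b => AsyAlg.mk a ha • (mk x hx <• b) = (AsyAlg.mk a ha • mk x hx) <• b)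
    (fun b _ => mk_congr fun n => X.lact_ract (a n) (x n) (b n)) b) a) x

theorem ract_mul (x : Asy tr X) (a b : AsyAlg tr) : x <• (a * b) = x <• a <• b := by
  rw [MulOpposite.op_mul, mul_smul]

/-- The inner product on sequences as a function. -/
def innerFun : Asy tr X → Asy tr X → AsyAlg tr :=
  Quotient.map₂ (fun x y => (⟨fun n => X.inner (x.1 n) (y.1 n), BddX.inner x.2 y.2⟩ : bddRing M))
    (fun x x' hx y y' hy => by
      have h := ((rel_iff.1 hx).inner_left hM.out.isPosTrace y.2).add hM.out.isPosTrace
        (NullX.inner_right hM.out.isPosTrace x'.2 (rel_iff.1 hy))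
      change NullA tr fun n => X.inner (x.1 n) (y.1 n) - X.inner (x'.1 n) (y'.1 n)
      simpa using h)

theorem innerFun_mk {x y : ℕ → X} (hx : BddX X x) (hy : BddX X y) :
    innerFun (mk x hx : Asy tr X) (mk y hy) = AsyAlg.mk _ (hx.inner hy) := rfl

/-- The `AsyAlg`-valued inner product of sequences. -/
def inner : Asy tr X →+ Asy tr X →+ AsyAlg tr :=
  AddMonoidHom.mk' (fun x => AddMonoidHom.mk' (fun y => innerFun x y) (fun y z => by
      induction x using ind with | _ x hx
      induction y using ind with | _ y hy
      induction z using ind with | _ z hz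
      rw [mk_add, innerFun_mk, innerFun_mk, innerFun_mk, AsyAlg.mk_add]
      exact AsyAlg.mk_congr fun n => map_add (X.inner (x n)) (y n) (z n)))
    (fun x y => AddMonoidHom.ext fun z => by
      change innerFun (x + y) z = innerFun x z + innerFun y z
      induction x using ind with | _ x hx
      induction y using ind with | _ y hy
      induction z using ind with | _ z hz
      rw [mk_add, innerFun_mk, innerFun_mk, innerFun_mk, AsyAlg.mk_add]
      exact AsyAlg.mk_congr fun n => LinearMap.congr_fun (map_add X.inner (x n) (y n)) (z n))

theorem inner_mk {x y : ℕ → X} (hx : BddX X x) (hy : BddX X y) :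
    inner (mk x hx : Asy tr X) (mk y hy) = AsyAlg.mk _ (hx.inner hy) := rfl

theorem star_inner (x y : Asy tr X) : star (inner x y) = inner y x :=
  ind (p := fun x => star (inner x y) = inner y x) (fun x hx =>
    ind (p := fun y => star (inner (mk x hx) y) = inner y (mk x hx)) (fun y _ =>
      AsyAlg.mk_congr fun n => X.star_inner (x n) (y n)) y) x

theorem inner_ract (x y : Asy tr X) (a : AsyAlg tr) : inner x (y <• a) = inner x y * a :=
  ind (p := fun x => inner x (y <• a) = inner x y * a) (fun x hx =>
    ind (p := fun y => inner (mk x hx) (y <• a) = inner (mk x hx) y * a) (fun y hy =>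
    AsyAlg.ind (p := fun a => inner (mk x hx) (mk y hy <• a) = inner (mk x hx) (mk y hy) * a)
    (fun a _ => AsyAlg.mk_congr fun n => X.inner_ract (x n) (y n) (a n)) a) y) x

theorem inner_ract_left (x y : Asy tr X) (a : AsyAlg tr) :
    inner (x <• a) y = star a * inner x y := by
  rw [← star_inner, inner_ract, star_mul, star_inner]

theorem inner_smul (x y : Asy tr X) (a : AsyAlg tr) : inner (a • x) y = inner x (star a • y) :=
  ind (p := fun x => inner (a • x) y = inner x (star a • y)) (fun x hx =>
    ind (p := fun y => inner (a • mk x hx) y = inner (mk x hx) (star a • y)) (fun y hy =>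
    AsyAlg.ind (p := fun a => inner (a • mk x hx) (mk y hy) = inner (mk x hx) (star a • mk y hy))
    (fun a _ => AsyAlg.mk_congr fun n => X.inner_lact (a n) (x n) (y n)) a) y) x

/-- The tensor product of sequences as a function. -/
def tmFun : Asy tr X → Asy tr Y → Asy tr (Bim.tensor X Y) :=
  Quotient.map₂ (fun x y => (⟨fun n => Bim.tm (x.1 n) (y.1 n), BddX.tm x.2 y.2⟩ :
      bddGrp (Bim.tensor X Y)))
    (fun x x' hx y y' hy => by
      have h := (NullX.tm_left hM.out (x.2.sub x'.2) (rel_iff.1 hx) y.2).add hM.out.isPosTrace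
        (NullX.tm_right hM.out.isPosTrace x'.2 (rel_iff.1 hy))
      refine rel_iff.2 ?_
      have e : ∀ n, Bim.tm (x.1 n - x'.1 n) (y.1 n) + Bim.tm (x'.1 n) (y.1 n - y'.1 n)
          = Bim.tm (x.1 n) (y.1 n) - Bim.tm (x'.1 n) (y'.1 n) := fun n => by
        have h1 : Bim.tm (x.1 n - x'.1 n) (y.1 n) = Bim.tm (x.1 n) (y.1 n) - Bim.tm (x'.1 n) (y.1 n) :=
          LinearMap.congr_fun (map_sub (Bim.tmL X Y) _ _) _
        have h2 : Bim.tm (x'.1 n) (y.1 n - y'.1 n)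
            = Bim.tm (x'.1 n) (y.1 n) - Bim.tm (x'.1 n) (y'.1 n) :=
          map_sub (Bim.tmL X Y (x'.1 n)) _ _
        rw [h1, h2]; abel
      simpa only [e] using h)

theorem tmFun_mk {x : ℕ → X} {y : ℕ → Y} (hx : BddX X x) (hy : BddX Y y) :
    tmFun (mk x hx : Asy tr X) (mk y hy) = mk _ (hx.tm hy) := rfl

/-- The tensor product of sequences. -/
def tm : Asy tr X →+ Asy tr Y →+ Asy tr (Bim.tensor X Y) :=
  AddMonoidHom.mk' (fun x => AddMonoidHom.mk' (fun y => tmFun x y) (fun y z => by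
      induction x using ind with | _ x hx
      induction y using ind with | _ y hy
      induction z using ind with | _ z hz
      rw [mk_add, tmFun_mk, tmFun_mk, tmFun_mk, mk_add]
      exact mk_congr fun n => Bim.tm_add (x n) (y n) (z n)))
    (fun x y => AddMonoidHom.ext fun z => by
      change tmFun (x + y) z = tmFun x z + tmFun y z
      induction x using ind with | _ x hx
      induction y using ind with | _ y hy
      induction z using ind with | _ z hz
      rw [mk_add, tmFun_mk, tmFun_mk, tmFun_mk, mk_add]
      exact mk_congr fun n => Bim.add_tm (x n) (y n) (z n))

theorem tm_mk {x : ℕ → X} {y : ℕ → Y} (hx : BddX X x) (hy : BddX Y y) :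
    tm (mk x hx : Asy tr X) (mk y hy) = mk _ (hx.tm hy) := rfl

theorem tm_balanced (x : Asy tr X) (a : AsyAlg tr) (y : Asy tr Y) :
    tm (x <• a) y = tm x (a • y) :=
  ind (p := fun x => tm (x <• a) y = tm x (a • y)) (fun x hx =>
    ind (p := fun y => tm (mk x hx <• a) y = tm (mk x hx) (a • y)) (fun y hy =>
    AsyAlg.ind (p := fun a => tm (mk x hx <• a) (mk y hy) = tm (mk x hx) (a • mk y hy))
    (fun a _ => mk_congr fun n => Bim.tm_balanced (x n) (a n) (y n)) a) y) x

theorem smul_tm (x : Asy tr X) (a : AsyAlg tr) (y : Asy tr Y) : a • tm x y = tm (a • x) y :=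
  ind (p := fun x => a • tm x y = tm (a • x) y) (fun x hx =>
    ind (p := fun y => a • tm (mk x hx) y = tm (a • mk x hx) y) (fun y hy =>
    AsyAlg.ind (p := fun a => a • tm (mk x hx) (mk y hy) = tm (a • mk x hx) (mk y hy))
    (fun a _ => mk_congr fun n => Bim.lact_tm (a n) (x n) (y n)) a) y) x

theorem ract_tm (x : Asy tr X) (y : Asy tr Y) (a : AsyAlg tr) : tm x y <• a = tm x (y <• a) :=
  ind (p := fun x => tm x y <• a = tm x (y <• a)) (fun x hx =>
    ind (p := fun y => tm (mk x hx) y <• a = tm (mk x hx) (y <• a)) (fun y hy =>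
    AsyAlg.ind (p := fun a => tm (mk x hx) (mk y hy) <• a = tm (mk x hx) (mk y hy <• a))
    (fun a _ => mk_congr fun n => Bim.ract_tm (x n) (y n) (a n)) a) y) x

theorem inner_tm (x x₂ : Asy tr X) (y y₂ : Asy tr Y) :
    inner (tm x y) (tm x₂ y₂) = inner y (inner x x₂ • y₂) :=
  ind (p := fun x => inner (tm x y) (tm x₂ y₂) = inner y (inner x x₂ • y₂)) (fun x hx =>
    ind (p := fun y => inner (tm (mk x hx) y) (tm x₂ y₂) = inner y (inner (mk x hx) x₂ • y₂))
    (fun y hy => ind (p := fun x₂ => inner (tm (mk x hx) (mk y hy)) (tm x₂ y₂)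
      = inner (mk y hy) (inner (mk x hx) x₂ • y₂)) (fun x₂ hx₂ =>
    ind (p := fun y₂ => inner (tm (mk x hx) (mk y hy)) (tm (mk x₂ hx₂) y₂)
      = inner (mk y hy) (inner (mk x hx) (mk x₂ hx₂) • y₂)) (fun _ _ => rfl) y₂) x₂) y) x

/-- A morphism applied to sequences, as a function. -/
def mapFun (f : X ⟶ Y) : Asy tr X → Asy tr Y :=
  Quotient.map (fun x => (⟨fun n => Bim.lin f (x.1 n), BddX.map f x.2⟩ : bddGrp Y))
    (fun x y hxy => rel_iff.2 (by simpa only [map_sub] using (rel_iff.1 hxy).map f))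

theorem mapFun_mk (f : X ⟶ Y) {x : ℕ → X} (hx : BddX X x) :
    mapFun f (mk x hx : Asy tr X) = mk _ (hx.map f) := rfl

/-- A morphism applied to sequences. -/
def map (f : X ⟶ Y) : Asy tr X →+ Asy tr Y :=
  AddMonoidHom.mk' (mapFun f) (fun x y => by
    induction x using ind with | _ x hx
    induction y using ind with | _ y hy
    rw [mk_add, mapFun_mk, mapFun_mk, mapFun_mk, mk_add]
    exact mk_congr fun n => map_add (Bim.lin f) (x n) (y n))

theorem map_smul (f : X ⟶ Y) (a : AsyAlg tr) (x : Asy tr X) : map f (a • x) = a • map f x :=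
  ind (p := fun x => map f (a • x) = a • map f x) (fun x hx =>
    AsyAlg.ind (p := fun a => map f (a • mk x hx) = a • map f (mk x hx))
    (fun a _ => mk_congr fun n => f.map_lact (a n) (x n)) a) x

theorem map_ract (f : X ⟶ Y) (a : AsyAlg tr) (x : Asy tr X) : map f (x <• a) = map f x <• a :=
  ind (p := fun x => map f (x <• a) = map f x <• a) (fun x hx =>
    AsyAlg.ind (p := fun a => map f (mk x hx <• a) = map f (mk x hx) <• a)
    (fun a _ => mk_congr fun n => f.map_ract (x n) (a n)) a) x

theorem map_comp (f : X ⟶ Y) (g : Y ⟶ Z) (x : Asy tr X) : map (f ≫ g) x = map g (map f x) :=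
  ind (p := fun x => map (f ≫ g) x = map g (map f x)) (fun _ _ => rfl) x

theorem map_tensorMap {X' Y' : Bim M} (f : X ⟶ X') (g : Y ⟶ Y') (x : Asy tr X) (y : Asy tr Y) :
    map (Bim.tensorMap f g) (tm x y) = tm (map f x) (map g y) :=
  ind (p := fun x => map (Bim.tensorMap f g) (tm x y) = tm (map f x) (map g y)) (fun x hx =>
    ind (p := fun y => map (Bim.tensorMap f g) (tm (mk x hx) y) = tm (map f (mk x hx)) (map g y))
      (fun _ _ => rfl) y) x

theorem map_id (x : Asy tr X) : map (𝟙 X) x = x :=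
  ind (p := fun x => map (𝟙 X) x = x) (fun _ _ => rfl) x

theorem map_assocHom (x : Asy tr X) (y : Asy tr Y) (z : Asy tr Z) :
    map (Bim.assocHom X Y Z) (tm (tm x y) z) = tm x (tm y z) :=
  ind (p := fun x => map (Bim.assocHom X Y Z) (tm (tm x y) z) = tm x (tm y z)) (fun x hx =>
    ind (p := fun y => map (Bim.assocHom X Y Z) (tm (tm (mk x hx) y) z) = tm (mk x hx) (tm y z))
      (fun y hy => ind (p := fun z => map (Bim.assocHom X Y Z) (tm (tm (mk x hx) (mk y hy)) z)
        = tm (mk x hx) (tm (mk y hy) z)) (fun _ _ => rfl) z) y) x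

theorem map_assocHom_dagger (x : Asy tr X) (y : Asy tr Y) (z : Asy tr Z) :
    map (Bim.dagger (Bim.assocHom X Y Z)) (tm x (tm y z)) = tm (tm x y) z :=
  ind (p := fun x => map (Bim.dagger (Bim.assocHom X Y Z)) (tm x (tm y z)) = tm (tm x y) z)
    (fun x hx => ind (p := fun y => map (Bim.dagger (Bim.assocHom X Y Z)) (tm (mk x hx) (tm y z))
        = tm (tm (mk x hx) y) z)
      (fun y hy => ind (p := fun z => map (Bim.dagger (Bim.assocHom X Y Z))
          (tm (mk x hx) (tm (mk y hy) z)) = tm (tm (mk x hx) (mk y hy)) z)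
        (fun _ _ => rfl) z) y) x

variable (tr) in
/-- Constant sequences. -/
def const : X →+ Asy tr X := AddMonoidHom.mk' (fun x => mk _ (BddX.const x)) fun _ _ => rfl

theorem const_ract (x : X) (a : Alg M) : const tr (X.ract x a) = const tr x <• constA tr a := rfl

theorem const_lact (a : Alg M) (x : X) : const tr (X.lact a x) = constA tr a • const tr x := rfl

theorem const_inner (x y : X) : constA tr (X.inner x y) = inner (const tr x) (const tr y) := rfl

theorem const_tm (x : X) (y : Y) : const tr (Bim.tm x y) = tm (const tr x) (const tr y) := rfl

theorem map_const (f : X ⟶ Y) (x : X) : map f (const tr x) = const tr (Bim.lin f x) := rfl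

theorem ext_const {x y : Asy tr X}
    (h : ∀ z : X, inner (const tr z) x = inner (const tr z) y) : x = y := by
  induction x using ind with | _ x hx
  induction y using ind with | _ y hy
  refine mk_eq.2 fun z => ?_
  simpa using AsyAlg.mk_eq.1 (h z)

theorem ext_inner {x y : Asy tr X} (h : ∀ z : Asy tr X, inner z x = inner z y) : x = y :=
  ext_const fun _ => h _

theorem const_injective : Function.Injective (const tr : X → Asy tr X) := fun x y h => by
  have h1 : NullX tr X fun _ => x - y := mk_eq.1 h
  refine X.ext_inner fun z => ?_
  have h2 : twoSq tr (X.inner z (x - y)) = 0 := tendsto_nhds_unique tendsto_const_nhds (h1 z)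
  have h3 := hM.out.tr_faithful (X.inner z (x - y))
    (by rw [hM.out.isPosTrace.eq_re (star_mul_self_nonneg _)]; exact_mod_cast h2)
  rwa [map_sub, sub_eq_zero] at h3

theorem constA_injective : Function.Injective (constA tr) := fun a b h => by
  have h1 : NullA tr fun _ => a - b := AsyAlg.mk_eq.1 h
  have h2 : twoSq tr (a - b) = 0 := tendsto_nhds_unique tendsto_const_nhds h1
  have h3 := hM.out.tr_faithful (a - b)
    (by rw [hM.out.isPosTrace.eq_re (star_mul_self_nonneg _)]; exact_mod_cast h2)
  rwa [sub_eq_zero] at h3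

theorem sum_basis {k : ℕ} {b : Fin k → X} (hb : IsBasis X b) (x : Asy tr X) :
    ∑ i, const tr (b i) <• inner (const tr (b i)) x = x := by
  induction x using ind with | _ x hx
  refine (mk_sum (tr := tr) Finset.univ fun i => (BddX.const (b i)).ract (hx (b i))).trans ?_
  exact mk_congr fun n => hb (x n)

end Asy

end

section

open Filter Topology
variable {tr : Alg M →ₗ[ℂ] ℂ} [hM : Fact (IsIIOneFactor M tr)]

open scoped RightActions

namespace Asy

variable {X Y Z W : Bim M}

/-- Sequences in a bimodule that asymptotically commute with `M`. -/
def Commuting (ξ : Asy tr X) : Prop := ∀ a : Alg M, constA tr a • ξ = ξ <• constA tr a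

theorem ind_const {p : Asy tr X → Prop} (h : ∀ x, p (const tr x))
    (hadd : ∀ s t, p s → p t → p (s + t)) (hr : ∀ t (a : AsyAlg tr), p t → p (t <• a))
    (t : Asy tr X) : p t := by
  obtain ⟨k, b, hb⟩ := X.exists_basis
  rw [← sum_basis hb t]
  exact Finset.sum_induction _ p hadd (by simpa using h 0) fun i _ => hr _ _ (h _)

theorem ind_tm {p : Asy tr (Bim.tensor X Y) → Prop}
    (h : ∀ x y, p (tm (const tr x) (const tr y)))
    (hadd : ∀ s t, p s → p t → p (s + t)) (hr : ∀ t (a : AsyAlg tr), p t → p (t <• a))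
    (t : Asy tr (Bim.tensor X Y)) : p t :=
  ind_const (fun t => Bim.ind2 (p := fun t => p (const tr t)) h
    (by simpa using h 0 0) (fun s t hs ht => by rw [map_add]; exact hadd _ _ hs ht) t) hadd hr t

theorem Commuting.inner {ξ η : Asy tr X} (hξ : Commuting ξ) (hη : Commuting η) (a : Alg M) :
    constA tr a * inner ξ η = inner ξ η * constA tr a := by
  rw [← inner_ract, ← hη a]
  have h := hξ (star a)
  rw [← star_constA] at h
  have h2 := inner_smul ξ η (star (constA tr a))
  rw [star_star] at h2
  rw [← h2, h, inner_ract_left, star_star]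

theorem Commuting.tm {ξ : Asy tr X} {η : Asy tr Y} (hξ : Commuting ξ) (hη : Commuting η) :
    Commuting (tm ξ η) := fun a => by
  rw [smul_tm, hξ, tm_balanced, hη, ract_tm]

theorem Commuting.map {ξ : Asy tr X} (hξ : Commuting ξ) (f : X ⟶ Y) : Commuting (map f ξ) :=
  fun a => by rw [← map_smul, hξ, map_ract]

/-- A basis of the sequence module consisting of sequences asymptotically commuting with `M`. -/
structure IsAsyBasis {ι : Type*} [Fintype ι] (β : ι → Asy tr X) : Prop where
  comm : ∀ i, Commuting (β i)
  sum : ∀ x : Asy tr X, ∑ i, β i <• inner (β i) x = x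

theorem isAsyBasis_of_const {ι : Type*} [Fintype ι] {β : ι → Asy tr X}
    (hc : ∀ i, Commuting (β i)) (h : ∀ x : X, ∑ i, β i <• inner (β i) (const tr x) = const tr x) :
    IsAsyBasis β where
  comm := hc
  sum := ind_const h (fun s t hs ht => by
      simp only [map_add, MulOpposite.op_add, add_smul, Finset.sum_add_distrib, hs, ht])
    (fun t a ht => by
      simp only [inner_ract, ract_mul]
      rw [← Finset.smul_sum, ht])

theorem IsAsyBasis.reindex {ι κ : Type*} [Fintype ι] [Fintype κ] {β : ι → Asy tr X}
    (hβ : IsAsyBasis β) (e : κ ≃ ι) : IsAsyBasis (β ∘ e) where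
  comm _ := hβ.comm _
  sum x := (e.sum_comp fun i => β i <• inner (β i) x).trans (hβ.sum x)

theorem IsAsyBasis.tm {ι κ : Type*} [Fintype ι] [Fintype κ] {β : ι → Asy tr X} {γ : κ → Asy tr Y}
    (hβ : IsAsyBasis β) (hγ : IsAsyBasis γ) :
    IsAsyBasis fun p : ι × κ => Asy.tm (β p.1) (γ p.2) where
  comm p := (hβ.comm _).tm (hγ.comm _)
  sum t := by
    rw [Fintype.sum_prod_type]
    refine ind_tm (p := fun t => ∑ i, ∑ j, Asy.tm (β i) (γ j) <• inner (Asy.tm (β i) (γ j)) t = t)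
      (fun x y => ?_) (fun s t hs ht => ?_) (fun t a ht => ?_) t
    · have h : ∀ i, ∑ j, Asy.tm (β i) (γ j) <• inner (Asy.tm (β i) (γ j))
          (Asy.tm (const tr x) (const tr y))
          = Asy.tm (β i <• inner (β i) (const tr x)) (const tr y) := fun i => by
        simp only [inner_tm, ract_tm]
        rw [← map_sum, hγ.sum, tm_balanced]
      rw [Finset.sum_congr rfl fun i _ => h i, ← AddMonoidHom.finsetSum_apply, ← map_sum, hβ.sum]
    · simp only [map_add, MulOpposite.op_add, add_smul, Finset.sum_add_distrib, hs, ht]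
    · simp only [inner_ract, ract_mul, ← Finset.smul_sum, ht]

theorem isAsyBasis_pad {k : ℕ → ℕ} {b : ∀ n, Fin (k n) → X} (hb : IsApproxInnerBasis tr X k b)
    {K : ℕ} (hK : ∀ n, k n ≤ K) :
    IsAsyBasis fun i : Fin K => (mk (pad b i) (bddX_pad hb i) : Asy tr X) := by
  refine isAsyBasis_of_const (fun i a => ?_) (fun x => ?_)
  · refine mk_eq.2 ((nullX_iff hM.out.isPosTrace).2 ?_)
    refine squeeze_zero (fun n => Real.sqrt_nonneg _) (fun n => ?_) (hb.approx_comm a)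
    rw [← sum_pad b hK (fun x => twoNorm tr X (X.lact a x - X.ract x a)) (by simp [twoNorm])]
    exact Finset.single_le_sum (f := fun i => twoNorm tr X
      (X.lact a (pad b i n) - X.ract (pad b i n) a)) (fun i _ => Real.sqrt_nonneg _)
      (Finset.mem_univ i)
  · refine (mk_sum (tr := tr) Finset.univ (x := fun i n => X.ract (pad b i n) (X.inner (pad b i n) x))
      fun i => (bddX_pad hb i).ract ((bddX_pad hb i).inner (BddX.const x))).trans ?_
    refine mk_eq.2 ?_
    have h := ((nullX_iff hM.out.isPosTrace).2 (hb.approx_basis x)).neg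
    simp only [← fun n => sum_pad b hK (fun y => X.ract y (X.inner y x)) (by simp) n] at h
    simpa using h

theorem IsAsyBasis.approximatelyInner_of_fin {K : ℕ} {β : Fin K → Asy tr X}
    (hβ : IsAsyBasis β) : ApproximatelyInner tr X := by
  have h1 : ∀ i, ∃ (x : ℕ → X) (hx : BddX X x), β i = Asy.mk x hx :=
    fun i => ind (p := fun y => ∃ (x : ℕ → X) (hx : BddX X x), y = Asy.mk x hx)
      (fun x hx => ⟨x, hx, rfl⟩) _
  choose x hx h using h1
  obtain rfl : β = fun i => Asy.mk (x i) (hx i) := funext h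
  refine ⟨fun _ => K, fun n i => x i n, ⟨⟨K, fun _ => le_rfl⟩, ?_, fun y => ?_, fun a => ?_⟩⟩
  · choose C hC using fun i => bddX_iff.1 (hx i)
    refine ⟨∑ i, |C i|, fun n i => (hC i n).trans ((le_abs_self _).trans ?_)⟩
    exact Finset.single_le_sum (f := fun i => |C i|) (fun i _ => abs_nonneg _) (Finset.mem_univ i)
  · rw [← nullX_iff hM.out.isPosTrace]
    refine mk_eq.1 (Eq.symm ?_ : const tr y = Asy.mk _ ?_)
    · exact BddX.sum _ fun i => (hx i).ract ((hx i).inner (BddX.const y))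
    · exact (mk_sum (tr := tr) Finset.univ
        fun i => (hx i).ract ((hx i).inner (BddX.const y))).symm.trans (hβ.sum (const tr y))
  · rw [← Finset.sum_const_zero]
    refine tendsto_finsetSum _ fun i _ => ?_
    rw [← nullX_iff hM.out.isPosTrace]
    exact mk_eq.1 (hβ.comm i a)

theorem IsAsyBasis.approximatelyInner {ι : Type*} [Fintype ι] {β : ι → Asy tr X}
    (hβ : IsAsyBasis β) : ApproximatelyInner tr X :=
  (hβ.reindex (Fintype.equivFin ι).symm).approximatelyInner_of_fin

theorem approximatelyInner_iff :
    ApproximatelyInner tr X ↔ ∃ (K : ℕ) (β : Fin K → Asy tr X), IsAsyBasis β := by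
  constructor
  · rintro ⟨k, b, hb⟩
    obtain ⟨K, hK⟩ := hb.card_bdd
    exact ⟨K, _, isAsyBasis_pad hb hK⟩
  · rintro ⟨K, β, hβ⟩
    exact hβ.approximatelyInner

theorem centrallyTrivial_iff : CentrallyTrivial tr X ↔
    ∀ α : AsyAlg tr, (∀ a, constA tr a * α = α * constA tr a) →
      ∀ x : X, α • const tr x = const tr x <• α := by
  constructor
  · intro h α hα x
    induction α using AsyAlg.ind with | _ a ha
    refine mk_eq.2 ((nullX_iff hM.out.isPosTrace).2 (h a ⟨ha, fun m => ?_⟩ x))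
    rw [← nullA_iff hM.out.isPosTrace]
    exact AsyAlg.mk_eq.1 (hα m).symm
  · rintro h a ⟨ha, hc⟩ x
    rw [← nullX_iff hM.out.isPosTrace]
    refine mk_eq.1 (h (AsyAlg.mk a ha) (fun m => (AsyAlg.mk_eq.2 ?_).symm) x)
    rw [nullA_iff hM.out.isPosTrace]
    exact hc m

theorem _root_.PopaChi.CentrallyTrivial.smul_const (h : CentrallyTrivial tr X) {α : AsyAlg tr}
    (hα : ∀ a, constA tr a * α = α * constA tr a) (x : X) : α • const tr x = const tr x <• α :=
  centrallyTrivial_iff.1 h α hα x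

/-! ### The braiding operator on sequences -/

/-- The operator `∑ |c_j ⊠ β_i⟩⟨β_i ⊠ c_j|`. -/
def braidOp {ι : Type*} [Fintype ι] (β : ι → Asy tr X) {l : ℕ} (c : Fin l → Y)
    (t : Asy tr (Bim.tensor X Y)) : Asy tr (Bim.tensor Y X) :=
  ∑ i, ∑ j, tm (const tr (c j)) (β i) <• inner (tm (β i) (const tr (c j))) t

/-- The operator `∑ |β_i ⊠ c_j⟩⟨c_j ⊠ β_i|`. -/
def braidOpAdj {ι : Type*} [Fintype ι] (β : ι → Asy tr X) {l : ℕ} (c : Fin l → Y)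
    (t : Asy tr (Bim.tensor Y X)) : Asy tr (Bim.tensor X Y) :=
  ∑ i, ∑ j, tm (β i) (const tr (c j)) <• inner (tm (const tr (c j)) (β i)) t

section

variable {ι κ : Type*} [Fintype ι] [Fintype κ] {β : ι → Asy tr X} {β' : κ → Asy tr X}
  {l l' : ℕ} {c : Fin l → Y} {c' : Fin l' → Y}

theorem sum_tm_basis (hβ : IsAsyBasis β) (hc : IsBasis Y c) (t : Asy tr (Bim.tensor X Y)) :
    ∑ i, ∑ j, tm (β i) (const tr (c j)) <• inner (tm (β i) (const tr (c j))) t = t := by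
  refine ind_tm (p := fun t => ∑ i, ∑ j, tm (β i) (const tr (c j)) <•
    inner (tm (β i) (const tr (c j))) t = t) (fun x y => ?_) (fun s t hs ht => ?_)
    (fun t a ht => ?_) t
  · have h : ∀ i, ∑ j, tm (β i) (const tr (c j)) <• inner (tm (β i) (const tr (c j)))
        (tm (const tr x) (const tr y)) = tm (β i <• inner (β i) (const tr x)) (const tr y) :=
      fun i => by
        simp only [inner_tm, ract_tm]
        rw [← map_sum, sum_basis hc, tm_balanced]
    rw [Finset.sum_congr rfl fun i _ => h i, ← AddMonoidHom.finsetSum_apply, ← map_sum, hβ.sum]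
  · simp only [map_add, MulOpposite.op_add, add_smul, Finset.sum_add_distrib, hs, ht]
  · simp only [inner_ract, ract_mul, ← Finset.smul_sum, ht]

theorem sum_tm_basis' (hβ : IsAsyBasis β) (hc : IsBasis Y c) (t : Asy tr (Bim.tensor Y X)) :
    ∑ i, ∑ j, tm (const tr (c j)) (β i) <• inner (tm (const tr (c j)) (β i)) t = t := by
  rw [Finset.sum_comm]
  refine ind_tm (p := fun t => ∑ j, ∑ i, tm (const tr (c j)) (β i) <•
    inner (tm (const tr (c j)) (β i)) t = t) (fun y x => ?_) (fun s t hs ht => ?_)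
    (fun t a ht => ?_) t
  · have h : ∀ j, ∑ i, tm (const tr (c j)) (β i) <• inner (tm (const tr (c j)) (β i))
        (tm (const tr y) (const tr x))
        = tm (const tr (c j) <• inner (const tr (c j)) (const tr y)) (const tr x) :=
      fun j => by
        simp only [inner_tm, ract_tm]
        rw [← map_sum, hβ.sum, tm_balanced]
    rw [Finset.sum_congr rfl fun i _ => h i, ← AddMonoidHom.finsetSum_apply, ← map_sum,
      sum_basis hc]
  · simp only [map_add, MulOpposite.op_add, add_smul, Finset.sum_add_distrib, hs, ht]
  · simp only [inner_ract, ract_mul, ← Finset.smul_sum, ht]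

theorem braidOp_add (s t : Asy tr (Bim.tensor X Y)) :
    braidOp β c (s + t) = braidOp β c s + braidOp β c t := by
  simp only [braidOp, map_add, MulOpposite.op_add, add_smul, Finset.sum_add_distrib]

theorem braidOp_sum {σ : Type*} (S : Finset σ) (t : σ → Asy tr (Bim.tensor X Y)) :
    braidOp β c (∑ k ∈ S, t k) = ∑ k ∈ S, braidOp β c (t k) :=
  map_sum (AddMonoidHom.mk' (braidOp β c) braidOp_add) t S

theorem braidOp_ract (t : Asy tr (Bim.tensor X Y)) (a : AsyAlg tr) :
    braidOp β c (t <• a) = braidOp β c t <• a := by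
  simp only [braidOp, inner_ract, ract_mul, ← Finset.smul_sum]

theorem braidOpAdj_add (s t : Asy tr (Bim.tensor Y X)) :
    braidOpAdj β c (s + t) = braidOpAdj β c s + braidOpAdj β c t := by
  simp only [braidOpAdj, map_add, MulOpposite.op_add, add_smul, Finset.sum_add_distrib]

theorem braidOpAdj_ract (t : Asy tr (Bim.tensor Y X)) (a : AsyAlg tr) :
    braidOpAdj β c (t <• a) = braidOpAdj β c t <• a := by
  simp only [braidOpAdj, inner_ract, ract_mul, ← Finset.smul_sum]

theorem inner_braidOp (s : Asy tr (Bim.tensor X Y)) (t : Asy tr (Bim.tensor Y X)) :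
    inner (braidOp β c s) t = inner s (braidOpAdj β c t) := by
  simp only [braidOp, braidOpAdj, map_sum, AddMonoidHom.finsetSum_apply, inner_ract,
    inner_ract_left, star_inner]

theorem braidOp_tm (hβ : IsAsyBasis β) (hc : IsBasis Y c) (hY : CentrallyTrivial tr Y)
    {ξ : Asy tr X} (hξ : Commuting ξ) (y : Y) :
    braidOp β c (tm ξ (const tr y)) = tm (const tr y) ξ := by
  have h : ∀ i j, tm (const tr (c j)) (β i) <• inner (tm (β i) (const tr (c j))) (tm ξ (const tr y))
      = tm (const tr (c j) <• inner (const tr (c j)) (const tr y)) (β i <• inner (β i) ξ) := by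
    intro i j
    rw [inner_tm, hY.smul_const ((hβ.comm i).inner hξ), inner_ract, ract_mul, ← const_inner,
      tm_balanced, smul_ract, hβ.comm i, ract_tm, ract_tm]
  simp only [braidOp, h]
  rw [Finset.sum_comm]
  simp only [← map_sum, hβ.sum]
  rw [← AddMonoidHom.finsetSum_apply, ← map_sum, sum_basis hc]

theorem braidOp_indep (hβ : IsAsyBasis β) (hβ' : IsAsyBasis β') (hc : IsBasis Y c)
    (hc' : IsBasis Y c') (hY : CentrallyTrivial tr Y) (t : Asy tr (Bim.tensor X Y)) :
    braidOp β c t = braidOp β' c' t := by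
  conv_lhs => rw [← sum_tm_basis hβ' hc' t]
  simp only [braidOp_sum, braidOp_ract, braidOp_tm hβ hc hY (hβ'.comm _)]
  rfl

theorem braidOp_smul (hβ : IsAsyBasis β) (hc : IsBasis Y c)
    (hY : CentrallyTrivial tr Y) (a : Alg M) (t : Asy tr (Bim.tensor X Y)) :
    braidOp β c (constA tr a • t) = constA tr a • braidOp β c t := by
  conv_lhs => rw [← sum_tm_basis hβ hc t]
  simp only [Finset.smul_sum, braidOp_sum, smul_ract, smul_tm, braidOp_ract]
  simp only [hβ.comm _ a, tm_balanced, ← const_lact, braidOp_tm hβ hc hY (hβ.comm _)]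
  simp only [const_lact, ← smul_tm, ← smul_ract, ← Finset.smul_sum]
  rfl

theorem inner_braidOp_braidOp (hβ : IsAsyBasis β) (hc : IsBasis Y c)
    (hY : CentrallyTrivial tr Y) (s t : Asy tr (Bim.tensor X Y)) :
    inner (braidOp β c s) (braidOp β c t) = inner s t := by
  conv_rhs => rw [← sum_tm_basis hβ hc t, ← sum_tm_basis hβ hc s]
  have h : ∀ i j i' j', inner (tm (const tr (c j)) (β i)) (tm (const tr (c j')) (β i'))
      = inner (tm (β i) (const tr (c j))) (tm (β i') (const tr (c j'))) := by
    intro i j i' j'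
    rw [inner_tm, inner_tm, hY.smul_const ((hβ.comm i).inner (hβ.comm i')), inner_ract,
      ← const_inner, hβ.comm i', inner_ract, (hβ.comm i).inner (hβ.comm i')]
  simp only [braidOp, map_sum, AddMonoidHom.finsetSum_apply, inner_ract, inner_ract_left, h]

theorem braidOpAdj_braidOp (hβ : IsAsyBasis β) (hc : IsBasis Y c)
    (hY : CentrallyTrivial tr Y) (t : Asy tr (Bim.tensor X Y)) :
    braidOpAdj β c (braidOp β c t) = t :=
  ext_inner fun z => by rw [← inner_braidOp, inner_braidOp_braidOp hβ hc hY]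

theorem braidOp_braidOpAdj (hβ : IsAsyBasis β) (hc : IsBasis Y c)
    (hY : CentrallyTrivial tr Y) (t : Asy tr (Bim.tensor Y X)) :
    braidOp β c (braidOpAdj β c t) = t := by
  simp only [braidOpAdj, braidOp_sum, braidOp_ract, braidOp_tm hβ hc hY (hβ.comm _)]
  exact sum_tm_basis' hβ hc t

theorem braidOpAdj_indep (hβ : IsAsyBasis β) (hβ' : IsAsyBasis β') (hc : IsBasis Y c)
    (hc' : IsBasis Y c') (hY : CentrallyTrivial tr Y) (t : Asy tr (Bim.tensor Y X)) :
    braidOpAdj β c t = braidOpAdj β' c' t := by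
  rw [← braidOpAdj_braidOp hβ' hc' hY (braidOpAdj β c t), ← braidOp_indep hβ hβ' hc hc' hY,
    braidOp_braidOpAdj hβ hc hY]

end

/-- A class in `Asy` all of whose subsequences agree is constant. -/
theorem exists_const {x : ℕ → X} (hx : BddX X x)
    (h : ∀ s t : ℕ → ℕ, Tendsto s atTop atTop → Tendsto t atTop atTop →
      NullX tr X fun n => x (s n) - x (t n)) :
    ∃ y : X, mk x hx = const tr y := by
  obtain ⟨y, hy⟩ := hM.out.exists_limitX hx h
  exact ⟨y, mk_eq.2 hy⟩

end Asy

end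

section

open Filter Topology
variable {tr : Alg M →ₗ[ℂ] ℂ} [hM : Fact (IsIIOneFactor M tr)]
open scoped RightActions

/-! ### The braiding as a morphism -/

section Braid

variable {X Y Z W : Bim M}

open Asy

theorem bddX_braidSeq {k : ℕ → ℕ} {b : ∀ n, Fin (k n) → X} (hb : IsApproxInnerBasis tr X k b)
    {K l : ℕ} (c : Fin l → Y) (t : Bim.tensor X Y) (i : Fin K) (j : Fin l) :
    BddX (Bim.tensor Y X) fun n => (Bim.tensor Y X).ract (Bim.tm (c j) (pad b i n))
      ((Bim.tensor X Y).inner (Bim.tm (pad b i n) (c j)) t) :=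
  ((BddX.const (c j)).tm (bddX_pad hb i)).ract
    (((bddX_pad hb i).tm (BddX.const (c j))).inner (BddX.const t))

theorem braidOp_pad {k : ℕ → ℕ} {b : ∀ n, Fin (k n) → X} (hb : IsApproxInnerBasis tr X k b)
    {K l : ℕ} (c : Fin l → Y) (t : Bim.tensor X Y) :
    braidOp (fun i : Fin K => Asy.mk (pad b i) (bddX_pad hb i)) c (const tr t)
      = Asy.mk _ (BddX.sum Finset.univ fun i : Fin K => BddX.sum Finset.univ fun j =>
          bddX_braidSeq hb c t i j) := by
  refine Eq.trans (Finset.sum_congr rfl fun i _ =>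
    mk_sum (tr := tr) Finset.univ fun j => bddX_braidSeq hb c t i j) ?_
  exact mk_sum (tr := tr) Finset.univ fun i => BddX.sum Finset.univ fun j =>
    bddX_braidSeq hb c t i j

theorem bddX_braidSeqAdj {k : ℕ → ℕ} {b : ∀ n, Fin (k n) → X} (hb : IsApproxInnerBasis tr X k b)
    {K l : ℕ} (c : Fin l → Y) (t : Bim.tensor Y X) (i : Fin K) (j : Fin l) :
    BddX (Bim.tensor X Y) fun n => (Bim.tensor X Y).ract (Bim.tm (pad b i n) (c j))
      ((Bim.tensor Y X).inner (Bim.tm (c j) (pad b i n)) t) :=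
  ((bddX_pad hb i).tm (BddX.const (c j))).ract
    (((BddX.const (c j)).tm (bddX_pad hb i)).inner (BddX.const t))

theorem braidOpAdj_pad {k : ℕ → ℕ} {b : ∀ n, Fin (k n) → X} (hb : IsApproxInnerBasis tr X k b)
    {K l : ℕ} (c : Fin l → Y) (t : Bim.tensor Y X) :
    braidOpAdj (fun i : Fin K => Asy.mk (pad b i) (bddX_pad hb i)) c (const tr t)
      = Asy.mk _ (BddX.sum Finset.univ fun i : Fin K => BddX.sum Finset.univ fun j =>
          bddX_braidSeqAdj hb c t i j) := by
  refine Eq.trans (Finset.sum_congr rfl fun i _ =>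
    mk_sum (tr := tr) Finset.univ fun j => bddX_braidSeqAdj hb c t i j) ?_
  exact mk_sum (tr := tr) Finset.univ fun i => BddX.sum Finset.univ fun j =>
    bddX_braidSeqAdj hb c t i j

theorem exists_braidOp_const (hX : ApproximatelyInner tr X) (hY : CentrallyTrivial tr Y)
    (t : Bim.tensor X Y) : ∃ w : Bim.tensor Y X, ∀ {K : ℕ} (β : Fin K → Asy tr X) {l : ℕ}
      (c : Fin l → Y), IsAsyBasis β → IsBasis Y c → braidOp β c (const tr t) = const tr w := by
  obtain ⟨k, b, hb⟩ := hX
  obtain ⟨K, hK⟩ := hb.card_bdd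
  obtain ⟨l, c, hc⟩ := Y.exists_basis
  obtain ⟨w, hw⟩ := exists_const (tr := tr) (BddX.sum Finset.univ fun i : Fin K =>
    BddX.sum Finset.univ fun j => bddX_braidSeq hb c t i j) (fun s s' hs hs' => by
      refine mk_eq.1 ((braidOp_pad (hb.comp hs) (K := K) c t).symm.trans
        ((braidOp_indep ?_ ?_ hc hc hY _).trans (braidOp_pad (hb.comp hs') (K := K) c t)))
      · exact isAsyBasis_pad (hb.comp hs) fun n => hK _
      · exact isAsyBasis_pad (hb.comp hs') fun n => hK _)
  refine ⟨w, fun β l' c' hβ hc' => ?_⟩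
  rw [braidOp_indep hβ (isAsyBasis_pad hb hK) hc' hc hY, ← hw]
  exact braidOp_pad hb c t

theorem exists_braidOpAdj_const (hX : ApproximatelyInner tr X) (hY : CentrallyTrivial tr Y)
    (t : Bim.tensor Y X) : ∃ w : Bim.tensor X Y, ∀ {K : ℕ} (β : Fin K → Asy tr X) {l : ℕ}
      (c : Fin l → Y), IsAsyBasis β → IsBasis Y c → braidOpAdj β c (const tr t) = const tr w := by
  obtain ⟨k, b, hb⟩ := hX
  obtain ⟨K, hK⟩ := hb.card_bdd
  obtain ⟨l, c, hc⟩ := Y.exists_basis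
  obtain ⟨w, hw⟩ := exists_const (tr := tr) (BddX.sum Finset.univ fun i : Fin K =>
    BddX.sum Finset.univ fun j => bddX_braidSeqAdj hb c t i j) (fun s s' hs hs' => by
      refine mk_eq.1 ((braidOpAdj_pad (hb.comp hs) (K := K) c t).symm.trans
        ((braidOpAdj_indep ?_ ?_ hc hc hY _).trans (braidOpAdj_pad (hb.comp hs') (K := K) c t)))
      · exact isAsyBasis_pad (hb.comp hs) fun n => hK _
      · exact isAsyBasis_pad (hb.comp hs') fun n => hK _)
  refine ⟨w, fun β l' c' hβ hc' => ?_⟩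
  rw [braidOpAdj_indep hβ (isAsyBasis_pad hb hK) hc' hc hY, ← hw]
  exact braidOpAdj_pad hb c t

theorem Bim.ract_smul_one (X : Bim M) (z : ℂ) (x : X) : X.ract x (z • (1 : Alg M)) = z • x := by
  rw [_root_.map_smul, X.ract_one]

theorem exists_braidHom (hX : ApproximatelyInner tr X) (hY : CentrallyTrivial tr Y) :
    ∃ u : Bim.tensor X Y ⟶ Bim.tensor Y X, ∀ {K : ℕ} (β : Fin K → Asy tr X) {l : ℕ}
      (c : Fin l → Y), IsAsyBasis β → IsBasis Y c →
      (∀ t, braidOp β c (const tr t) = const tr (Bim.lin u t)) ∧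
      ∀ t, braidOpAdj β c (const tr t) = const tr (Bim.lin (Bim.dagger u) t) := by
  choose f hf using exists_braidOp_const (tr := tr) hX hY
  choose g hg using exists_braidOpAdj_const (tr := tr) hX hY
  obtain ⟨K, β, hβ⟩ := approximatelyInner_iff.1 hX
  obtain ⟨l, c, hc⟩ := Y.exists_basis
  have hf' := fun t => (hf t β c hβ hc).symm
  have hg' := fun t => (hg t β c hβ hc).symm
  have fadd : ∀ s t, f (s + t) = f s + f t := fun s t => const_injective (tr := tr) (by
    rw [map_add, hf', hf', hf', map_add, braidOp_add])
  have gadd : ∀ s t, g (s + t) = g s + g t := fun s t => const_injective (tr := tr) (by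
    rw [map_add, hg', hg', hg', map_add, braidOpAdj_add])
  have fr : ∀ t a, f ((Bim.tensor X Y).ract t a) = (Bim.tensor Y X).ract (f t) a :=
    fun t a => const_injective (tr := tr) (by
      rw [hf', const_ract, braidOp_ract, const_ract, hf'])
  have gr : ∀ t a, g ((Bim.tensor Y X).ract t a) = (Bim.tensor X Y).ract (g t) a :=
    fun t a => const_injective (tr := tr) (by
      rw [hg', const_ract, braidOpAdj_ract, const_ract, hg'])
  refine ⟨⟨⟨⟨f, fadd⟩, fun z t => ?_⟩, ⟨⟨g, gadd⟩, fun z t => ?_⟩, fun a t => ?_, fr, fun s t => ?_⟩,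
    fun β _ c hβ hc => ⟨fun t => hf t β c hβ hc, fun t => hg t β c hβ hc⟩⟩
  · change f (z • t) = z • f t
    rw [← Bim.ract_smul_one, fr, Bim.ract_smul_one]
  · change g (z • t) = z • g t
    rw [← Bim.ract_smul_one, gr, Bim.ract_smul_one]
  · refine const_injective (tr := tr) ?_
    change const tr (f _) = const tr ((Bim.tensor Y X).lact a (f t))
    rw [const_lact, hf', hf', const_lact, braidOp_smul hβ hc hY]
  · refine constA_injective (tr := tr) ?_
    change constA tr ((Bim.tensor Y X).inner (f s) t) = constA tr ((Bim.tensor X Y).inner s (g t))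
    rw [const_inner, const_inner, hf', hg', inner_braidOp]

/-- The braiding `X ⊠ Y → Y ⊠ X` of an approximately inner and a centrally trivial bimodule. -/
def braidHom (hX : ApproximatelyInner tr X) (hY : CentrallyTrivial tr Y) :
    Bim.tensor X Y ⟶ Bim.tensor Y X := (exists_braidHom hX hY).choose

section

variable (hX : ApproximatelyInner tr X) (hY : CentrallyTrivial tr Y)

theorem const_braidHom {K : ℕ} {β : Fin K → Asy tr X} {l : ℕ} {c : Fin l → Y} (hβ : IsAsyBasis β)
    (hc : IsBasis Y c) (t : Bim.tensor X Y) :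
    const tr (Bim.lin (braidHom hX hY) t) = braidOp β c (const tr t) :=
  (((exists_braidHom hX hY).choose_spec β c hβ hc).1 t).symm

theorem const_braidHom_dagger {K : ℕ} {β : Fin K → Asy tr X} {l : ℕ} {c : Fin l → Y}
    (hβ : IsAsyBasis β) (hc : IsBasis Y c) (t : Bim.tensor Y X) :
    const tr (Bim.lin (Bim.dagger (braidHom hX hY)) t) = braidOpAdj β c (const tr t) :=
  (((exists_braidHom hX hY).choose_spec β c hβ hc).2 t).symm

theorem map_braidHom {K : ℕ} {β : Fin K → Asy tr X} {l : ℕ} {c : Fin l → Y} (hβ : IsAsyBasis β)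
    (hc : IsBasis Y c) (t : Asy tr (Bim.tensor X Y)) :
    Asy.map (braidHom hX hY) t = braidOp β c t :=
  ind_const (p := fun t => Asy.map (braidHom hX hY) t = braidOp β c t)
    (fun t => (Asy.map_const _ t).trans (const_braidHom hX hY hβ hc t))
    (fun s t hs ht => by rw [map_add, hs, ht, braidOp_add])
    (fun t a ht => by rw [map_ract, ht, braidOp_ract]) t

/-- The braiding flips asymptotically commuting sequences past every vector. -/
theorem map_braidHom_tm {ξ : Asy tr X} (hξ : Commuting ξ) (y : Y) :
    Asy.map (braidHom hX hY) (tm ξ (const tr y)) = tm (const tr y) ξ := by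
  obtain ⟨K, β, hβ⟩ := approximatelyInner_iff.1 hX
  obtain ⟨l, c, hc⟩ := Y.exists_basis
  rw [map_braidHom hX hY hβ hc, braidOp_tm hβ hc hY hξ]

theorem dagger_braidHom_braidHom (t : Bim.tensor X Y) :
    Bim.lin (Bim.dagger (braidHom hX hY)) (Bim.lin (braidHom hX hY) t) = t := by
  obtain ⟨K, β, hβ⟩ := approximatelyInner_iff.1 hX
  obtain ⟨l, c, hc⟩ := Y.exists_basis
  exact const_injective (tr := tr) (by
    rw [const_braidHom_dagger hX hY hβ hc, const_braidHom hX hY hβ hc, braidOpAdj_braidOp hβ hc hY])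

theorem braidHom_dagger_braidHom (t : Bim.tensor Y X) :
    Bim.lin (braidHom hX hY) (Bim.lin (Bim.dagger (braidHom hX hY)) t) = t := by
  obtain ⟨K, β, hβ⟩ := approximatelyInner_iff.1 hX
  obtain ⟨l, c, hc⟩ := Y.exists_basis
  exact const_injective (tr := tr) (by
    rw [const_braidHom hX hY hβ hc, const_braidHom_dagger hX hY hβ hc, braidOp_braidOpAdj hβ hc hY])

/-- The braiding as a unitary isomorphism. -/
def braidIso : Bim.tensor X Y ≅ Bim.tensor Y X :=
  Bim.unitaryIso (braidHom hX hY) (dagger_braidHom_braidHom hX hY) (braidHom_dagger_braidHom hX hY)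

end

/-- Morphisms out of `X ⊠ Y` are determined by their values on asymptotically commuting
sequences in `X`. -/
theorem hom_ext_commuting {ι : Type*} [Fintype ι] {β : ι → Asy tr X} (hβ : IsAsyBasis β)
    {f g : Bim.tensor X Y ⟶ W}
    (h : ∀ i y, Asy.map f (tm (β i) (const tr y)) = Asy.map g (tm (β i) (const tr y))) : f = g := by
  obtain ⟨l, c, hc⟩ := Y.exists_basis
  refine Bim.hom_ext fun t => const_injective (tr := tr) ?_
  rw [← Asy.map_const, ← Asy.map_const, ← sum_tm_basis hβ hc (const tr t)]
  simp only [map_sum, map_ract, h]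

theorem hom_ext_commuting3 {ι : Type*} [Fintype ι] {β : ι → Asy tr X} (hβ : IsAsyBasis β)
    {f g : Bim.tensor X (Bim.tensor Y Z) ⟶ W}
    (h : ∀ i y z, Asy.map f (tm (β i) (tm (const tr y) (const tr z)))
      = Asy.map g (tm (β i) (tm (const tr y) (const tr z)))) : f = g :=
  hom_ext_commuting hβ fun i t => Bim.ind2
    (p := fun t => Asy.map f (tm (β i) (const tr t)) = Asy.map g (tm (β i) (const tr t)))
    (h i) (by simp) (fun s t hs ht => by simp only [map_add, hs, ht]) t

/-! ### Closure under tensor products -/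

theorem ApproximatelyInner.tensor (hX : ApproximatelyInner tr X) (hY : ApproximatelyInner tr Y) :
    ApproximatelyInner tr (Bim.tensor X Y) := by
  obtain ⟨K, β, hβ⟩ := approximatelyInner_iff.1 hX
  obtain ⟨L, γ, hγ⟩ := approximatelyInner_iff.1 hY
  exact (hβ.tm hγ).approximatelyInner

theorem CentrallyTrivial.tensor (hX : CentrallyTrivial tr X) (hY : CentrallyTrivial tr Y) :
    CentrallyTrivial tr (Bim.tensor X Y) :=
  centrallyTrivial_iff.2 fun α hα t => Bim.ind2
    (p := fun t => α • const tr t = const tr t <• α)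
    (fun x y => by
      rw [const_tm, smul_tm, hX.smul_const hα, tm_balanced, hY.smul_const hα, ract_tm])
    (by simp) (fun s t hs ht => by simp only [map_add, smul_add, hs, ht]) t

theorem ApproximatelyInner.unit : ApproximatelyInner tr (Bim.unit M) :=
  IsAsyBasis.approximatelyInner (β := fun _ : Unit => const tr (X := Bim.unit M) (1 : Alg M))
    (isAsyBasis_of_const (fun _ a => congrArg (const tr (X := Bim.unit M))
      ((mul_one a).trans (one_mul a).symm : a * 1 = 1 * a))
      (fun x => by
        rw [Fintype.sum_unique]
        exact congrArg (const tr (X := Bim.unit M))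
          (by rw [star_one, one_mul, one_mul] : (1 : Alg M) * (star 1 * (show Alg M from x)) = x)))

theorem CentrallyTrivial.unit : CentrallyTrivial tr (Bim.unit M) := fun a ha x => by
  have h := ha.2 x
  rw [← nullA_iff hM.out.isPosTrace] at h
  rw [← nullX_iff hM.out.isPosTrace]
  exact fun y => NullA.mul_left hM.out.isPosTrace (BddA.const (star (show Alg M from y))) h

theorem IsLocal.tensor (hX : IsLocal tr X) (hY : IsLocal tr Y) : IsLocal tr (Bim.tensor X Y) :=
  ⟨hX.1.tensor hY.1, hX.2.tensor hY.2⟩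

theorem IsLocal.unit : IsLocal tr (Bim.unit M) := ⟨ApproximatelyInner.unit, CentrallyTrivial.unit⟩

end Braid

open MonoidalCategory

theorem chiProp_isMonoidal : (chiProp tr).IsMonoidal where
  prop_unit := ⟨IsLocal.unit, ⟨𝟙_ (Bim M), IsLocal.unit, ⟨inferInstance⟩⟩,
    𝟙_ (Bim M), IsLocal.unit, ⟨inferInstance⟩⟩
  prop_tensor := by
    rintro X Y ⟨hX, ⟨X', hX', ⟨pX⟩⟩, X'', hX'', ⟨qX⟩⟩ ⟨hY, ⟨Y', hY', ⟨pY⟩⟩, Y'', hY'', ⟨qY⟩⟩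
    exact ⟨hX.tensor hY, ⟨Y' ⊗ X', hY'.tensor hX', ⟨inferInstance⟩⟩,
      Y'' ⊗ X'', hY''.tensor hX'', ⟨inferInstance⟩⟩

attribute [local instance] chiProp_isMonoidal

open Asy in
/-- The braiding of `χ̃(M)`. -/
@[reducible] def chiBraiding : BraidedCategory (Chi tr) where
  braiding X Y := (chiProp tr).isoMk (braidIso X.2.1.1 Y.2.1.2)
  braiding_naturality_right X Y Z f := by
    obtain ⟨K, β, hβ⟩ := approximatelyInner_iff.1 X.2.1.1
    refine ObjectProperty.hom_ext _ (hom_ext_commuting hβ fun i y => ?_)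
    change Asy.map (Bim.tensorMap (𝟙 X.obj) f.hom ≫ braidHom X.2.1.1 Z.2.1.2) _
      = Asy.map (braidHom X.2.1.1 Y.2.1.2 ≫ Bim.tensorMap f.hom (𝟙 X.obj)) _
    rw [Asy.map_comp, Asy.map_comp, map_tensorMap, map_braidHom_tm _ _ (hβ.comm i), map_tensorMap, Asy.map_const,
      Asy.map_id, map_braidHom_tm _ _ (hβ.comm i)]
  braiding_naturality_left {X Y} f Z := by
    obtain ⟨K, β, hβ⟩ := approximatelyInner_iff.1 X.2.1.1
    refine ObjectProperty.hom_ext _ (hom_ext_commuting hβ fun i y => ?_)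
    change Asy.map (Bim.tensorMap f.hom (𝟙 Z.obj) ≫ braidHom Y.2.1.1 Z.2.1.2) _
      = Asy.map (braidHom X.2.1.1 Z.2.1.2 ≫ Bim.tensorMap (𝟙 Z.obj) f.hom) _
    rw [Asy.map_comp, Asy.map_comp, map_tensorMap, map_braidHom_tm _ _ (hβ.comm i), map_tensorMap, Asy.map_id,
      map_braidHom_tm _ _ ((hβ.comm i).map f.hom)]
  hexagon_forward X Y Z := by
    obtain ⟨K, β, hβ⟩ := approximatelyInner_iff.1 X.2.1.1
    refine (cancel_epi (α_ X Y Z).inv).1 (ObjectProperty.hom_ext _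
      (hom_ext_commuting3 hβ fun i y z => ?_))
    change Asy.map (Bim.dagger (Bim.assocHom X.obj Y.obj Z.obj) ≫ Bim.assocHom X.obj Y.obj Z.obj ≫
        braidHom X.2.1.1 (Y.2.1.2.tensor Z.2.1.2) ≫ Bim.assocHom Y.obj Z.obj X.obj) _
      = Asy.map (Bim.dagger (Bim.assocHom X.obj Y.obj Z.obj) ≫
        Bim.tensorMap (braidHom X.2.1.1 Y.2.1.2) (𝟙 Z.obj) ≫ Bim.assocHom Y.obj X.obj Z.obj ≫
          Bim.tensorMap (𝟙 Y.obj) (braidHom X.2.1.1 Z.2.1.2)) _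
    simp only [Asy.map_comp, map_assocHom_dagger, map_assocHom, map_tensorMap, Asy.map_id,
      map_braidHom_tm _ _ (hβ.comm i)]
    rw [← const_tm, map_braidHom_tm _ _ (hβ.comm i), const_tm, map_assocHom]
  hexagon_reverse X Y Z := by
    obtain ⟨K, β, hβ⟩ := approximatelyInner_iff.1 X.2.1.1
    obtain ⟨L, γ, hγ⟩ := approximatelyInner_iff.1 Y.2.1.1
    refine (cancel_epi (α_ X Y Z).hom).1 (ObjectProperty.hom_ext _
      (hom_ext_commuting (hβ.tm hγ) fun i z => ?_))
    change Asy.map (Bim.assocHom X.obj Y.obj Z.obj ≫ Bim.dagger (Bim.assocHom X.obj Y.obj Z.obj) ≫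
        braidHom (X.2.1.1.tensor Y.2.1.1) Z.2.1.2 ≫ Bim.dagger (Bim.assocHom Z.obj X.obj Y.obj)) _
      = Asy.map (Bim.assocHom X.obj Y.obj Z.obj ≫
        Bim.tensorMap (𝟙 X.obj) (braidHom Y.2.1.1 Z.2.1.2) ≫
          Bim.dagger (Bim.assocHom X.obj Z.obj Y.obj) ≫
            Bim.tensorMap (braidHom X.2.1.1 Z.2.1.2) (𝟙 Y.obj)) _
    simp only [Asy.map_comp, map_assocHom_dagger, map_assocHom, map_tensorMap, Asy.map_id,
      map_braidHom_tm _ _ (hβ.comm _), map_braidHom_tm _ _ (hγ.comm _),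
      map_braidHom_tm _ _ ((hβ.comm _).tm (hγ.comm _))]

open Asy in
theorem isCanonicalBraiding_chiBraiding : IsCanonicalBraiding (chiBraiding (tr := tr)) where
  unitary X Y := rfl
  formula X Y k b l c hb hc t := by
    obtain ⟨K, hK⟩ := hb.card_bdd
    have h : const tr (Bim.lin (braidHom X.2.1.1 Y.2.1.2) t) = _ :=
      (const_braidHom X.2.1.1 Y.2.1.2 (isAsyBasis_pad hb hK) hc t).trans (braidOp_pad hb c t)
    have h2 := (nullX_iff hM.out.isPosTrace).1 (mk_eq.1 h)
    refine h2.congr fun n => ?_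
    congr 2
    exact sum_pad b hK (fun x => ∑ j, (Bim.tensor Y.obj X.obj).ract (Bim.tm (c j) x)
      ((Bim.tensor X.obj Y.obj).inner (Bim.tm x (c j)) t)) (by simp) n
  formula_dagger X Y k b l c hb hc t := by
    obtain ⟨K, hK⟩ := hc.card_bdd
    have h : const tr (Bim.lin (Bim.dagger (braidHom Y.2.1.1 X.2.1.2)) t) = _ :=
      (const_braidHom_dagger Y.2.1.1 X.2.1.2 (isAsyBasis_pad hc hK) hb t).trans
        (braidOpAdj_pad hc b t)
    have h2 := (nullX_iff hM.out.isPosTrace).1 (mk_eq.1 h)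
    refine h2.congr fun n => ?_
    rw [Finset.sum_comm (s := (Finset.univ : Finset (Fin k)))]
    congr 2
    exact sum_pad c hK (fun x => ∑ j, (Bim.tensor Y.obj X.obj).ract (Bim.tm x (b j))
      ((Bim.tensor X.obj Y.obj).inner (Bim.tm (b j) x) t)) (by simp) n

end

section

open Filter Topology

/-! ### Comparison of projections -/

section Projections

/-- The support projection of an element of a von Neumann algebra. -/
theorem exists_support (k : Alg M) : ∃ e : Alg M, IsStarProjection e ∧ k * e = k ∧
    ∀ x : Alg M, k * x = 0 → e * x = 0 := by
  let K := LinearMap.ker (k : H →L[ℂ] H).toLinearMap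
  have hKc : IsClosed (K : Set H) := ContinuousLinearMap.isClosed_ker (k : H →L[ℂ] H)
  have : CompleteSpace K := hKc.completeSpace_coe
  have hK : ∀ {ξ}, ξ ∈ K ↔ (k : H →L[ℂ] H) ξ = 0 := LinearMap.mem_ker
  have hq : K.starProjection ∈ M := by
    rw [VonNeumannAlgebra.IsStarProjection.mem_iff isStarProjection_starProjection]
    intro y hy
    rw [Submodule.range_starProjection]
    intro ξ hξ
    have h := congrArg (fun T : H →L[ℂ] H => T ξ) (commute_of_mem_commutant k hy).eq
    refine hK.2 (h.trans ?_)
    change y ((k : H →L[ℂ] H) ξ) = 0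
    rw [hK.1 hξ, map_zero]
  let q : Alg M := ⟨K.starProjection, hq⟩
  have hqs : IsStarProjection q :=
    ⟨Subtype.ext isStarProjection_starProjection.isIdempotentElem,
      Subtype.ext isStarProjection_starProjection.isSelfAdjoint⟩
  have hkq : k * q = 0 := Subtype.ext (ContinuousLinearMap.ext fun ξ =>
    hK.1 (K.starProjection_apply_mem ξ))
  refine ⟨1 - q, hqs.one_sub, by rw [mul_sub, hkq, mul_one, sub_zero], fun x hx => ?_⟩
  have hqx : q * x = x := Subtype.ext (ContinuousLinearMap.ext fun ξ =>
    Submodule.starProjection_eq_self_iff.2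
      (hK.2 (congrArg (fun T : Alg M => (T : H →L[ℂ] H) ξ) hx)))
  rw [sub_mul, hqx, one_mul, sub_self]

/-- A spectral cut of a nonzero positive element away from zero. -/
theorem exists_spectral_cut {A : Type*} [CStarAlgebra A] [PartialOrder A] [StarOrderedRing A] {k : A}
    (hk0 : 0 ≤ k) (hk : k ≠ 0) : ∃ c q r : A, c ≠ 0 ∧ c = r * k ∧ star q = q ∧
      c * (1 - q * k * q) = 0 := by
  have hkn : 0 < ‖k‖ := norm_pos_iff.2 hk
  have hksa : IsSelfAdjoint k := IsSelfAdjoint.of_nonneg hk0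
  obtain ⟨δ, hδ0, hδ⟩ : ∃ δ : ℝ, 0 < δ ∧ δ < ‖k‖ := exists_between hkn
  have hm : ∀ t : ℝ, 0 < max t δ := fun t => lt_max_of_lt_right hδ0
  have hcont : Continuous fun t : ℝ => (Real.sqrt (max t δ))⁻¹ :=
    (Real.continuous_sqrt.comp (by fun_prop)).inv₀ fun t => (Real.sqrt_pos.2 (hm t)).ne'
  have hcont' : Continuous fun t : ℝ => max (t - δ) 0 / max t δ :=
    Continuous.div (by fun_prop) (by fun_prop) fun t => (hm t).ne'
  have hcont0 : Continuous fun t : ℝ => max (t - δ) 0 := by fun_prop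
  have hid : cfc (fun t : ℝ => t) k = k := cfc_id' ℝ k hksa
  have hmul : ∀ (f g : ℝ → ℝ), Continuous f → Continuous g →
      cfc f k * cfc g k = cfc (fun t => f t * g t) k := fun f g hf hg =>
    (cfc_mul f g k hf.continuousOn hg.continuousOn).symm
  refine ⟨cfc (fun t : ℝ => max (t - δ) 0) k, cfc (fun t : ℝ => (Real.sqrt (max t δ))⁻¹) k,
    cfc (fun t : ℝ => max (t - δ) 0 / max t δ) k, fun h0 => ?_, ?_,
    (cfc_predicate (p := IsSelfAdjoint) _ k).star_eq, ?_⟩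
  · have hle : k ≤ algebraMap ℝ A δ := by
      have h1 : cfc (fun t : ℝ => t) k ≤ cfc (fun t : ℝ => δ + max (t - δ) 0) k :=
        cfc_mono (fun t _ => by linarith [le_max_left (t - δ) 0])
          continuous_id.continuousOn (by fun_prop)
      rw [cfc_const_add δ _ k hcont0.continuousOn hksa, h0, add_zero, hid] at h1
      exact h1
    have := (CStarAlgebra.norm_le_iff_le_algebraMap k hδ0.le hk0).2 hle
    linarith
  · have h := hmul _ _ hcont' continuous_id
    rw [show cfc (id : ℝ → ℝ) k = k from hid] at h
    rw [h]
    congr 1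
    ext t
    rcases le_total t δ with ht | ht
    · simp [max_eq_right (sub_nonpos.2 ht)]
    · simp only [max_eq_left ht, id]
      rw [div_mul_cancel₀ _ (hδ0.trans_le ht).ne']
  · have h := hmul _ _ hcont continuous_id
    rw [show cfc (id : ℝ → ℝ) k = k from hid] at h
    have h2 : Continuous fun t : ℝ => (Real.sqrt (max t δ))⁻¹ * id t := hcont.mul continuous_id
    have h3 : Continuous fun t : ℝ => (Real.sqrt (max t δ))⁻¹ * id t * (Real.sqrt (max t δ))⁻¹ :=
      h2.mul hcont
    rw [h, hmul _ _ h2 hcont, mul_sub, mul_one, hmul _ _ hcont0 h3, sub_eq_zero]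
    congr 1
    ext t
    rcases le_total t δ with ht | ht
    · simp [max_eq_right (sub_nonpos.2 ht)]
    · have h0 := hδ0.trans_le ht
      simp only [max_eq_left ht, id]
      rw [mul_right_comm _ t, ← mul_inv, Real.mul_self_sqrt h0.le, inv_mul_cancel₀ (ne_of_gt h0), mul_one]

/-- Below every nonzero element there is a nonzero partial isometry. -/
theorem exists_partialIsometry {x : Alg M} (hx : x ≠ 0) : ∃ y g : Alg M, IsStarProjection g ∧ g ≠ 0 ∧
    star (x * y) * (x * y) = g ∧ ∀ b, x * b = 0 → g * b = 0 := by
  obtain ⟨c, q, r, hc0, hcr, hqsa, hcq⟩ := exists_spectral_cut (star_mul_self_nonneg x)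
    ((CStarRing.star_mul_self_eq_zero_iff x).not.2 hx)
  obtain ⟨g, hg, hcg, hgx⟩ := exists_support c
  have hgq : g * (q * (star x * x) * q) = g := by
    have := hgx _ hcq
    rwa [mul_sub, mul_one, sub_eq_zero, eq_comm] at this
  refine ⟨q * g, g, hg, ?_, ?_, fun b hb => hgx b ?_⟩
  · rintro rfl
    exact hc0 (by rw [← hcg, mul_zero])
  · calc star (x * (q * g)) * (x * (q * g)) = g * (q * (star x * x) * q) * g := by
          rw [star_mul, star_mul, hqsa, hg.isSelfAdjoint.star_eq]; noncomm_ring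
      _ = g := by rw [hgq, hg.isIdempotentElem.eq]
  · rw [hcr, mul_assoc, mul_assoc, hb, mul_zero, mul_zero]

/-- In a factor, `f M e = 0` only if `e = 0` or `f = 0`. -/
theorem eq_zero_or_eq_zero_of_factor
    (hf : ∀ a : Alg M, (∀ b : Alg M, a * b = b * a) → ∃ z : ℂ, a = z • (1 : Alg M))
    {e f : Alg M} (h : ∀ b : Alg M, f * b * e = 0) : e = 0 ∨ f = 0 := by
  let K : Submodule ℂ H := ⨅ b : Alg M, LinearMap.ker ((f * b : Alg M) : H →L[ℂ] H).toLinearMap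
  have hK : ∀ {ξ}, ξ ∈ K ↔ ∀ b : Alg M, ((f * b : Alg M) : H →L[ℂ] H) ξ = 0 := by
    simp [K, Submodule.mem_iInf]
  have hKc : IsClosed (K : Set H) := by
    have : (K : Set H) = ⋂ b : Alg M, {ξ | ((f * b : Alg M) : H →L[ℂ] H) ξ = 0} := by
      ext ξ; simp only [SetLike.mem_coe, hK, Set.mem_iInter, Set.mem_ofPred_eq]
    rw [this]
    exact isClosed_iInter fun b => isClosed_eq (ContinuousLinearMap.continuous _) continuous_const
  have : CompleteSpace K := hKc.completeSpace_coe
  have hq : K.starProjection ∈ M := by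
    rw [VonNeumannAlgebra.IsStarProjection.mem_iff isStarProjection_starProjection]
    intro y hy
    rw [Submodule.range_starProjection]
    intro ξ hξ
    refine hK.2 fun b => ?_
    have h := congrArg (fun T : H →L[ℂ] H => T ξ) (commute_of_mem_commutant (f * b) hy).eq
    refine h.trans ?_
    change y (((f * b : Alg M) : H →L[ℂ] H) ξ) = 0
    rw [hK.1 hξ, map_zero]
  have hq' : K.starProjection ∈ M.commutant := by
    rw [VonNeumannAlgebra.IsStarProjection.mem_iff isStarProjection_starProjection,
      VonNeumannAlgebra.commutant_commutant]
    intro y hy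
    rw [Submodule.range_starProjection]
    intro ξ hξ
    refine hK.2 fun b => ?_
    have h := hK.1 hξ (b * (⟨y, hy⟩ : Alg M))
    rw [← mul_assoc] at h
    exact h
  let q : Alg M := ⟨K.starProjection, hq⟩
  have hqq : q * q = q := Subtype.ext isStarProjection_starProjection.isIdempotentElem
  have hqe : q * e = e := Subtype.ext (ContinuousLinearMap.ext fun ξ =>
    Submodule.starProjection_eq_self_iff.2 (hK.2 fun b =>
      congrArg (fun T : Alg M => (T : H →L[ℂ] H) ξ) (h b)))
  have hfq : f * q = 0 := Subtype.ext (ContinuousLinearMap.ext fun ξ => by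
    have := hK.1 (K.starProjection_apply_mem ξ) 1
    rwa [mul_one] at this)
  obtain ⟨z, hz⟩ := hf q fun b => Subtype.ext (commute_of_mem_commutant b hq').eq.symm
  by_cases hz0 : z = 0
  · left
    rw [← hqe, hz, hz0, zero_smul, zero_mul]
  · right
    rw [hz, mul_smul_comm, mul_one, smul_eq_zero] at hfq
    exact hfq.resolve_left hz0

end Projections

section Comparison

variable {tr : Alg M →ₗ[ℂ] ℂ}

/-- Partial isometries from a subprojection of `e` to a subprojection of `f`. -/
structure IsPartialIso (e f v : Alg M) : Prop where
  mul_star_mul : v * star v * v = v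
  mul_right : v * e = v
  mul_left : f * v = v

/-- The partial isometry `w` extends `v`. -/
def Extends (v w : Alg M) : Prop := w * star v * v = v ∧ v * star v * w = v

theorem Extends.star_mul {v w : Alg M} (h : Extends v w) (hv : v * star v * v = v) :
    star v * w = star v * v := by
  have hv' : star v * v * star v = star v := by simpa [mul_assoc] using congrArg star hv
  calc star v * w = star v * (v * star v * w) := by
        rw [← mul_assoc, ← mul_assoc, hv']
    _ = star v * v := by rw [h.2]

theorem Extends.twoSq_sub {v w : Alg M} (h : Extends v w) (hv : v * star v * v = v) :
    twoSq tr (w - v) = twoSq tr w - twoSq tr v := by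
  have h1 := h.star_mul hv
  have h2 : star w * v = star v * v := by simpa using congrArg star h1
  rw [twoSq, star_sub, sub_mul, mul_sub, mul_sub, h1, h2, sub_self, sub_zero, map_sub,
    Complex.sub_re, twoSq, twoSq]

theorem Extends.trans {u v w : Alg M} (hu : u * star u * u = u) (h : Extends u v)
    (h' : Extends v w) : Extends u w := by
  have e1 : u * star u * v = u := h.2
  have e2 : v * star u * u = u := h.1
  have e3 : star v * u * star u = star u := by simpa [mul_assoc] using congrArg star e1
  have e4 : star u * u * star v = star u := by simpa [mul_assoc] using congrArg star e2
  constructor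
  · calc w * star u * u = w * star v * (u * star u * u) := by
          conv_lhs => rw [← e3]
          simp only [mul_assoc]
      _ = w * star v * (v * star u * u) := by rw [hu, e2]
      _ = (w * star v * v) * star u * u := by simp only [mul_assoc]
      _ = u := by rw [h'.1, e2]
  · calc u * star u * w = (u * star u * u) * star v * w := by
          conv_lhs => rw [← e4]
          simp only [mul_assoc]
      _ = (u * star u * v) * star v * w := by rw [hu, e1]
      _ = u * star u * (v * star v * w) := by simp only [mul_assoc]
      _ = u := by rw [h'.2, e1]

theorem norm_le_one_of_mul_star_mul {v : Alg M} (hv : v * star v * v = v) : ‖v‖ ≤ 1 := by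
  by_contra! h
  have h1 : ‖v‖ ^ 4 = ‖v‖ ^ 2 := by
    have : star v * v * (star v * v) = star v * v := by
      rw [mul_assoc, ← mul_assoc v, hv]
    have h2 := congrArg norm this
    have h3 : ‖star v * v * (star v * v)‖ = ‖star v * v‖ * ‖star v * v‖ := by
      conv_lhs => rw [show star v * v * (star v * v) = star (star v * v) * (star v * v) by simp]
      rw [CStarRing.norm_star_mul_self]
    rw [h3, CStarRing.norm_star_mul_self] at h2
    linarith
  have h2 : ‖v‖ ^ 2 < ‖v‖ ^ 4 := pow_lt_pow_right₀ h (by norm_num)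
  linarith

/-- A chain of partial isometries with traces tending to their supremum has a limit that
extends all its members. -/
theorem IsIIOneFactor.exists_extends_of_chain (hM : IsIIOneFactor M tr) {e f : Alg M}
    {c : Set {v : Alg M // IsPartialIso e f v}} (hc : IsChain (fun v w => Extends v.1 w.1) c) :
    ∃ ub : {v : Alg M // IsPartialIso e f v}, ∀ v ∈ c, Extends v.1 ub.1 := by
  have := Fact.mk hM
  have hτ := hM.isPosTrace
  rcases c.eq_empty_or_nonempty with rfl | hne
  · exact ⟨⟨0, by simp, by simp, by simp⟩, fun v hv => absurd hv (Set.notMem_empty v)⟩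
  let T : Set ℝ := (fun v : {v : Alg M // IsPartialIso e f v} => twoSq tr v.1) '' c
  have hTne : T.Nonempty := hne.image _
  have hTb : BddAbove T := ⟨1, by
    rintro _ ⟨v, -, rfl⟩
    have h := hτ.twoSq_mul_le v.1 1
    have h1 : twoSq tr (1 : Alg M) = 1 := by simp [twoSq, hM.tr_one]
    rw [mul_one, h1, mul_one] at h
    exact h.trans (pow_le_one₀ (norm_nonneg _) (norm_le_one_of_mul_star_mul v.2.mul_star_mul))⟩
  have hcmp : ∀ v ∈ c, ∀ w ∈ c, twoSq tr (v.1 - w.1) = |twoSq tr v.1 - twoSq tr w.1| := by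
    intro v hv w hw
    rcases eq_or_ne v w with rfl | hvw
    · simp [twoSq_zero]
    rcases hc hv hw hvw with h | h
    · have h1 := h.twoSq_sub (tr := tr) v.2.mul_star_mul
      rw [abs_sub_comm, ← h1, abs_of_nonneg (hτ.twoSq_nonneg _), ← twoSq_neg, neg_sub]
    · have h1 := h.twoSq_sub (tr := tr) w.2.mul_star_mul
      rw [← h1, abs_of_nonneg (hτ.twoSq_nonneg _)]
  obtain ⟨t, -, ht, htT⟩ := exists_seq_tendsto_sSup hTne hTb
  choose v hvc hvt using htT
  have hlim : Tendsto (fun n => twoSq tr (v n).1) atTop (𝓝 (sSup T)) := by simpa only [hvt] using ht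
  have hb : ∀ n, ‖(v n).1‖ ≤ 1 := fun n => norm_le_one_of_mul_star_mul (v n).2.mul_star_mul
  obtain ⟨w, -, hw⟩ := hM.exists_limit hb fun s s' hs hs' => by
    simp only [hcmp _ (hvc _) _ (hvc _)]
    simpa using ((hlim.comp hs).sub (hlim.comp hs')).abs
  have hmk : AsyAlg.mk (fun n => (v n).1) ⟨1, hb⟩ = constA tr w := AsyAlg.mk_eq.2 hw
  have hmk' : ∀ N, AsyAlg.mk (fun n => (v (n + N)).1) ⟨1, fun n => hb _⟩ = constA tr w := fun N =>
    AsyAlg.mk_eq.2 ((tendsto_add_atTop_iff_nat N).2 hw)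
  have hwp : IsPartialIso e f w := by
    constructor <;> refine Asy.constA_injective (tr := tr) ?_
    · rw [map_mul, map_mul, ← star_constA, ← hmk]
      exact AsyAlg.mk_congr fun n => (v n).2.mul_star_mul
    · rw [map_mul, ← hmk]
      exact AsyAlg.mk_congr fun n => (v n).2.mul_right
    · rw [map_mul, ← hmk]
      exact AsyAlg.mk_congr fun n => (v n).2.mul_left
  refine ⟨⟨w, hwp⟩, fun u hu => ?_⟩
  have hule : twoSq tr u.1 ≤ sSup T := le_csSup hTb ⟨u, hu, rfl⟩
  rcases hule.lt_or_eq with hlt | heq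
  · obtain ⟨N, hN⟩ := eventually_atTop.1 (hlim.eventually_const_lt hlt)
    have hext : ∀ n, Extends u.1 (v (n + N)).1 := fun n => by
      have h1 := hN (n + N) (Nat.le_add_left _ _)
      have hne : u ≠ v (n + N) := fun h => by rw [← h] at h1; exact lt_irrefl _ h1
      refine (hc hu (hvc _) hne).resolve_right fun h => ?_
      have h2 := h.twoSq_sub (tr := tr) (v (n + N)).2.mul_star_mul
      have h3 := hτ.twoSq_nonneg (u.1 - (v (n + N)).1)
      linarith
    constructor <;> refine Asy.constA_injective (tr := tr) ?_
    · rw [map_mul, map_mul, ← hmk' N]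
      exact AsyAlg.mk_congr fun n => (hext n).1
    · rw [map_mul, map_mul, ← hmk' N]
      exact AsyAlg.mk_congr fun n => (hext n).2
  · have : constA tr u.1 = constA tr w := by
      rw [← hmk]
      refine AsyAlg.mk_eq.2 ?_
      change Tendsto (fun n => twoSq tr (u.1 - (v n).1)) atTop (𝓝 0)
      simp only [hcmp _ hu _ (hvc _), heq]
      simpa using (hlim.const_sub (sSup T)).abs
    have huw := Asy.constA_injective this
    change Extends u.1 w
    rw [← huw]
    exact ⟨u.2.mul_star_mul, u.2.mul_star_mul⟩

/-- Comparison of projections in a factor. -/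
theorem IsIIOneFactor.comparison (hM : IsIIOneFactor M tr) {e f : Alg M} (he : IsStarProjection e)
    (hf : IsStarProjection f) :
    (∃ v, star v * v = e ∧ f * v = v) ∨ ∃ v, star v * v = f ∧ e * v = v := by
  obtain ⟨⟨v, hv⟩, hmax⟩ := exists_maximal_of_chains_bounded
    (fun c hc => hM.exists_extends_of_chain (e := e) (f := f) hc)
    (fun {a b c} h h' => h.trans a.2.mul_star_mul h')
  have hes := he.isSelfAdjoint.star_eq
  have hfs := hf.isSelfAdjoint.star_eq
  have h1 : star v * v * star v = star v := by
    simpa [mul_assoc] using congrArg star hv.mul_star_mul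
  have h2 : e * star v = star v := by simpa [hes] using congrArg star hv.mul_right
  have h3 : star v * f = star v := by simpa [hfs] using congrArg star hv.mul_left
  have h4 := hv.mul_star_mul
  have h5 := hv.mul_right
  have h6 := hv.mul_left
  set e' := e - star v * v with he'
  set f' := f - v * star v with hf'
  have hve' : v * e' = 0 := by rw [he', mul_sub, h5, ← mul_assoc, h4, sub_self]
  have hvf' : star v * f' = 0 := by rw [hf', mul_sub, h3, ← mul_assoc, h1, sub_self]
  have hee' : e * e' = e' := by
    rw [he', mul_sub, he.isIdempotentElem.eq, ← mul_assoc, h2]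
  have hff' : f * f' = f' := by
    rw [hf', mul_sub, hf.isIdempotentElem.eq, ← mul_assoc, h6]
  have hes' : star e' = e' := by simp [he', hes]
  have hfs' : star f' = f' := by simp [hf', hfs]
  have hfi' : f' * f' = f' := by
    conv_lhs => rw [hf', sub_mul, hff', mul_assoc, hvf', mul_zero, sub_zero]
  have hei' : e' * e' = e' := by
    conv_lhs => rw [he', sub_mul, hee', mul_assoc, hve', mul_zero, sub_zero]
  have hzero : ∀ b : Alg M, f' * b * e' = 0 := by
    intro b
    by_contra hb
    obtain ⟨y, g, hg, hg0, hyg, hgb⟩ := exists_partialIsometry hb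
    set w := f' * b * e' * y with hw
    have hge : g * e' = g := by
      have := hgb (1 - e') (by rw [mul_sub, mul_one, mul_assoc (f' * b), hei', sub_self])
      rwa [mul_sub, mul_one, sub_eq_zero, eq_comm] at this
    have heg : e' * g = g := by simpa [hes', hg.isSelfAdjoint.star_eq] using congrArg star hge
    have hwg : w * g = w := by
      rw [← sub_eq_zero, ← CStarRing.star_mul_self_eq_zero_iff]
      calc star (w * g - w) * (w * g - w) = (g - 1) * (star w * w) * (g - 1) := by
            rw [star_sub, star_mul, hg.isSelfAdjoint.star_eq]; noncomm_ring
        _ = 0 := by rw [hyg, sub_mul, hg.isIdempotentElem.eq, one_mul, sub_self, zero_mul]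
    have hfw : f' * w = w := by rw [hw, ← mul_assoc, ← mul_assoc, ← mul_assoc, hfi']
    have hwe : w * e' = w := by rw [← hwg, mul_assoc, hge]
    have hvw : v * star w = 0 := by
      have := congrArg star hwe
      rw [star_mul, hes'] at this
      rw [← this, ← mul_assoc, hve', zero_mul]
    have hwv : w * star v = 0 := by simpa using congrArg star hvw
    have hvw' : star v * w = 0 := by rw [← hfw, ← mul_assoc, hvf', zero_mul]
    have hwv' : star w * v = 0 := by simpa using congrArg star hvw'
    have hwww : w * star w * w = w := by rw [mul_assoc, hyg, hwg]
    have hp : IsPartialIso e f (v + w) := by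
      constructor
      · have : (v + w) * star (v + w) * (v + w) = v * star v * v + w * star w * w
            + v * (star v * w) + w * (star w * v) + (v * star w) * (v + w)
            + (w * star v) * (v + w) := by
          rw [star_add]; noncomm_ring
        rw [this, h4, hwww, hvw, hwv, hvw', hwv']
        simp
      · rw [add_mul, h5]
        have : e' * e = e' := by simpa [hes, hes'] using congrArg star hee'
        rw [← hwe, mul_assoc, this]
      · rw [mul_add, h6, ← hfw, ← mul_assoc, hff']
    have hext := hmax ⟨v + w, hp⟩ ⟨by
      change (v + w) * star v * v = v
      rw [add_mul, add_mul, hwv, zero_mul, add_zero, h4], by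
      change v * star v * (v + w) = v
      rw [mul_add, h4, mul_assoc, hvw', mul_zero, add_zero]⟩
    have h7 : v * star (v + w) * (v + w) = v + w := hext.1
    have h8 : v * star (v + w) * (v + w) = v * star v * v + v * (star v * w)
        + (v * star w) * (v + w) := by
      rw [star_add]; noncomm_ring
    rw [h8, h4, hvw, hvw', mul_zero, zero_mul, add_zero, add_zero] at h7
    have hw0 : w = 0 := by simpa using h7
    exact hg0 (by rw [← hyg, hw0, mul_zero])
  rcases eq_zero_or_eq_zero_of_factor hM.factor hzero with h | h
  · exact Or.inl ⟨v, (sub_eq_zero.1 h).symm, h6⟩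
  · exact Or.inr ⟨star v, by rw [star_star]; exact (sub_eq_zero.1 h).symm, h2⟩

end Comparison

end

section

open Filter Topology
variable {tr : Alg M →ₗ[ℂ] ℂ}

/-! ### Averaging over unitaries -/

/-- Iterated averages of `x` over pairs of unitary conjugates. -/
inductive IsAverage (x : Alg M) : Alg M → Prop
  | refl : IsAverage x x
  | step {y u : Alg M} : IsAverage x y → star u * u = 1 → u * star u = 1 →
      IsAverage x ((2⁻¹ : ℝ) • (y + star u * y * u))

theorem IsAverage.trace_eq {τ : Alg M →ₗ[ℂ] ℂ} (hτ : ∀ a b, τ (a * b) = τ (b * a)) {x y : Alg M}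
    (h : IsAverage x y) : τ y = τ x := by
  induction h with
  | refl => rfl
  | @step y u _ hu hu' ih =>
    have h1 : τ (star u * y * u) = τ y := by rw [hτ, ← mul_assoc, hu', one_mul]
    rw [← Complex.coe_smul, map_smul, map_add, h1, ih, smul_eq_mul]
    push_cast
    ring

theorem IsAverage.exists_sum {x y : Alg M} (h : IsAverage x y) :
    ∃ (ι : Type) (_ : Fintype ι) (a : ι → Alg M), y = ∑ s, star (a s) * x * a s := by
  induction h with
  | refl => exact ⟨Unit, inferInstance, fun _ => 1, by simp⟩
  | @step y u _ _ _ ih =>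
    obtain ⟨ι, _, a, rfl⟩ := ih
    have hr : (2⁻¹ : ℝ) = Real.sqrt 2⁻¹ * Real.sqrt 2⁻¹ := (Real.mul_self_sqrt (by norm_num)).symm
    refine ⟨ι ⊕ ι, inferInstance, Sum.elim (fun s => Real.sqrt 2⁻¹ • a s)
      (fun s => Real.sqrt 2⁻¹ • (a s * u)), ?_⟩
    rw [Fintype.sum_sum_type, smul_add, Finset.mul_sum, Finset.sum_mul, Finset.smul_sum,
      Finset.smul_sum]
    congr 1
    · refine Finset.sum_congr rfl fun s _ => ?_
      simp only [Sum.elim_inl, star_smul, smul_mul_assoc, mul_smul_comm, smul_smul, star_trivial]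
      rw [← hr]
    · refine Finset.sum_congr rfl fun s _ => ?_
      simp only [Sum.elim_inr, star_smul, smul_mul_assoc, mul_smul_comm, smul_smul, star_trivial,
        star_mul, mul_assoc]
      rw [← hr]

theorem conj_smul_one_le {k u : Alg M} (hu : star u * u = 1) {c : ℝ} (h : k ≤ c • (1 : Alg M)) :
    star u * k * u ≤ c • (1 : Alg M) := by
  have := star_left_conjugate_le_conjugate h u
  rwa [mul_smul_comm, smul_mul_assoc, mul_one, hu] at this

theorem le_conj_smul_one {k u : Alg M} (hu : star u * u = 1) {c : ℝ} (h : c • (1 : Alg M) ≤ k) :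
    c • (1 : Alg M) ≤ star u * k * u := by
  have := star_left_conjugate_le_conjugate h u
  rwa [mul_smul_comm, smul_mul_assoc, mul_one, hu] at this

/-- The unitary exchanging a projection `e` with an orthogonal equivalent one lowers the upper
bound of an element below `c e`. -/
theorem exists_unitary_conj_le {e k v : Alg M} (he : IsStarProjection e) {c : ℝ} (hc : 0 ≤ c)
    (hk : k ≤ c • e) (hv : star v * v = e) (hev : (1 - e) * v = v) :
    ∃ u : Alg M, star u * u = 1 ∧ u * star u = 1 ∧ k + star u * k * u ≤ c • (1 : Alg M) := by
  have hes := he.isSelfAdjoint.star_eq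
  have hee := he.isIdempotentElem.eq
  have hev0 : e * v = 0 := by simpa [sub_mul] using hev
  have hve0 : star v * e = 0 := by simpa [hes] using congrArg star hev0
  have hvve : v * e = v := by
    rw [← sub_eq_zero, ← CStarRing.star_mul_self_eq_zero_iff]
    calc star (v * e - v) * (v * e - v) = (e - 1) * (star v * v) * (e - 1) := by
          rw [star_sub, star_mul, hes]; noncomm_ring
      _ = 0 := by rw [hv, sub_mul, hee, one_mul, sub_self, zero_mul]
  have hev' : e * star v = star v := by simpa [hes] using congrArg star hvve
  have hvv : v * v = 0 := by
    nth_rewrite 1 [← hvve]; rw [mul_assoc, hev0, mul_zero]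
  have hvv' : star v * star v = 0 := by simpa using congrArg star hvv
  set g := v * star v with hg
  have hgs : star g = g := by simp [hg]
  have hgg : g * g = g := by rw [hg, mul_assoc, ← mul_assoc (star v), hv, hev']
  have hge : g * e = 0 := by rw [hg, mul_assoc, hve0, mul_zero]
  have heg : e * g = 0 := by rw [hg, ← mul_assoc, hev0, zero_mul]
  have hgv : g * v = v := by rw [hg, mul_assoc, hv, hvve]
  have hvg : star v * g = star v := by simpa [hgs] using congrArg star hgv
  have hvg0 : v * g = 0 := by rw [hg, ← mul_assoc, hvv, zero_mul]
  have hgv0 : g * star v = 0 := by simpa [hgs] using congrArg star hvg0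
  set u := v + star v + (1 - e - g) with hu
  have hus : star u = u := by
    rw [hu]; simp only [star_add, star_sub, star_star, star_one, hes, hgs]; abel
  have huu : u * u = 1 := by
    rw [hu]
    simp only [mul_add, add_mul, mul_sub, sub_mul, mul_one, one_mul, hvv, hvv', hv, hvve, hev', hev0,
      hve0, hgg, hge, heg, hgv, hvg, hvg0, hgv0, hee, ← hg]
    abel
  have hue : u * e = v := by
    rw [hu]
    simp only [add_mul, sub_mul, one_mul, hvve, hve0, hge, hee]
    abel
  have heu : e * u = star v := by simpa [hes, hus] using congrArg star hue
  have hueu : star u * e * u = g := by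
    rw [hus, ← hee, ← mul_assoc, mul_assoc _ e u, hue, heu]
  refine ⟨u, by rw [hus, huu], by rw [hus, huu], ?_⟩
  have h1 := star_left_conjugate_le_conjugate hk u
  rw [mul_smul_comm, smul_mul_assoc, hueu] at h1
  have h2 : e + g ≤ 1 := by
    have : (1 - e - g) = star (1 - e - g) * (1 - e - g) := by
      simp only [star_sub, star_one, hes, hgs, mul_sub, sub_mul, mul_one, one_mul, hgg, hge, heg, hee]
      abel
    have h3 : 0 ≤ 1 - e - g := by rw [this]; exact star_mul_self_nonneg _
    rwa [sub_sub, sub_nonneg] at h3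
  calc k + star u * k * u ≤ c • e + c • g := add_le_add hk h1
    _ = c • (e + g) := (smul_add _ _ _).symm
    _ ≤ c • (1 : Alg M) := smul_le_smul_of_nonneg_left h2 hc

theorem exists_posPart_negPart {A : Type*} [CStarAlgebra A] [PartialOrder A] [StarOrderedRing A] {k : A}
    (hk : IsSelfAdjoint k) : ∃ p n : A, 0 ≤ p ∧ 0 ≤ n ∧ p * n = 0 ∧ p - n = k :=
  ⟨k⁺, k⁻, CFC.posPart_nonneg k, CFC.negPart_nonneg k, CFC.posPart_mul_negPart k,
    CFC.posPart_sub_negPart k hk⟩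

theorem isSelfAdjoint_of_smul_one_le {A : Type*} [CStarAlgebra A] [PartialOrder A] [StarOrderedRing A]
    {y : A} {a : ℝ} (hy : a • (1 : A) ≤ y) : IsSelfAdjoint y := by
  have h1 : IsSelfAdjoint (y - a • (1 : A)) := IsSelfAdjoint.of_nonneg (sub_nonneg.2 hy)
  have h2 : IsSelfAdjoint (a • (1 : A)) := by simp [isSelfAdjoint_iff]
  simpa using h1.add h2

theorem exists_mul_mul_eq_one {A : Type*} [CStarAlgebra A] [PartialOrder A] [StarOrderedRing A] {y : A}
    {a : ℝ} (ha0 : 0 < a) (hy : a • (1 : A) ≤ y) : ∃ q : A, star q = q ∧ q * y * q = 1 := by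
  have hysa := isSelfAdjoint_of_smul_one_le hy
  have hsp : ∀ t ∈ spectrum ℝ y, a ≤ t :=
    (algebraMap_le_iff_le_spectrum hysa).1 (by rwa [Algebra.algebraMap_eq_smul_one])
  have hco : ContinuousOn (fun t : ℝ => (Real.sqrt t)⁻¹) (spectrum ℝ y) :=
    Real.continuous_sqrt.continuousOn.inv₀ fun t ht =>
      (Real.sqrt_pos.2 (ha0.trans_le (hsp t ht))).ne'
  have hid : cfc (fun t : ℝ => t) y = y := cfc_id' ℝ y hysa
  refine ⟨cfc (fun t : ℝ => (Real.sqrt t)⁻¹) y, (cfc_predicate (p := IsSelfAdjoint) _ y).star_eq, ?_⟩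
  have h1 := cfc_mul _ _ y hco (continuousOn_id (α := ℝ))
  rw [show cfc (id : ℝ → ℝ) y = y from hid] at h1
  have h2 : ContinuousOn (fun t : ℝ => (Real.sqrt t)⁻¹ * id t) (spectrum ℝ y) :=
    hco.mul continuousOn_id
  rw [← h1, ← cfc_mul _ _ y h2 hco, ← cfc_one ℝ y hysa]
  refine cfc_congr fun t ht => ?_
  have h2 := ha0.trans_le (hsp t ht)
  simp only [Pi.one_apply, id]
  rw [mul_right_comm, ← mul_inv, Real.mul_self_sqrt h2.le, inv_mul_cancel₀ (ne_of_gt h2)]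

/-- Averaging once shrinks the spectral width of a selfadjoint element by a quarter. -/
theorem IsIIOneFactor.exists_average_step (hM : IsIIOneFactor M tr) {h : Alg M} {a b : ℝ}
    (ha : a • (1 : Alg M) ≤ h) (hb : h ≤ b • (1 : Alg M)) (hab : a ≤ b) :
    ∃ u : Alg M, star u * u = 1 ∧ u * star u = 1 ∧ ∃ a' b' : ℝ, b' - a' = 3 / 4 * (b - a) ∧
      a' • (1 : Alg M) ≤ (2⁻¹ : ℝ) • (h + star u * h * u) ∧
      (2⁻¹ : ℝ) • (h + star u * h * u) ≤ b' • (1 : Alg M) := by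
  set m := (a + b) / 2 with hm
  set c := (b - a) / 2 with hc
  have hc0 : 0 ≤ c := by rw [hc]; linarith
  set k := h - m • (1 : Alg M) with hk
  have hka : (-c) • (1 : Alg M) ≤ k := by
    rw [hk, le_sub_iff_add_le, ← add_smul]
    convert ha using 2
    rw [hm, hc]; ring
  have hkb : k ≤ c • (1 : Alg M) := by
    rw [hk, sub_le_iff_le_add, ← add_smul]
    convert hb using 2
    rw [hm, hc]; ring
  have hksa : IsSelfAdjoint k := isSelfAdjoint_of_smul_one_le hka
  obtain ⟨p, n, hp0, hn0, hpn, hkk⟩ := exists_posPart_negPart hksa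
  obtain ⟨e, he, hpe, hex⟩ := exists_support p
  have hes := he.isSelfAdjoint.star_eq
  have hps : star p = p := (IsSelfAdjoint.of_nonneg hp0).star_eq
  have hns : star n = n := (IsSelfAdjoint.of_nonneg hn0).star_eq
  have hep : e * p = p := by simpa [hes, hps] using congrArg star hpe
  have hen : e * n = 0 := hex _ hpn
  have hne : n * e = 0 := by simpa [hes, hns] using congrArg star hen
  have hup : k ≤ c • e := by
    have h1 := star_left_conjugate_le_conjugate hkb e
    rw [mul_smul_comm, smul_mul_assoc, mul_one, hes, he.isIdempotentElem.eq] at h1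
    refine le_trans ?_ h1
    rw [← hkk, mul_sub, hen, sub_zero, hep, hpe]
    exact sub_le_self _ hn0
  have hlo : -k ≤ c • (1 - e) := by
    have h1 := star_left_conjugate_le_conjugate hka (1 - e)
    rw [mul_smul_comm, smul_mul_assoc, mul_one, star_sub, star_one, hes,
      he.one_sub.isIdempotentElem.eq, neg_smul, neg_le] at h1
    refine le_trans ?_ h1
    have h2 : (1 - e) * (p - n) * (1 - e) = -n := by
      simp only [mul_sub, sub_mul, one_mul, mul_one, hep, hen, hpe, hne]
      abel_nf
      simp
    rw [← hkk, h2, neg_neg, neg_sub]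
    exact sub_le_self _ hp0
  have hhk : h = k + m • (1 : Alg M) := by rw [hk, sub_add_cancel]
  have hconj : ∀ u : Alg M, star u * u = 1 → (2⁻¹ : ℝ) • (h + star u * h * u)
      = (2⁻¹ : ℝ) • (k + star u * k * u) + m • (1 : Alg M) := fun u hu => by
    rw [hhk, mul_add, add_mul, mul_smul_comm, smul_mul_assoc, mul_one, hu, add_add_add_comm, smul_add,
      ← two_smul ℝ (m • (1 : Alg M)), smul_smul (2⁻¹ : ℝ) 2, inv_mul_cancel₀ two_ne_zero, one_smul]
  have hhalf : ∀ {x : Alg M} {d : ℝ}, x ≤ d • (1 : Alg M) →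
      (2⁻¹ : ℝ) • x ≤ (2⁻¹ * d) • (1 : Alg M) := fun {x d} hx => by
    rw [← smul_smul]; exact smul_le_smul_of_nonneg_left hx (by norm_num)
  have hhalf' : ∀ {x : Alg M} {d : ℝ}, d • (1 : Alg M) ≤ x →
      (2⁻¹ * d) • (1 : Alg M) ≤ (2⁻¹ : ℝ) • x := fun {x d} hx => by
    rw [← smul_smul]; exact smul_le_smul_of_nonneg_left hx (by norm_num)
  rcases hM.comparison he he.one_sub with ⟨v, hv, hv'⟩ | ⟨v, hv, hv'⟩
  · obtain ⟨u, hu, hu', hle⟩ := exists_unitary_conj_le he hc0 hup hv hv'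
    refine ⟨u, hu, hu', 2⁻¹ * (-c + -c) + m, 2⁻¹ * c + m, by rw [hc]; ring, ?_, ?_⟩
    · rw [hconj u hu, add_smul]
      refine add_le_add_left (hhalf' ?_) _
      rw [add_smul]
      exact add_le_add hka (le_conj_smul_one hu hka)
    · rw [hconj u hu, add_smul]
      exact add_le_add_left (hhalf hle) _
  · obtain ⟨u, hu, hu', hle⟩ := exists_unitary_conj_le he.one_sub hc0 hlo hv
      (by rwa [sub_sub_cancel])
    refine ⟨u, hu, hu', 2⁻¹ * -c + m, 2⁻¹ * (c + c) + m, by rw [hc]; ring, ?_, ?_⟩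
    · rw [hconj u hu, add_smul]
      refine add_le_add_left (hhalf' ?_) _
      rw [neg_smul, neg_le]
      convert hle using 1
      rw [mul_neg, neg_mul, neg_add]
    · rw [hconj u hu, add_smul]
      refine add_le_add_left (hhalf ?_) _
      rw [add_smul]
      exact add_le_add hkb (conj_smul_one_le hu hkb)

/-- Dixmier averaging: the averages of a selfadjoint element come close to the scalars. -/
theorem IsIIOneFactor.exists_average (hM : IsIIOneFactor M tr) {h : Alg M} (hh : 0 ≤ h) {ε : ℝ}
    (hε : 0 < ε) : ∃ y, IsAverage h y ∧ ∃ a b : ℝ, b - a < ε ∧ a • (1 : Alg M) ≤ y ∧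
      y ≤ b • (1 : Alg M) := by
  have key : ∀ n : ℕ, ∃ y, IsAverage h y ∧ ∃ a b : ℝ, b - a = (3 / 4) ^ n * ‖h‖ ∧
      a • (1 : Alg M) ≤ y ∧ y ≤ b • (1 : Alg M) := by
    intro n
    induction n with
    | zero =>
      refine ⟨h, .refl, 0, ‖h‖, by simp, by simpa using hh, ?_⟩
      rw [← Algebra.algebraMap_eq_smul_one]
      exact (CStarAlgebra.norm_le_iff_le_algebraMap h (norm_nonneg _) hh).1 le_rfl
    | succ n ih =>
      obtain ⟨y, hy, a, b, hab, ha, hb⟩ := ih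
      have hle : a ≤ b := by rw [← sub_nonneg, hab]; positivity
      obtain ⟨u, hu, hu', a', b', hab', h1, h2⟩ := hM.exists_average_step ha hb hle
      exact ⟨_, hy.step hu hu', a', b', by rw [hab', hab]; ring, h1, h2⟩
  have hlim : Tendsto (fun n : ℕ => (3 / 4 : ℝ) ^ n * ‖h‖) atTop (𝓝 0) := by
    simpa using (tendsto_pow_atTop_nhds_zero_of_lt_one (by norm_num : (0 : ℝ) ≤ 3 / 4)
      (by norm_num)).mul_const ‖h‖
  obtain ⟨n, hn⟩ := (hlim.eventually_lt_const hε).exists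
  obtain ⟨y, hy, a, b, hab, h1, h2⟩ := key n
  exact ⟨y, hy, a, b, hab.trans_lt hn, h1, h2⟩

theorem IsPosTrace.re_smul_one {τ : Alg M →ₗ[ℂ] ℂ} (c : ℝ) :
    (τ (c • (1 : Alg M))).re = c * (τ 1).re := by
  rw [← Complex.coe_smul, map_smul, smul_eq_mul, Complex.re_ofReal_mul]

/-- The trace of a `II₁` factor is unique. -/
theorem IsIIOneFactor.trace_unique (hM : IsIIOneFactor M tr) {τ : Alg M →ₗ[ℂ] ℂ} (hτ : IsPosTrace τ)
    {h : Alg M} (hh : 0 ≤ h) : (τ h).re = (τ 1).re * (tr h).re := by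
  have h1 : 0 ≤ (τ 1).re := hτ.re_nonneg zero_le_one
  refine eq_of_abs_sub_le_all fun ε hε => ?_
  obtain ⟨y, hy, a, b, hab, ha, hb⟩ := hM.exists_average hh
    (show 0 < ε / ((τ 1).re + 1) by positivity)
  have e1 := hτ.re_mono ha
  have e2 := hτ.re_mono hb
  have e3 := hM.isPosTrace.re_mono ha
  have e4 := hM.isPosTrace.re_mono hb
  rw [IsPosTrace.re_smul_one, hy.trace_eq hτ.mul_comm] at e1
  rw [IsPosTrace.re_smul_one, hy.trace_eq hτ.mul_comm] at e2
  rw [IsPosTrace.re_smul_one, hy.trace_eq hM.tr_mul_comm, hM.tr_one, Complex.one_re, mul_one] at e3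
  rw [IsPosTrace.re_smul_one, hy.trace_eq hM.tr_mul_comm, hM.tr_one, Complex.one_re, mul_one] at e4
  have e5 : (b - a) * (τ 1).re ≤ ε := by
    rw [lt_div_iff₀ (by positivity)] at hab
    have : 0 ≤ b - a := by linarith
    nlinarith
  rw [abs_le]
  constructor <;> nlinarith

/-- Every nonzero positive element of a `II₁` factor is full. -/
theorem IsIIOneFactor.exists_sum_eq_one (hM : IsIIOneFactor M tr) {h : Alg M} (hh : 0 ≤ h)
    (h0 : h ≠ 0) : ∃ (r : ℕ) (a : Fin r → Alg M), ∑ s, star (a s) * h * a s = 1 := by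
  have ht : 0 < (tr h).re := (hM.isPosTrace.re_nonneg hh).lt_of_ne fun h1 =>
    h0 (hM.eq_zero_of_tr_eq_zero hh (by rw [hM.isPosTrace.eq_re hh, ← h1, Complex.ofReal_zero]))
  obtain ⟨y, hy, a, b, hab, ha, hb⟩ := hM.exists_average hh ht
  have e4 := hM.isPosTrace.re_mono hb
  rw [IsPosTrace.re_smul_one, hy.trace_eq hM.tr_mul_comm, hM.tr_one, Complex.one_re, mul_one] at e4
  have ha0 : 0 < a := by linarith
  obtain ⟨ι, _, d, hd⟩ := hy.exists_sum
  obtain ⟨q, hqs, hqq⟩ := exists_mul_mul_eq_one ha0 ha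
  let E := Fintype.equivFin ι
  refine ⟨Fintype.card ι, fun s => d (E.symm s) * q, ?_⟩
  rw [E.symm.sum_comp fun s => star (d s * q) * h * (d s * q), ← hqq, hd, Finset.mul_sum,
    Finset.sum_mul]
  refine Finset.sum_congr rfl fun s _ => ?_
  rw [star_mul, hqs]
  simp only [mul_assoc]

end

section

open Filter Topology
variable {tr : Alg M →ₗ[ℂ] ℂ}

/-! ### A criterion for normality -/

section Normality

variable (M) in
/-- The vector functional `a ↦ ⟪ξ, a η⟫`. -/
def vectorFunctional (ξ η : H) : StrongDual ℂ (Alg M) :=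
  LinearMap.mkContinuous
    { toFun := fun a => inner ℂ ξ ((a : H →L[ℂ] H) η)
      map_add' := fun a b => by simp
      map_smul' := fun z a => by simp } (‖ξ‖ * ‖η‖) fun a => by
    refine (norm_inner_le_norm _ _).trans ?_
    rw [mul_assoc, mul_comm ‖η‖]
    exact mul_le_mul_of_nonneg_left ((a : H →L[ℂ] H).le_opNorm η) (norm_nonneg _)

@[simp] theorem vectorFunctional_apply (ξ η : H) (a : Alg M) :
    vectorFunctional M ξ η a = inner ℂ ξ ((a : H →L[ℂ] H) η) := rfl

theorem norm_vectorFunctional_le (ξ η : H) : ‖vectorFunctional M ξ η‖ ≤ ‖ξ‖ * ‖η‖ :=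
  LinearMap.mkContinuous_norm_le _ (by positivity) _

theorem summable_norm_mul_norm {ι E F : Type*} [SeminormedAddCommGroup E] [SeminormedAddCommGroup F]
    {ξ : ι → E} {η : ι → F} (h1 : Summable fun i => ‖ξ i‖ ^ 2) (h2 : Summable fun i => ‖η i‖ ^ 2) :
    Summable fun i => ‖ξ i‖ * ‖η i‖ :=
  Summable.of_nonneg_of_le (fun i => by positivity)
    (fun i => by nlinarith [sq_nonneg (‖ξ i‖ - ‖η i‖)]) (h1.add h2)

theorem hasSum_vectorFunctional {f : StrongDual ℂ (Alg M)} {ι : Type} {ξ η : ι → H}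
    (h1 : Summable fun i => ‖ξ i‖ ^ 2) (h2 : Summable fun i => ‖η i‖ ^ 2)
    (h : ∀ a : Alg M, HasSum (fun i => inner ℂ (ξ i) ((a : H →L[ℂ] H) (η i))) (f a)) :
    HasSum (fun i => vectorFunctional M (ξ i) (η i)) f := by
  have hs : Summable fun i => vectorFunctional M (ξ i) (η i) :=
    Summable.of_norm_bounded (summable_norm_mul_norm h1 h2) fun i => norm_vectorFunctional_le _ _
  have : ∑' i, vectorFunctional M (ξ i) (η i) = f := by
    ext a
    have := ContinuousLinearMap.hasSum (ContinuousLinearMap.apply ℂ ℂ a) hs.hasSum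
    exact this.unique (h a)
  exact this ▸ hs.hasSum

/-- Normal functionals represented by square summable families of square norm at most `r`. -/
def IsNormalBounded (r : ℝ) (f : StrongDual ℂ (Alg M)) : Prop :=
  ∃ (ι : Type) (ξ η : ι → H), Summable (fun i => ‖ξ i‖ ^ 2) ∧ Summable (fun i => ‖η i‖ ^ 2) ∧
    ∑' i, ‖ξ i‖ ^ 2 ≤ r ∧ ∑' i, ‖η i‖ ^ 2 ≤ r ∧
    ∀ a : Alg M, HasSum (fun i => inner ℂ (ξ i) ((a : H →L[ℂ] H) (η i))) (f a)

theorem IsNormalBounded.isNormal {r : ℝ} {f : StrongDual ℂ (Alg M)} (h : IsNormalBounded r f) :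
    IsNormal f := by
  obtain ⟨ι, ξ, η, h1, h2, -, -, h3⟩ := h
  exact ⟨ι, ξ, η, h1, h2, h3⟩

theorem IsNormalBounded.smul {r c : ℝ} (hc : 0 ≤ c) {f : StrongDual ℂ (Alg M)}
    (h : IsNormalBounded r f) : IsNormalBounded (c * r) (c • f) := by
  obtain ⟨ι, ξ, η, h1, h2, h3, h4, h5⟩ := h
  have hn : ∀ x : H, ‖((Real.sqrt c : ℝ) : ℂ) • x‖ ^ 2 = c * ‖x‖ ^ 2 := fun x => by
    rw [norm_smul, mul_pow, Complex.norm_real, Real.norm_eq_abs, sq_abs, Real.sq_sqrt hc]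
  refine ⟨ι, fun i => ((Real.sqrt c : ℝ) : ℂ) • ξ i, fun i => ((Real.sqrt c : ℝ) : ℂ) • η i, ?_, ?_,
    ?_, ?_, fun a => ?_⟩
  · simpa only [hn] using h1.mul_left c
  · simpa only [hn] using h2.mul_left c
  · simp only [hn, tsum_mul_left]
    exact mul_le_mul_of_nonneg_left h3 hc
  · simp only [hn, tsum_mul_left]
    exact mul_le_mul_of_nonneg_left h4 hc
  · have h6 : ∀ i, inner ℂ (((Real.sqrt c : ℝ) : ℂ) • ξ i)
        ((a : H →L[ℂ] H) (((Real.sqrt c : ℝ) : ℂ) • η i)) = c * inner ℂ (ξ i) ((a : H →L[ℂ] H) (η i)) :=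
      fun i => by
        rw [map_smul, inner_smul_left, inner_smul_right, Complex.conj_ofReal, ← mul_assoc,
          ← Complex.ofReal_mul, Real.mul_self_sqrt hc]
    simp only [h6]
    exact (h5 a).mul_left (c : ℂ)

theorem IsNormalBounded.add {r s : ℝ} {f g : StrongDual ℂ (Alg M)} (hf : IsNormalBounded r f)
    (hg : IsNormalBounded s g) : IsNormalBounded (r + s) (f + g) := by
  obtain ⟨ι, ξ, η, h1, h2, h3, h4, h5⟩ := hf
  obtain ⟨κ, ξ', η', h1', h2', h3', h4', h5'⟩ := hg
  refine ⟨ι ⊕ κ, Sum.elim ξ ξ', Sum.elim η η', Summable.sum _ h1 h1', Summable.sum _ h2 h2', ?_, ?_,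
    fun a => HasSum.sum (h5 a) (h5' a)⟩
  · exact ((HasSum.sum (f := fun i => ‖Sum.elim ξ ξ' i‖ ^ 2) h1.hasSum h1'.hasSum).tsum_eq).trans_le
      (add_le_add h3 h3')
  · exact ((HasSum.sum (f := fun i => ‖Sum.elim η η' i‖ ^ 2) h2.hasSum h2'.hasSum).tsum_eq).trans_le
      (add_le_add h4 h4')

theorem convex_isNormalBounded : Convex ℝ {f : StrongDual ℂ (Alg M) | IsNormalBounded 1 f} := by
  intro f hf g hg s t hs ht hst
  have := (IsNormalBounded.smul hs hf).add (IsNormalBounded.smul ht hg)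
  rwa [mul_one, mul_one, hst] at this

theorem isNormalBounded_vectorFunctional {ξ η : H} (hξ : ‖ξ‖ ≤ 1) (hη : ‖η‖ ≤ 1) :
    IsNormalBounded 1 (vectorFunctional M ξ η) := by
  refine ⟨Unit, fun _ => ξ, fun _ => η, (hasSum_fintype _).summable, (hasSum_fintype _).summable,
    ?_, ?_, fun a => ?_⟩
  · rw [tsum_fintype, Fintype.sum_unique]; exact pow_le_one₀ (norm_nonneg _) hξ
  · rw [tsum_fintype, Fintype.sum_unique]; exact pow_le_one₀ (norm_nonneg _) hη
  · exact hasSum_unique (fun _ : Unit => inner ℂ ξ ((a : H →L[ℂ] H) η))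

theorem vectorFunctional_smul_right (z : ℂ) (ξ η : H) :
    vectorFunctional M ξ (z • η) = z • vectorFunctional M ξ η := by
  ext a; simp

theorem vectorFunctional_smul_left (z : ℂ) (ξ η : H) :
    vectorFunctional M (z • ξ) η = (starRingEnd ℂ) z • vectorFunctional M ξ η := by
  ext a; simp [mul_comm]

/-- Functionals on the predual that are bounded by `u` on vector functionals are evaluations at
elements of norm at most `u`. -/
theorem exists_eval {Λ : StrongDual ℂ (StrongDual ℂ (Alg M))} {u : ℝ} (hu : 0 ≤ u)
    (h : ∀ ξ η : H, ‖Λ (vectorFunctional M ξ η)‖ ≤ u * ‖ξ‖ * ‖η‖) :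
    ∃ S : Alg M, ‖S‖ ≤ u ∧ ∀ ξ η : H, Λ (vectorFunctional M ξ η) = vectorFunctional M ξ η S := by
  let B : H →ₗ⋆[ℂ] H →ₗ[ℂ] ℂ := LinearMap.mk₂'ₛₗ (starRingEnd ℂ) (RingHom.id ℂ)
    (fun ξ η => Λ (vectorFunctional M ξ η))
    (fun x y z => by
      rw [← map_add]; congr 1; ext a; simp)
    (fun c x z => by rw [vectorFunctional_smul_left, map_smul])
    (fun x y z => by
      rw [← map_add]; congr 1; ext a; simp)
    (fun c x z => by rw [vectorFunctional_smul_right, map_smul]; rfl)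
  let T := InnerProductSpace.continuousLinearMapOfBilin (B.mkContinuous₂ u h)
  let S := ContinuousLinearMap.adjoint T
  have hS : ∀ ξ η, inner ℂ ξ (S η) = Λ (vectorFunctional M ξ η) := fun ξ η => by
    rw [ContinuousLinearMap.adjoint_inner_right]
    exact InnerProductSpace.continuousLinearMapOfBilin_apply _ ξ η
  have hSM : S ∈ M.toStarSubalgebra := mem_alg_of_commute fun y hy => by
    refine ContinuousLinearMap.ext fun η => ext_inner_left ℂ fun ξ => ?_
    change inner ℂ ξ (S (y η)) = inner ℂ ξ (y (S η))
    rw [← ContinuousLinearMap.adjoint_inner_left y, hS, hS]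
    congr 1
    ext a
    have := congrArg (fun T : H →L[ℂ] H => T η) (commute_of_mem_commutant a hy).eq
    simp only [vectorFunctional_apply, ContinuousLinearMap.adjoint_inner_left]
    exact congrArg (inner ℂ ξ) this
  refine ⟨⟨S, hSM⟩, ?_, fun ξ η => (hS ξ η).symm⟩
  refine ContinuousLinearMap.opNorm_le_bound _ hu fun η => ?_
  rcases eq_or_ne (S η) 0 with h0 | h0
  · change ‖S η‖ ≤ _
    rw [h0, norm_zero]; positivity
  · have h1 := h (S η) η
    rw [← hS, inner_self_eq_norm_sq_to_K] at h1
    have h2 : ‖S η‖ ^ 2 ≤ u * ‖S η‖ * ‖η‖ := by simpa using h1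
    have h3 : 0 < ‖S η‖ := norm_pos_iff.2 h0
    change ‖S η‖ ≤ _
    nlinarith

/-- Norm limits of normal functionals are approximated by normal functionals represented by vectors
of the right size. -/
theorem mem_closure_isNormalBounded {f : StrongDual ℂ (Alg M)}
    (hf : f ∈ closure {g : StrongDual ℂ (Alg M) | IsNormal g}) (h1 : ‖f‖ ≤ 1) :
    f ∈ closure {g : StrongDual ℂ (Alg M) | IsNormalBounded 1 g} := by
  by_contra hcon
  obtain ⟨Λ, u, hΛ, hu⟩ := RCLike.geometric_hahn_banach_closed_point (𝕜 := ℂ)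
    convex_isNormalBounded.closure isClosed_closure hcon
  have hΛ' : ∀ g : StrongDual ℂ (Alg M), IsNormalBounded 1 g → (Λ g).re < u := fun g hg =>
    hΛ g (subset_closure hg)
  have hu0 : 0 ≤ u := by
    have := hΛ' _ (isNormalBounded_vectorFunctional (ξ := 0) (η := 0) (by simp) (by simp))
    have h0 : vectorFunctional M (0 : H) 0 = 0 := by ext a; simp
    rw [h0, map_zero] at this
    exact this.le
  have hunit : ∀ ξ η : H, ‖ξ‖ ≤ 1 → ‖η‖ ≤ 1 → ‖Λ (vectorFunctional M ξ η)‖ ≤ u := by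
    intro ξ η hξ hη
    obtain ⟨c, hc, hcz⟩ := Complex.exists_norm_eq_mul_self (Λ (vectorFunctional M ξ η))
    have h2 := hΛ' _ (isNormalBounded_vectorFunctional (ξ := ξ) (η := c • η) hξ
      (by rw [norm_smul, hc, one_mul]; exact hη))
    rw [vectorFunctional_smul_right, map_smul, smul_eq_mul, ← hcz, Complex.ofReal_re] at h2
    exact h2.le
  have hbd : ∀ ξ η : H, ‖Λ (vectorFunctional M ξ η)‖ ≤ u * ‖ξ‖ * ‖η‖ := by
    intro ξ η
    have hn : ∀ x : H, ‖((‖x‖⁻¹ : ℝ) : ℂ) • x‖ ≤ 1 := fun x => by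
      rw [norm_smul, Complex.norm_real, Real.norm_eq_abs, abs_of_nonneg (by positivity)]
      exact inv_mul_le_one
    have hx : ∀ x : H, x = ((‖x‖ : ℝ) : ℂ) • ((‖x‖⁻¹ : ℝ) : ℂ) • x := fun x => by
      rcases eq_or_ne x 0 with rfl | h
      · simp
      · rw [smul_smul, ← Complex.ofReal_mul, mul_inv_cancel₀ (norm_ne_zero_iff.2 h),
          Complex.ofReal_one, one_smul]
    have h2 := hunit _ _ (hn ξ) (hn η)
    conv_lhs => rw [hx ξ, hx η]
    rw [vectorFunctional_smul_left, vectorFunctional_smul_right, map_smul, map_smul, norm_smul,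
      norm_smul, Complex.conj_ofReal, Complex.norm_real, Complex.norm_real, norm_norm, norm_norm]
    calc ‖ξ‖ * (‖η‖ * _) ≤ ‖ξ‖ * (‖η‖ * u) := by gcongr
      _ = u * ‖ξ‖ * ‖η‖ := by ring
  obtain ⟨S, hSn, hS⟩ := exists_eval hu0 hbd
  have hev : ∀ g ∈ closure {g : StrongDual ℂ (Alg M) | IsNormal g}, Λ g = g S := by
    intro g hg
    refine closure_minimal (s := {g : StrongDual ℂ (Alg M) | IsNormal g})
      (t := {g | Λ g = ContinuousLinearMap.apply ℂ ℂ S g}) ?_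
      (isClosed_eq Λ.continuous (ContinuousLinearMap.continuous _)) hg
    rintro g ⟨ι, ξ, η, h1, h2, h3⟩
    have h4 := hasSum_vectorFunctional h1 h2 h3
    have h5 := Λ.hasSum h4
    simp only [hS, vectorFunctional_apply] at h5
    exact h5.unique (h3 S)
  have h2 : (Λ f).re ≤ u := by
    rw [hev f hf]
    calc (f S).re ≤ ‖f S‖ := Complex.re_le_norm _
      _ ≤ ‖f‖ * ‖S‖ := f.le_opNorm S
      _ ≤ 1 * u := by gcongr
      _ = u := one_mul u
  exact absurd hu (not_lt.2 h2)

/-- Limits of normal functionals in norm are normal. -/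
theorem isNormal_of_mem_closure {f : StrongDual ℂ (Alg M)}
    (hf : f ∈ closure {g : StrongDual ℂ (Alg M) | IsNormal g}) : IsNormal f := by
  let N : AddSubgroup (StrongDual ℂ (Alg M)) :=
    { carrier := {g | IsNormal g}
      add_mem' := fun {g g'} hg hg' => hg.add hg'
      zero_mem' := IsNormal.zero
      neg_mem' := fun {g} hg => by
        obtain ⟨ι, ξ, η, h1, h2, h3⟩ := hg
        refine ⟨ι, ξ, fun i => -η i, h1, by simpa using h2, fun a => ?_⟩
        simpa using (h3 a).neg }
  have step : ∀ r : ℝ, 0 < r → ∀ g ∈ N.topologicalClosure, ‖g‖ ≤ r →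
      ∃ d, IsNormalBounded r d ∧ g - d ∈ N.topologicalClosure ∧ ‖g - d‖ ≤ r / 4 := by
    intro r hr g hg hgr
    have hg1 : r⁻¹ • g ∈ closure {g : StrongDual ℂ (Alg M) | IsNormal g} := by
      have : (fun x : StrongDual ℂ (Alg M) => r⁻¹ • x) g ∈
          closure {g : StrongDual ℂ (Alg M) | IsNormal g} := by
        refine map_mem_closure (continuous_const_smul _) hg fun x hx => ?_
        obtain ⟨ι, ξ, η, h1, h2, h3⟩ := hx
        refine ⟨ι, ξ, fun i => ((r⁻¹ : ℝ) : ℂ) • η i, h1, ?_, fun a => ?_⟩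
        · simpa only [norm_smul, mul_pow] using h2.mul_left _
        · simp only [map_smul, inner_smul_right]
          exact (h3 a).mul_left _
      exact this
    have hg2 : ‖r⁻¹ • g‖ ≤ 1 := by
      rw [norm_smul, norm_inv, Real.norm_of_nonneg hr.le]
      exact inv_mul_le_one_of_le₀ hgr hr.le
    obtain ⟨d, hd, hdist⟩ := Metric.mem_closure_iff.1 (mem_closure_isNormalBounded hg1 hg2) (1 / 4)
      (by norm_num)
    have hd' := IsNormalBounded.smul hr.le hd
    rw [mul_one] at hd'
    refine ⟨r • d, hd', sub_mem hg (subset_closure hd'.isNormal), ?_⟩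
    have : g - r • d = r • (r⁻¹ • g - d) := by
      rw [smul_sub, smul_smul, mul_inv_cancel₀ hr.ne', one_smul]
    rw [this, norm_smul, Real.norm_of_nonneg hr.le]
    rw [dist_eq_norm] at hdist
    calc r * _ ≤ r * (1 / 4) := by gcongr
      _ = r / 4 := by ring
  set R := ‖f‖ + 1 with hR
  have hR0 : 0 < R := by positivity
  have hRn : ∀ n : ℕ, 0 < R * (1 / 4) ^ n := fun n => by positivity
  choose! d hd hdN hdn using step
  let G : ∀ n : ℕ, {g : StrongDual ℂ (Alg M) // g ∈ N.topologicalClosure ∧ ‖g‖ ≤ R * (1 / 4) ^ n} :=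
    fun n => Nat.rec ⟨f, hf, by simp [hR]⟩ (fun n g => ⟨g.1 - d (R * (1 / 4) ^ n) g.1,
      hdN _ (hRn n) _ g.2.1 g.2.2, (hdn _ (hRn n) _ g.2.1 g.2.2).trans_eq (by rw [Nat.succ_eq_add_one]; ring)⟩) n
  let D : ℕ → StrongDual ℂ (Alg M) := fun n => d (R * (1 / 4) ^ n) (G n).1
  have hGD : ∀ n, (G (n + 1)).1 = (G n).1 - D n := fun n => rfl
  have hD : ∀ n, IsNormalBounded (R * (1 / 4) ^ n) (D n) := fun n => hd _ (hRn n) _ (G n).2.1 (G n).2.2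
  have hlim : Tendsto (fun n : ℕ => R * (1 / 4 : ℝ) ^ n) atTop (𝓝 0) := by
    simpa using (tendsto_pow_atTop_nhds_zero_of_lt_one (by norm_num : (0 : ℝ) ≤ 1 / 4)
      (by norm_num)).const_mul R
  have hpart : ∀ n, ∑ k ∈ Finset.range n, D k = f - (G n).1 := fun n => by
    induction n with
    | zero => simp [G]
    | succ n ih => rw [Finset.sum_range_succ, ih, hGD]; abel
  have hsumm : Summable fun n : ℕ => R * (1 / 4 : ℝ) ^ n :=
    (summable_geometric_of_lt_one (by norm_num) (by norm_num)).mul_left R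
  choose ι ξ η h1 h2 h3 h4 h5 using hD
  have hS : ∀ {θ : ∀ n, ι n → H}, (∀ n, Summable fun i => ‖θ n i‖ ^ 2) →
      (∀ n, ∑' i, ‖θ n i‖ ^ 2 ≤ R * (1 / 4) ^ n) →
      Summable fun p : Σ n, ι n => ‖θ p.1 p.2‖ ^ 2 := fun {θ} e1 e2 =>
    (summable_sigma_of_nonneg fun _ => by positivity).2 ⟨e1,
      Summable.of_nonneg_of_le (fun n => tsum_nonneg fun i => by positivity) e2 hsumm⟩
  have hξ := hS h1 h3
  have hη := hS h2 h4
  refine ⟨Σ n, ι n, fun p => ξ p.1 p.2, fun p => η p.1 p.2, hξ, hη, fun a => ?_⟩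
  have hDs : HasSum (fun n => D n a) (f a) := by
    have hsum : Summable fun n => D n a := by
      refine Summable.of_norm_bounded (hsumm.mul_left (2 * ‖a‖)) fun n => ?_
      have e1 : D n = (G n).1 - (G (n + 1)).1 := by rw [hGD]; abel
      have e2 : ‖D n‖ ≤ 2 * (R * (1 / 4) ^ n) := by
        rw [e1]
        refine (norm_sub_le _ _).trans ?_
        have := (G (n + 1)).2.2
        have h6 : R * (1 / 4 : ℝ) ^ (n + 1) ≤ R * (1 / 4) ^ n := by
          rw [pow_succ]; nlinarith [hRn n]
        linarith [(G n).2.2]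
      calc ‖D n a‖ ≤ ‖D n‖ * ‖a‖ := (D n).le_opNorm a
        _ ≤ 2 * (R * (1 / 4) ^ n) * ‖a‖ := by gcongr
        _ = _ := by ring
    refine hsum.hasSum_iff_tendsto_nat.2 ?_
    have e3 : ∀ n, ∑ k ∈ Finset.range n, D k a = f a - (G n).1 a := fun n => by
      have := congrArg (fun g : StrongDual ℂ (Alg M) => g a) (hpart n)
      simpa using this
    simp only [e3]
    have e4 : Tendsto (fun n => (G n).1 a) atTop (𝓝 0) := by
      refine squeeze_zero_norm (fun n => ((G n).1.le_opNorm a).trans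
        (mul_le_mul_of_nonneg_right (G n).2.2 (norm_nonneg a))) ?_
      simpa using hlim.mul_const ‖a‖
    simpa using e4.const_sub (f a)
  refine HasSum.sigma_of_hasSum hDs (fun n => h5 n a) ?_
  refine Summable.of_norm_bounded ((summable_norm_mul_norm hξ hη).mul_left ‖a‖) fun p => ?_
  refine (norm_inner_le_norm _ _).trans ?_
  calc ‖ξ p.1 p.2‖ * _ ≤ ‖ξ p.1 p.2‖ * (‖a‖ * ‖η p.1 p.2‖) := by
        gcongr; exact (a : H →L[ℂ] H).le_opNorm _
    _ = _ := by ring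

end Normality

end

section

open Filter Topology
variable {tr : Alg M →ₗ[ℂ] ℂ}

section Normality

open scoped ComplexOrder

/-- The trace as a positive linear map. -/
def IsIIOneFactor.positive (hM : IsIIOneFactor M tr) : Alg M →ₚ[ℂ] ℂ :=
  PositiveLinearMap.mk₀ tr fun x hx => by
    obtain ⟨r, hr, h⟩ := hM.isPosTrace.apply_nonneg hx
    rw [h]
    exact_mod_cast hr

/-- Bounded functionals continuous for the `2`-norm on bounded sets are controlled by the norm
and the `2`-norm. -/
theorem exists_le_norm_add_algTwoNorm (hτ : IsPosTrace tr) {f : Alg M →ₗ[ℂ] ℂ} {B : ℝ}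
    (hB : ∀ a, ‖f a‖ ≤ B * ‖a‖)
    (hf : ∀ a : ℕ → Alg M, BddA a → NullA tr a → Tendsto (fun n => f (a n)) atTop (𝓝 0)) {ε : ℝ}
    (hε : 0 < ε) : ∃ C : ℝ, 0 < C ∧ ∀ a, ‖f a‖ ≤ ε * ‖a‖ + C * algTwoNorm tr a := by
  by_contra! hcon
  have hcon' : ∀ n : ℕ, ∃ a : Alg M, ‖a‖ = 1 ∧ ε + (n + 1) * algTwoNorm tr a < ‖f a‖ := by
    intro n
    obtain ⟨a, ha⟩ := hcon (n + 1) (by positivity)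
    have ha0 : 0 < ‖a‖ := norm_pos_iff.2 fun h => by
      rw [h] at ha
      simp [algTwoNorm] at ha
    have hnn : ‖((‖a‖⁻¹ : ℝ) : ℂ)‖ = ‖a‖⁻¹ := by
      rw [Complex.norm_real, Real.norm_of_nonneg (by positivity)]
    refine ⟨((‖a‖⁻¹ : ℝ) : ℂ) • a, ?_, ?_⟩
    · rw [norm_smul, hnn, inv_mul_cancel₀ ha0.ne']
    · have h2 : algTwoNorm tr (((‖a‖⁻¹ : ℝ) : ℂ) • a) = ‖a‖⁻¹ * algTwoNorm tr a := by
        rw [algTwoNorm, algTwoNorm, star_smul, smul_mul_smul_comm, map_smul, smul_eq_mul,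
          Complex.star_def, Complex.conj_ofReal, ← Complex.ofReal_mul, Complex.re_ofReal_mul,
          Real.sqrt_mul (by positivity), Real.sqrt_mul_self (by positivity)]
      rw [map_smul, norm_smul, hnn, h2]
      have := mul_lt_mul_of_pos_left ha (inv_pos.2 ha0)
      calc ε + (n + 1) * (‖a‖⁻¹ * algTwoNorm tr a)
          = ‖a‖⁻¹ * (ε * ‖a‖ + (n + 1) * algTwoNorm tr a) := by
            field_simp
        _ < _ := this
  choose a ha1 ha2 using hcon'
  have hbd : BddA a := ⟨1, fun n => (ha1 n).le⟩
  have hnull : NullA tr a := by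
    rw [nullA_iff hτ]
    have hle : ∀ n : ℕ, algTwoNorm tr (a n) ≤ B * (1 / ((n : ℝ) + 1)) := fun n => by
      have h1 := (ha2 n).trans_le (hB (a n))
      rw [ha1, mul_one] at h1
      have hn : (0 : ℝ) < n + 1 := by positivity
      rw [mul_one_div, le_div_iff₀ hn]
      nlinarith
    refine squeeze_zero (fun n => Real.sqrt_nonneg _) hle ?_
    simpa using tendsto_one_div_add_atTop_nhds_zero_nat.const_mul B
  have h0 := (hf a hbd hnull).norm
  rw [norm_zero] at h0
  obtain ⟨n, hn⟩ := (h0.eventually_lt_const hε).exists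
  have h1 := ha2 n
  have h2 : 0 ≤ ((n : ℝ) + 1) * algTwoNorm tr (a n) :=
    mul_nonneg (by positivity) (Real.sqrt_nonneg _)
  linarith

/-- Linear functionals controlled by the sum of a norm and a weaker Hilbert norm are close to inner
products. -/
theorem exists_inner_approx {A L : Type*} [NormedAddCommGroup A] [NormedSpace ℂ A]
    [NormedAddCommGroup L] [InnerProductSpace ℂ L] [CompleteSpace L] (ι : A →ₗ[ℂ] L)
    (hιle : ∀ a, ‖ι a‖ ≤ ‖a‖) (hιd : DenseRange ι) {f : A →ₗ[ℂ] ℂ} {ε C : ℝ}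
    (hε : 0 < ε) (hC : 0 < C) (h : ∀ a, ‖f a‖ ≤ ε * ‖a‖ + C * ‖ι a‖) :
    ∃ b : A, ∀ a, ‖f a - inner ℂ (ι b) (ι a)‖ ≤ 3 * ε * ‖a‖ := by
  let j : A →ₗ[ℂ] A × L := (((2 * ε : ℝ) : ℂ) • LinearMap.id).prod (((2 * C : ℝ) : ℂ) • ι)
  have hj : ∀ a, j a = (((2 * ε : ℝ) : ℂ) • a, ((2 * C : ℝ) : ℂ) • ι a) := fun a => rfl
  have hjn : ∀ a, ‖f a‖ ≤ ‖j a‖ := fun a => by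
    rw [hj, Prod.norm_def, norm_smul, norm_smul, Complex.norm_real, Complex.norm_real,
      Real.norm_of_nonneg (by positivity), Real.norm_of_nonneg (by positivity)]
    have h1 := le_max_left (2 * ε * ‖a‖) (2 * C * ‖ι a‖)
    have h2 := le_max_right (2 * ε * ‖a‖) (2 * C * ‖ι a‖)
    linarith [h a]
  have hji : Function.Injective j := fun a b hab => by
    have h1 := congrArg Prod.fst hab
    simp only [hj] at h1
    exact smul_right_injective _ (by exact_mod_cast (by positivity : (2 * ε : ℝ) ≠ 0)) h1
  let E := LinearEquiv.ofInjective j hji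
  let f0 : StrongDual ℂ (LinearMap.range j) := LinearMap.mkContinuous (f ∘ₗ E.symm.toLinearMap) 1 (by
    intro x
    obtain ⟨a, rfl⟩ := E.surjective x
    rw [one_mul, LinearMap.comp_apply, LinearEquiv.coe_coe, E.symm_apply_apply]
    exact hjn a)
  obtain ⟨g, hg, hgn⟩ := exists_extension_norm_eq (LinearMap.range j) f0
  have hg1 : ‖g‖ ≤ 1 := hgn.trans_le (LinearMap.mkContinuous_norm_le _ zero_le_one _)
  have hgf : ∀ a, g (j a) = f a := fun a => by
    have := hg (E a)
    simpa [f0] using! this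
  let g2 : StrongDual ℂ L :=
    g.comp ((ContinuousLinearMap.inr ℂ (A) L).comp (((2 * C : ℝ) : ℂ) • ContinuousLinearMap.id ℂ _))
  let ζ := (InnerProductSpace.toDual ℂ L).symm g2
  obtain ⟨b, hb⟩ := hιd.exists_dist_lt ζ hε
  refine ⟨b, fun a => ?_⟩
  have e1 : f a = g (((2 * ε : ℝ) : ℂ) • a, 0) + inner ℂ ζ (ι a) := by
    rw [InnerProductSpace.toDual_symm_apply, ← hgf]
    change _ = _ + g (0, ((2 * C : ℝ) : ℂ) • ι a)
    rw [← map_add, hj, Prod.mk_add_mk, add_zero, zero_add]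
  have e2 : ‖g (((2 * ε : ℝ) : ℂ) • a, (0 : L))‖ ≤ 2 * ε * ‖a‖ := by
    refine (g.le_opNorm _).trans ?_
    rw [Prod.norm_def, norm_zero, max_eq_left (norm_nonneg _), norm_smul, Complex.norm_real,
      Real.norm_of_nonneg (by positivity)]
    exact mul_le_of_le_one_left (by positivity) hg1
  have e3 : ‖inner ℂ (ζ - ι b) (ι a)‖ ≤ ε * ‖a‖ := by
    refine (norm_inner_le_norm _ _).trans ?_
    rw [dist_eq_norm] at hb
    exact mul_le_mul hb.le (hιle a) (norm_nonneg _) hε.le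
  rw [e1, add_sub_assoc, ← inner_sub_left]
  refine (norm_add_le _ _).trans ?_
  linarith

/-- Functionals controlled by the norm and the `2`-norm are close to functionals `tr(b* ·)`. -/
theorem IsIIOneFactor.exists_approx (hM : IsIIOneFactor M tr) {f : Alg M →ₗ[ℂ] ℂ} {ε C : ℝ}
    (hε : 0 < ε) (hC : 0 < C) (h : ∀ a, ‖f a‖ ≤ ε * ‖a‖ + C * algTwoNorm tr a) :
    ∃ b : Alg M, ∀ a, ‖f a - tr (star b * a)‖ ≤ 3 * ε * ‖a‖ := by
  let φ := hM.positive
  let ι : Alg M →ₗ[ℂ] φ.GNS :=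
    (UniformSpace.Completion.toComplL (𝕜 := ℂ) (E := φ.PreGNS)).toLinearMap ∘ₗ φ.toPreGNS.toLinearMap
  have hι : ∀ a, ‖ι a‖ = algTwoNorm tr a := fun a =>
    UniformSpace.Completion.norm_coe (φ.toPreGNS a)
  have hιi : ∀ a b, inner ℂ (ι a) (ι b) = tr (star a * b) := fun a b =>
    UniformSpace.Completion.inner_coe (φ.toPreGNS a) (φ.toPreGNS b)
  have hιle : ∀ a, ‖ι a‖ ≤ ‖a‖ := fun a => by
    rw [hι, algTwoNorm, Real.sqrt_le_left (norm_nonneg _)]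
    have := hM.isPosTrace.twoSq_mul_le a 1
    have h1 : twoSq tr (1 : Alg M) = 1 := by simp [twoSq, hM.tr_one]
    rwa [mul_one, h1, mul_one] at this
  have hιd : DenseRange ι := UniformSpace.Completion.denseRange_coe.comp
    φ.toPreGNS.surjective.denseRange (UniformSpace.Completion.continuous_coe _)
  obtain ⟨b, hb⟩ := exists_inner_approx ι hιle hιd hε hC fun a => by rw [hι]; exact h a
  exact ⟨b, fun a => by rw [← hιi]; exact hb a⟩

/-- A bounded functional on a `II₁` factor that is continuous for the `2`-norm on bounded sets
is normal. -/
theorem IsIIOneFactor.isNormal_of_tendsto (hM : IsIIOneFactor M tr) {f : Alg M →ₗ[ℂ] ℂ} {B : ℝ}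
    (hB : ∀ a, ‖f a‖ ≤ B * ‖a‖)
    (hf : ∀ a : ℕ → Alg M, BddA a → NullA tr a → Tendsto (fun n => f (a n)) atTop (𝓝 0)) :
    IsNormal f := by
  let F : StrongDual ℂ (Alg M) := f.mkContinuous B hB
  refine isNormal_of_mem_closure (f := F) (Metric.mem_closure_iff.2 fun ε hε => ?_)
  obtain ⟨C, hC, h⟩ := exists_le_norm_add_algTwoNorm hM.isPosTrace hB hf (by positivity : 0 < ε / 6)
  obtain ⟨b, hb⟩ := hM.exists_approx (by positivity) hC h
  have hn : IsNormal fun a => tr (star b * a) := by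
    simpa using hM.tr_normal.mul_mul b 1
  let g : Alg M →ₗ[ℂ] ℂ := tr ∘ₗ LinearMap.mulLeft ℂ (star b)
  have hgB : ∀ a, ‖g a‖ ≤ (B + 3 * (ε / 6)) * ‖a‖ := fun a => by
    have h1 : g a = f a - (f a - tr (star b * a)) := by simp [g]
    rw [h1, add_mul]
    exact (norm_sub_le _ _).trans (add_le_add (hB a) (hb a))
  refine ⟨g.mkContinuous _ hgB, hn, ?_⟩
  rw [dist_eq_norm]
  refine (ContinuousLinearMap.opNorm_le_bound _ (by positivity : 0 ≤ 3 * (ε / 6)) fun a => hb a).trans_lt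
    ?_
  linarith

end Normality

end

section

open Filter Topology

/-! ### Matrices over a bimodule -/

section MatrixCalculus

set_option linter.unusedSectionVars false

variable {X Y : Bim M} {ι ι' κ κ' μ : Type} [Fintype ι] [Fintype ι'] [Fintype κ] [Fintype κ']
  [Fintype μ]

namespace Bim

theorem sum_ract (X : Bim M) (s : Finset ι) (x : ι → X) (a : Alg M) :
    X.ract (∑ i ∈ s, x i) a = ∑ i ∈ s, X.ract (x i) a := by
  rw [_root_.map_sum, LinearMap.sum_apply]

theorem inner_self_nonneg (X : Bim M) (x : X) : 0 ≤ X.inner x x := X.inner_nonneg x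

/-- Left multiplication of a matrix over `X` by a matrix over `M`. -/
def matLact : Matrix ι' ι (Alg M) →ₗ[ℂ] Matrix ι κ X →ₗ[ℂ] Matrix ι' κ X :=
  LinearMap.mk₂ ℂ (fun A x => Matrix.of fun i j => ∑ k, X.lact (A i k) (x k j))
    (fun A B x => by ext i j; simp [Finset.sum_add_distrib])
    (fun z A x => by ext i j; simp [Finset.smul_sum])
    (fun A x y => by ext i j; simp [Finset.sum_add_distrib])
    (fun z A x => by ext i j; simp [Finset.smul_sum])

/-- Right multiplication of a matrix over `X` by a matrix over `M`. -/
def matRact : Matrix ι κ X →ₗ[ℂ] Matrix κ κ' (Alg M) →ₗ[ℂ] Matrix ι κ' X :=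
  LinearMap.mk₂ ℂ (fun x A => Matrix.of fun i j => ∑ k, X.ract (x i k) (A k j))
    (fun x y A => by ext i j; simp [Finset.sum_add_distrib])
    (fun z x A => by ext i j; simp [Finset.smul_sum])
    (fun x A B => by ext i j; simp [Finset.sum_add_distrib])
    (fun z x A => by ext i j; simp [Finset.smul_sum])

/-- The matrix valued inner product of matrices over `X`. -/
def matInner : Matrix ι κ X →ₗ⋆[ℂ] Matrix ι κ' X →ₗ[ℂ] Matrix κ κ' (Alg M) :=
  LinearMap.mk₂'ₛₗ (starRingEnd ℂ) (RingHom.id ℂ)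
    (fun x y => Matrix.of fun i j => ∑ k, X.inner (x k i) (y k j))
    (fun x y A => by ext i j; simp [Finset.sum_add_distrib])
    (fun z x A => by ext i j; simp [Finset.smul_sum])
    (fun x A B => by ext i j; simp [Finset.sum_add_distrib])
    (fun z x A => by ext i j; simp [Finset.smul_sum])

/-- The matrix product of matrices over `X` and over `Y`. -/
def matTm : Matrix ι κ X →ₗ[ℂ] Matrix κ κ' Y →ₗ[ℂ] Matrix ι κ' (tensor X Y) :=
  LinearMap.mk₂ ℂ (fun x y => Matrix.of fun i j => ∑ k, tm (x i k) (y k j))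
    (fun x y A => by ext i j; simp [add_tm, Finset.sum_add_distrib])
    (fun z x A => by ext i j; simp [smul_tm, Finset.smul_sum])
    (fun x A B => by ext i j; simp [tm_add, Finset.sum_add_distrib])
    (fun z x A => by ext i j; simp [tm_smul, Finset.smul_sum])

theorem matLact_apply (A : Matrix ι' ι (Alg M)) (x : Matrix ι κ X) (i : ι') (j : κ) :
    matLact A x i j = ∑ k, X.lact (A i k) (x k j) := rfl

theorem matRact_apply (x : Matrix ι κ X) (A : Matrix κ κ' (Alg M)) (i : ι) (j : κ') :
    matRact x A i j = ∑ k, X.ract (x i k) (A k j) := rfl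

theorem matInner_apply (x : Matrix ι κ X) (y : Matrix ι κ' X) (i : κ) (j : κ') :
    matInner x y i j = ∑ k, X.inner (x k i) (y k j) := rfl

theorem matTm_apply (x : Matrix ι κ X) (y : Matrix κ κ' Y) (i : ι) (j : κ') :
    matTm x y i j = ∑ k, tm (x i k) (y k j) := rfl

theorem matLact_mul (A : Matrix μ ι' (Alg M)) (B : Matrix ι' ι (Alg M)) (x : Matrix ι κ X) :
    matLact (A * B) x = matLact A (matLact B x) := by
  refine Matrix.ext fun i j => ?_
  simp only [matLact_apply, Matrix.mul_apply, _root_.map_sum, LinearMap.sum_apply, X.mul_lact]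
  exact Finset.sum_comm

theorem matRact_mul (x : Matrix ι κ X) (A : Matrix κ κ' (Alg M)) (B : Matrix κ' μ (Alg M)) :
    matRact x (A * B) = matRact (matRact x A) B := by
  refine Matrix.ext fun i j => ?_
  simp only [matRact_apply, Matrix.mul_apply, _root_.map_sum, LinearMap.sum_apply, X.ract_mul]
  exact Finset.sum_comm

theorem matLact_matRact (A : Matrix ι' ι (Alg M)) (x : Matrix ι κ X) (B : Matrix κ κ' (Alg M)) :
    matLact A (matRact x B) = matRact (matLact A x) B := by
  refine Matrix.ext fun i j => ?_
  simp only [matRact_apply, matLact_apply, _root_.map_sum, LinearMap.sum_apply, X.lact_ract]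
  exact Finset.sum_comm

theorem matInner_matRact (x : Matrix ι κ X) (y : Matrix ι κ' X) (A : Matrix κ' μ (Alg M)) :
    matInner x (matRact y A) = matInner x y * A := by
  refine Matrix.ext fun i j => ?_
  simp only [matRact_apply, matInner_apply, Matrix.mul_apply, X.inner_ract, _root_.map_sum,
    Finset.sum_mul]
  rw [Finset.sum_comm]

theorem star_matInner (x : Matrix ι κ X) (y : Matrix ι κ' X) :
    (matInner x y).conjTranspose = matInner y x := by
  refine Matrix.ext fun i j => ?_
  simp only [matInner_apply, Matrix.conjTranspose_apply, star_sum, X.star_inner]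

theorem matInner_matRact_left (x : Matrix ι κ X) (y : Matrix ι κ' X) (A : Matrix κ μ (Alg M)) :
    matInner (matRact x A) y = A.conjTranspose * matInner x y := by
  rw [← star_matInner, matInner_matRact, Matrix.conjTranspose_mul, star_matInner]

theorem matInner_matLact (A : Matrix ι' ι (Alg M)) (x : Matrix ι κ X) (y : Matrix ι' κ' X) :
    matInner (matLact A x) y = matInner x (matLact A.conjTranspose y) := by
  refine Matrix.ext fun i j => ?_
  simp only [matLact_apply, matInner_apply, _root_.map_sum, LinearMap.sum_apply, Matrix.conjTranspose_apply,
    X.inner_lact]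
  rw [Finset.sum_comm]

theorem matLact_matTm (A : Matrix ι' ι (Alg M)) (x : Matrix ι κ X) (y : Matrix κ κ' Y) :
    matLact A (matTm x y) = matTm (matLact A x) y := by
  refine Matrix.ext fun i j => ?_
  simp only [matLact_apply, matTm_apply, _root_.map_sum, lact_tm]
  rw [Finset.sum_comm]
  refine Finset.sum_congr rfl fun k _ => ?_
  exact (map_sum ((tmL X Y).flip (y k j)) _ _).symm

theorem matRact_matTm (x : Matrix ι κ X) (y : Matrix κ κ' Y) (A : Matrix κ' μ (Alg M)) :
    matRact (matTm x y) A = matTm x (matRact y A) := by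
  refine Matrix.ext fun i j => ?_
  simp only [matRact_apply, matTm_apply, sum_ract]
  rw [Finset.sum_comm]
  refine Finset.sum_congr rfl fun k _ => ?_
  exact (map_sum (tmL X Y (x i k)) _ _).symm

theorem matTm_balanced (x : Matrix ι κ X) (A : Matrix κ κ' (Alg M)) (y : Matrix κ' μ Y) :
    matTm (matRact x A) y = matTm x (matLact A y) := by
  refine Matrix.ext fun i j => ?_
  simp only [matRact_apply, matTm_apply, matLact_apply]
  have h1 : ∀ k, tm (∑ l, X.ract (x i l) (A l k)) (y k j)
      = ∑ l, tm (x i l) (Y.lact (A l k) (y k j)) := fun k =>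
    (map_sum ((tmL X Y).flip (y k j)) _ _).trans
      (Finset.sum_congr rfl fun l _ => tm_balanced _ _ _)
  have h2 : ∀ l, tm (x i l) (∑ k, Y.lact (A l k) (y k j))
      = ∑ k, tm (x i l) (Y.lact (A l k) (y k j)) := fun l => map_sum (tmL X Y (x i l)) _ _
  simp only [h1, h2]
  exact Finset.sum_comm

theorem matInner_matTm (x : Matrix ι κ X) (y : Matrix κ κ' Y) (x' : Matrix ι ι' X)
    (y' : Matrix ι' μ Y) :
    matInner (matTm x y) (matTm x' y') = matInner y (matLact (matInner x x') y') := by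
  refine Matrix.ext fun i j => ?_
  simp only [matInner_apply, matTm_apply, matLact_apply, _root_.map_sum, LinearMap.sum_apply, inner_tm]
  refine (Finset.sum_congr rfl fun k _ => Finset.sum_comm).trans (Finset.sum_comm.trans ?_)
  exact Finset.sum_congr rfl fun k _ => Finset.sum_comm

theorem matInner_self_eq_zero {x : Matrix ι κ X} (h : matInner x x = 0) : x = 0 := by
  refine Matrix.ext fun i j => ?_
  have h1 : ∑ k, X.inner (x k j) (x k j) = 0 := congrFun (congrFun h j) j
  exact X.inner_definite _ ((Finset.sum_eq_zero_iff_of_nonneg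
    fun k _ => X.inner_self_nonneg (x k j)).1 h1 i (Finset.mem_univ i))

end Bim

end MatrixCalculus

end

section

open Filter Topology
variable {K : Type u} [NormedAddCommGroup K] [InnerProductSpace ℂ K] [CompleteSpace K]
variable {N : VonNeumannAlgebra K} {tr : Alg M →ₗ[ℂ] ℂ} {tr' : Alg N →ₗ[ℂ] ℂ}

/-! ### Morita contexts of finite von Neumann algebras -/

theorem IsNormal.map_sum {φ : Alg M → ℂ} (hφ : IsNormal φ) {ι : Type*} (s : Finset ι)
    (a : ι → Alg M) : φ (∑ i ∈ s, a i) = ∑ i ∈ s, φ (a i) :=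
  _root_.map_sum (⟨⟨φ, hφ.map_zero⟩, hφ.map_add⟩ : Alg M →+ ℂ) a s

theorem IsNormal.sum {ι : Type*} (s : Finset ι) {φ : ι → Alg M → ℂ} (hφ : ∀ i, IsNormal (φ i)) :
    IsNormal fun a => ∑ i ∈ s, φ i a := by
  classical
  induction s using Finset.induction_on with
  | empty => simpa using IsNormal.zero
  | insert i s hi ih =>
    simp only [Finset.sum_insert hi]
    exact (hφ i).add ih

/-- The one by one matrix with a given entry. -/
def cell {R : Type*} (m : R) : Matrix Unit Unit R := Matrix.of fun _ _ => m

@[simp]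
theorem cell_apply {R : Type*} (m : R) (i j : Unit) : cell m i j = m := rfl

theorem cell_one {R : Type*} [MulZeroOneClass R] : cell (1 : R) = 1 :=
  Matrix.ext fun i j => by simp [Subsingleton.elim i j]

variable (tr tr') in
/-- A Morita context between `M` and `N`: each algebra is embedded as a corner of matrices over
the other one, compatibly, by finite families of columns. -/
structure Context where
  n : ℕ
  r : ℕ
  φ : Alg N →⋆ₙₐ[ℂ] Matrix (Fin n) (Fin n) (Alg M)
  ψ : Alg M →⋆ₙₐ[ℂ] Matrix (Fin r) (Fin r) (Alg N)
  V : Fin r → Matrix (Fin n) Unit (Alg M)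
  W : Fin n → Matrix (Fin r) Unit (Alg N)
  φ_ψ : ∀ m s t, φ (ψ m s t) = V s * cell m * (V t).conjTranspose
  ψ_φ : ∀ a i j, ψ (φ a i j) = W i * cell a * (W j).conjTranspose
  sum_V : ∑ s, (V s).conjTranspose * V s = 1
  sum_W : ∑ i, (W i).conjTranspose * W i = 1
  φ_W : ∀ i s, φ (W i s ()) = V s * (Matrix.of fun _ j => φ 1 i j : Matrix Unit (Fin n) (Alg M))
  ψ_V : ∀ s i, ψ (V s i ()) = W i * (Matrix.of fun _ t => ψ 1 s t : Matrix Unit (Fin r) (Alg N))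
  normal_φ : ∀ {g : Alg M → ℂ}, IsNormal g → ∀ k l, IsNormal fun a => g (φ a k l)
  normal_ψ : ∀ {g : Alg N → ℂ}, IsNormal g → ∀ k l, IsNormal fun a => g (ψ a k l)
  bdd_φ : ∀ {a : ℕ → Alg N}, BddA a → ∀ k l, BddA fun m => φ (a m) k l
  bdd_ψ : ∀ {a : ℕ → Alg M}, BddA a → ∀ k l, BddA fun m => ψ (a m) k l
  null_φ : ∀ {a : ℕ → Alg N}, NullA tr' a → ∀ k l, NullA tr fun m => φ (a m) k l
  null_ψ : ∀ {a : ℕ → Alg M}, NullA tr a → ∀ k l, NullA tr' fun m => ψ (a m) k l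

namespace Context

/-- The context with the roles of the two algebras exchanged. -/
@[reducible]
def swap (c : Context tr tr') : Context tr' tr where
  n := c.r
  r := c.n
  φ := c.ψ
  ψ := c.φ
  V := c.W
  W := c.V
  φ_ψ := c.ψ_φ
  ψ_φ := c.φ_ψ
  sum_V := c.sum_W
  sum_W := c.sum_V
  φ_W := c.ψ_V
  ψ_V := c.φ_W
  normal_φ := c.normal_ψ
  normal_ψ := c.normal_φ
  bdd_φ := c.bdd_ψ
  bdd_ψ := c.bdd_φ
  null_φ := c.null_ψ
  null_ψ := c.null_φ

variable (c : Context tr tr')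

/-- The projection that is the image of the unit. -/
def p : Matrix (Fin c.n) (Fin c.n) (Alg M) := c.φ 1

/-- The rows of the projection. -/
def row (i : Fin c.n) : Matrix Unit (Fin c.n) (Alg M) := Matrix.of fun _ j => c.φ 1 i j

theorem φ_star (a : Alg N) : c.φ (star a) = (c.φ a).conjTranspose := map_star c.φ a

theorem p_mul_φ (a : Alg N) : c.p * c.φ a = c.φ a := by
  rw [p, ← map_mul, one_mul]

theorem φ_mul_p (a : Alg N) : c.φ a * c.p = c.φ a := by
  rw [p, ← map_mul, mul_one]

theorem star_p : c.p.conjTranspose = c.p := by rw [p, ← φ_star, star_one]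

theorem p_mul_p : c.p * c.p = c.p := c.p_mul_φ 1

theorem p_mul_V (s : Fin c.r) : c.p * c.V s = c.V s := by
  have h : ∀ t, c.p * (c.V s * (c.V t).conjTranspose) = c.V s * (c.V t).conjTranspose := fun t => by
    have := c.φ_ψ 1 s t
    rw [cell_one, Matrix.mul_one] at this
    rw [← this, p_mul_φ]
  calc c.p * c.V s = c.p * (c.V s * ∑ t, (c.V t).conjTranspose * c.V t) := by rw [c.sum_V, Matrix.mul_one]
    _ = ∑ t, (c.p * (c.V s * (c.V t).conjTranspose)) * c.V t := by
        simp only [Matrix.mul_sum, Matrix.mul_assoc]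
    _ = c.V s * ∑ t, (c.V t).conjTranspose * c.V t := by
        simp only [h, Matrix.mul_sum, Matrix.mul_assoc]
    _ = c.V s := by rw [c.sum_V, Matrix.mul_one]

theorem V_star_mul_p (s : Fin c.r) : (c.V s).conjTranspose * c.p = (c.V s).conjTranspose := by
  have := congrArg Matrix.conjTranspose (c.p_mul_V s)
  rwa [Matrix.conjTranspose_mul, star_p] at this

theorem row_mul_p (i : Fin c.n) : c.row i * c.p = c.row i :=
  Matrix.ext fun _ j => congrFun (congrFun c.p_mul_p i) j

theorem p_mul_row (i : Fin c.n) : c.p * (c.row i).conjTranspose = (c.row i).conjTranspose := by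
  have := congrArg Matrix.conjTranspose (c.row_mul_p i)
  rwa [Matrix.conjTranspose_mul, star_p] at this

theorem sum_row : ∑ i, (c.row i).conjTranspose * c.row i = c.p := by
  refine Matrix.ext fun k l => ?_
  rw [Matrix.sum_apply]
  have : ∀ i, ((c.row i).conjTranspose * c.row i) k l = c.p k i * c.p i l := fun i => by
    rw [Matrix.mul_apply, Fintype.sum_unique]
    congr 1
    exact congrFun (congrFun c.star_p k) i
  simp only [this]
  exact congrFun (congrFun c.p_mul_p k) l

/-- The compression of matrices over `M` to `N`. -/
def ρ : Matrix (Fin c.n) (Fin c.n) (Alg M) →ₗ[ℂ] Alg N where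
  toFun z := ∑ i, ∑ j, ((c.W i).conjTranspose * c.ψ (z i j) * c.W j) () ()
  map_add' y z := by
    simp only [Matrix.add_apply, map_add, Matrix.mul_add, Matrix.add_mul, Finset.sum_add_distrib]
  map_smul' w z := by
    simp only [Matrix.smul_apply, map_smul, Matrix.mul_smul, Matrix.smul_mul, Finset.smul_sum,
      RingHom.id_apply]

theorem ρ_apply (z : Matrix (Fin c.n) (Fin c.n) (Alg M)) :
    c.ρ z = ∑ i, ∑ j, ((c.W i).conjTranspose * c.ψ (z i j) * c.W j) () () := rfl

theorem ρ_apply' (z : Matrix (Fin c.n) (Fin c.n) (Alg M)) :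
    c.ρ z = ∑ i, ∑ j, ∑ t, ∑ s, star (c.W i s ()) * c.ψ (z i j) s t * c.W j t () := by
  simp only [ρ_apply, Matrix.mul_apply, Finset.sum_mul, Matrix.conjTranspose_apply]

theorem φ_ρ (z : Matrix (Fin c.n) (Fin c.n) (Alg M)) : c.φ (c.ρ z) = c.p * z * c.p := by
  have h1 : ∀ i j, ∑ t, ∑ s, c.φ (star (c.W i s ()) * c.ψ (z i j) s t * c.W j t ())
      = (c.row i).conjTranspose * cell (z i j) * c.row j := fun i j => by
    have h2 : ∀ t s, c.φ (star (c.W i s ()) * c.ψ (z i j) s t * c.W j t ())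
        = (c.row i).conjTranspose * ((c.V s).conjTranspose * c.V s) * cell (z i j)
          * ((c.V t).conjTranspose * c.V t) * c.row j := fun t s => by
      rw [map_mul, map_mul, φ_star, c.φ_ψ, c.φ_W, c.φ_W, Matrix.conjTranspose_mul]
      simp only [Matrix.mul_assoc]
      rfl
    simp only [h2, ← Matrix.sum_mul, ← Matrix.mul_sum, c.sum_V, Matrix.mul_one]
  rw [ρ_apply']
  simp only [map_sum, h1]
  refine Matrix.ext fun k l => ?_
  simp only [Matrix.sum_apply, Matrix.mul_apply, Fintype.sum_unique, cell_apply,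
    Finset.sum_mul, Matrix.conjTranspose_apply]
  rw [Finset.sum_comm]
  refine Finset.sum_congr rfl fun j _ => Finset.sum_congr rfl fun i _ => ?_
  rw [show star (c.row i () k) = c.p k i from congrFun (congrFun c.star_p k) i]
  rfl

theorem ρ_φ (a : Alg N) : c.ρ (c.φ a) = a := by
  have h1 : ∀ i j, (c.W i).conjTranspose * c.ψ (c.φ a i j) * c.W j
      = ((c.W i).conjTranspose * c.W i) * cell a * ((c.W j).conjTranspose * c.W j) :=
    fun i j => by
      rw [c.ψ_φ]; simp only [Matrix.mul_assoc]
  have h2 : ∑ i, ∑ j, (c.W i).conjTranspose * c.ψ (c.φ a i j) * c.W j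
      = cell a := by
    simp only [h1, ← Matrix.sum_mul, ← Matrix.mul_sum, c.sum_W, Matrix.mul_one, Matrix.one_mul]
  have h3 := congrFun (congrFun h2 ()) ()
  simpa only [Matrix.sum_apply, ← ρ_apply, cell_apply] using h3

theorem φ_injective : Function.Injective c.φ := fun a b h => by rw [← c.ρ_φ a, h, c.ρ_φ]

theorem ρ_mul_φ (z : Matrix (Fin c.n) (Fin c.n) (Alg M)) (a : Alg N) :
    c.ρ (z * c.φ a) = c.ρ z * a := c.φ_injective (by
  rw [map_mul c.φ, φ_ρ, φ_ρ, Matrix.mul_assoc _ c.p (c.φ a), p_mul_φ, ← Matrix.mul_assoc,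
    Matrix.mul_assoc _ (c.φ a), φ_mul_p])

theorem star_ρ (z : Matrix (Fin c.n) (Fin c.n) (Alg M)) : star (c.ρ z) = c.ρ z.conjTranspose :=
  c.φ_injective (by
    rw [φ_star, φ_ρ, φ_ρ, Matrix.conjTranspose_mul, Matrix.conjTranspose_mul, star_p,
      ← Matrix.mul_assoc])

variable {X Y : Bim M}

open Bim

theorem ρ_star_mul_self_nonneg (z : Fin c.n → Alg M) :
    0 ≤ c.ρ (Matrix.of fun i j => star (z i) * z j) := by
  have h : c.ρ (Matrix.of fun i j => star (z i) * z j)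
      = ((∑ j, c.ψ (z j) * c.W j).conjTranspose * ∑ j, c.ψ (z j) * c.W j) () () := by
    rw [ρ_apply, Matrix.conjTranspose_sum, Matrix.sum_mul, Matrix.sum_apply]
    refine Finset.sum_congr rfl fun i _ => ?_
    rw [Matrix.mul_sum, Matrix.sum_apply]
    refine Finset.sum_congr rfl fun j _ => ?_
    rw [Matrix.of_apply, map_mul, map_star, Matrix.conjTranspose_mul, Matrix.star_eq_conjTranspose]
    simp only [Matrix.mul_assoc]
  rw [h, Matrix.mul_apply]
  exact Finset.sum_nonneg fun i _ => star_mul_self_nonneg _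

theorem ρ_matInner_nonneg (x : Matrix (Fin c.n) (Fin c.n) X) : 0 ≤ c.ρ (matInner x x) := by
  obtain ⟨l, b, hb⟩ := X.exists_basis
  have h : matInner x x = ∑ k, ∑ m, Matrix.of fun i j =>
      star (X.inner (b m) (x k i)) * X.inner (b m) (x k j) := by
    refine Matrix.ext fun i j => ?_
    simp only [matInner_apply, Matrix.sum_apply, Matrix.of_apply]
    refine Finset.sum_congr rfl fun k _ => ?_
    conv_lhs => rw [← hb (x k j)]
    simp only [map_sum, X.inner_ract, X.star_inner]
  rw [h, map_sum]
  refine Finset.sum_nonneg fun k _ => ?_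
  rw [map_sum]
  exact Finset.sum_nonneg fun m _ => c.ρ_star_mul_self_nonneg _

variable (X) in
/-- The matrices over `X` supported on the corner. -/
def corner : Submodule ℂ (Matrix (Fin c.n) (Fin c.n) X) where
  carrier := {x | matLact c.p x = x ∧ matRact x c.p = x}
  add_mem' {x y} hx hy := ⟨by rw [map_add, hx.1, hy.1],
    by rw [map_add, LinearMap.add_apply, hx.2, hy.2]⟩
  zero_mem' := ⟨map_zero _, by rw [map_zero, LinearMap.zero_apply]⟩
  smul_mem' z x hx := ⟨by rw [map_smul, hx.1], by rw [map_smul, LinearMap.smul_apply, hx.2]⟩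

theorem matLact_mem (a : Alg N) {x : Matrix (Fin c.n) (Fin c.n) X} (hx : x ∈ c.corner X) :
    matLact (c.φ a) x ∈ c.corner X :=
  ⟨by rw [← matLact_mul, p_mul_φ], by rw [← matLact_matRact, hx.2]⟩

theorem matRact_mem (a : Alg N) {x : Matrix (Fin c.n) (Fin c.n) X} (hx : x ∈ c.corner X) :
    matRact x (c.φ a) ∈ c.corner X :=
  ⟨by rw [matLact_matRact, hx.1], by rw [← matRact_mul, φ_mul_p]⟩

theorem φ_ρ_matInner {x y : Matrix (Fin c.n) (Fin c.n) X} (hx : x ∈ c.corner X)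
    (hy : y ∈ c.corner X) : c.φ (c.ρ (matInner x y)) = matInner x y := by
  rw [φ_ρ, Matrix.mul_assoc, ← matInner_matRact, hy.2]
  nth_rewrite 1 [← c.star_p]
  rw [← matInner_matRact_left, hx.2]

/-- The elements of a basis of the corner. -/
def cornerBasis (x : X) (i : Fin c.n) (s : Fin c.r) : Matrix (Fin c.n) (Fin c.n) X :=
  matRact (matLact (c.row i).conjTranspose (cell x))
    (c.V s).conjTranspose

theorem cornerBasis_mem (x : X) (i : Fin c.n) (s : Fin c.r) : c.cornerBasis x i s ∈ c.corner X :=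
  ⟨by rw [cornerBasis, matLact_matRact, ← matLact_mul, p_mul_row],
    by rw [cornerBasis, ← matRact_mul, V_star_mul_p]⟩

theorem sum_cornerBasis {l : ℕ} {b : Fin l → X} (hb : IsBasis X b)
    {x : Matrix (Fin c.n) (Fin c.n) X} (hx : x ∈ c.corner X) :
    ∑ k, ∑ i, ∑ s, matRact (c.cornerBasis (b k) i s) (matInner (c.cornerBasis (b k) i s) x) = x := by
  have h1 : ∀ k i, ∑ s, matRact (c.cornerBasis (b k) i s) (matInner (c.cornerBasis (b k) i s) x)
      = matLact (c.row i).conjTranspose (matRact (cell (b k))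
        (matInner (cell (b k)) (matLact (c.row i) x))) := by
    intro k i
    have h2 : ∀ s, matRact (c.cornerBasis (b k) i s) (matInner (c.cornerBasis (b k) i s) x)
        = matRact (matLact (c.row i).conjTranspose (cell (b k)))
          (((c.V s).conjTranspose * c.V s) * matInner (cell (b k))
            (matLact (c.row i) x)) := fun s => by
      rw [cornerBasis, matInner_matRact_left, Matrix.conjTranspose_conjTranspose, matInner_matLact,
        Matrix.conjTranspose_conjTranspose, ← matRact_mul, Matrix.mul_assoc]
    simp only [h2, ← map_sum, ← Matrix.sum_mul, c.sum_V, Matrix.one_mul, matLact_matRact]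
  have h3 : ∀ y : Matrix Unit (Fin c.n) X, ∑ k, matRact (cell (b k))
      (matInner (cell (b k)) y) = y := fun y => by
    refine Matrix.ext fun i j => ?_
    simp only [Matrix.sum_apply, matRact_apply, matInner_apply, Fintype.sum_unique, cell_apply]
    exact hb _
  simp only [h1]
  rw [Finset.sum_comm]
  simp only [← map_sum, h3, ← matLact_mul]
  rw [← LinearMap.sum_apply, ← map_sum, sum_row, hx.1]

variable (X) in
/-- The corner of the matrices over `X` as an `N`-bimodule. -/
def obj : Bim N where
  carrier := c.corner X
  lact := LinearMap.mk₂ ℂ (fun a x => ⟨matLact (c.φ a) x.1, c.matLact_mem a x.2⟩)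
    (fun a b x => Subtype.ext (by simp)) (fun z a x => Subtype.ext (by simp))
    (fun a x y => Subtype.ext (by simp)) (fun z a x => Subtype.ext (by simp))
  ract := LinearMap.mk₂ ℂ (fun x a => ⟨matRact x.1 (c.φ a), c.matRact_mem a x.2⟩)
    (fun a b x => Subtype.ext (by simp)) (fun z a x => Subtype.ext (by simp))
    (fun a x y => Subtype.ext (by simp)) (fun z a x => Subtype.ext (by simp))
  inner := LinearMap.mk₂'ₛₗ (starRingEnd ℂ) (RingHom.id ℂ) (fun x y => c.ρ (matInner x.1 y.1))
    (fun a b x => by simp) (fun z a x => by simp) (fun a x y => by simp) (fun z a x => by simp)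
  one_lact x := Subtype.ext x.2.1
  mul_lact a b x := Subtype.ext (by
    change matLact (c.φ (a * b)) x.1 = matLact (c.φ a) (matLact (c.φ b) x.1)
    rw [map_mul, matLact_mul])
  ract_one x := Subtype.ext x.2.2
  ract_mul x a b := Subtype.ext (by
    change matRact x.1 (c.φ (a * b)) = matRact (matRact x.1 (c.φ a)) (c.φ b)
    rw [map_mul, matRact_mul])
  lact_ract a x b := Subtype.ext (matLact_matRact _ _ _)
  inner_ract x y a := by
    change c.ρ (matInner x.1 (matRact y.1 (c.φ a))) = c.ρ (matInner x.1 y.1) * a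
    rw [matInner_matRact, ρ_mul_φ]
  star_inner x y := by
    change star (c.ρ (matInner x.1 y.1)) = c.ρ (matInner y.1 x.1)
    rw [star_ρ, star_matInner]
  inner_nonneg x := c.ρ_matInner_nonneg x.1
  inner_definite x h := Subtype.ext (matInner_self_eq_zero (by
    rw [← c.φ_ρ_matInner x.2 x.2]
    exact (congrArg c.φ h).trans (map_zero _)))
  inner_lact a x y := by
    change c.ρ (matInner (matLact (c.φ a) x.1) y.1) = c.ρ (matInner x.1 (matLact (c.φ (star a)) y.1))
    rw [matInner_matLact, φ_star]
  normal x y g hg := by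
    have h : ∀ a, g (c.ρ (matInner x.1 (matLact (c.φ a) y.1)))
        = ∑ i, ∑ j, ∑ t, ∑ s, ∑ k, ∑ l, g (star (c.W i s ()) *
          (c.ψ (X.inner (x.1 k i) (X.lact (c.φ a k l) (y.1 l j))) s t * c.W j t ())) := fun a => by
      simp only [ρ_apply', matInner_apply, matLact_apply, map_sum, Matrix.sum_apply, Finset.mul_sum,
        Finset.sum_mul, hg.map_sum, mul_assoc]
    change IsNormal fun a => g (c.ρ (matInner x.1 (matLact (c.φ a) y.1)))
    simp only [h]
    exact IsNormal.sum _ fun i => IsNormal.sum _ fun j => IsNormal.sum _ fun t => IsNormal.sum _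
      fun s => IsNormal.sum _ fun k => IsNormal.sum _ fun l =>
        c.normal_φ (X.normal (x.1 k i) (y.1 l j) _
          (c.normal_ψ (hg.mul_mul (c.W i s ()) (c.W j t ())) s t)) k l
  exists_basis := by
    obtain ⟨l, b, hb⟩ := X.exists_basis
    let e := Fintype.equivFin (Fin l × Fin c.n × Fin c.r)
    refine ⟨_, fun q => ⟨c.cornerBasis (b (e.symm q).1) (e.symm q).2.1 (e.symm q).2.2,
      c.cornerBasis_mem _ _ _⟩, fun x => Subtype.ext ?_⟩
    have h1 := c.sum_cornerBasis hb x.2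
    rw [AddSubmonoidClass.coe_finsetSum]
    refine Eq.trans (e.symm.sum_comp fun q => matRact (c.cornerBasis (b q.1) q.2.1 q.2.2)
      (c.φ (c.ρ (matInner (c.cornerBasis (b q.1) q.2.1 q.2.2) x.1)))) ?_
    simp only [c.φ_ρ_matInner (c.cornerBasis_mem _ _ _) x.2]
    rw [Fintype.sum_prod_type]
    simp only [Fintype.sum_prod_type]
    exact h1

theorem lact_val (a : Alg N) (x : c.obj X) : ((c.obj X).lact a x).1 = matLact (c.φ a) x.1 := rfl

theorem ract_val (x : c.obj X) (a : Alg N) : ((c.obj X).ract x a).1 = matRact x.1 (c.φ a) := rfl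

theorem sum_val {κ : Type} [Fintype κ] (x : κ → c.obj X) : (∑ k, x k).1 = ∑ k, (x k).1 :=
  map_sum (c.corner X).subtype x _

theorem φ_inner (x y : c.obj X) : c.φ ((c.obj X).inner x y) = matInner x.1 y.1 :=
  c.φ_ρ_matInner x.2 y.2

end Context

end

section

open Filter Topology
variable {K : Type u} [NormedAddCommGroup K] [InnerProductSpace ℂ K] [CompleteSpace K]
variable {N : VonNeumannAlgebra K} {tr : Alg M →ₗ[ℂ] ℂ} {tr' : Alg N →ₗ[ℂ] ℂ}
open Bim MonoidalCategory

/-! ### The functor between bimodule categories given by a Morita context -/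

namespace Bim

section

variable {X X' Y Y' : Bim M} {ι ι' κ κ' : Type} [Fintype ι] [Fintype ι'] [Fintype κ] [Fintype κ']

set_option linter.unusedSectionVars false

/-- A surjective bimodule map that preserves inner products, as a unitary isomorphism. -/
def isoOfInner (f : X →ₗ[ℂ] Y) (hl : ∀ a x, f (X.lact a x) = Y.lact a (f x))
    (hr : ∀ x a, f (X.ract x a) = Y.ract (f x) a)
    (hi : ∀ x y, Y.inner (f x) (f y) = X.inner x y) (hs : Function.Surjective f) : X ≅ Y :=
  have hinj : Function.Injective f := (injective_iff_map_eq_zero f).2 fun x hx =>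
    X.inner_definite x (by rw [← hi, hx, _root_.map_zero])
  let e := LinearEquiv.ofBijective f ⟨hinj, hs⟩
  unitaryIso (X := X) (Y := Y) ⟨f, e.symm, hl, hr, fun x y => by
      exact (congrArg (Y.inner (f x)) (e.apply_symm_apply y).symm).trans (hi _ _)⟩
    (fun x => e.symm_apply_apply x) (fun y => e.apply_symm_apply y)

theorem matLact_map (f : X ⟶ Y) (A : Matrix ι' ι (Alg M)) (x : Matrix ι κ X) :
    matLact A (x.map (lin f)) = (matLact A x).map (lin f) := by
  refine Matrix.ext fun i j => ?_
  simp only [matLact_apply, Matrix.map_apply, _root_.map_sum]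
  exact Finset.sum_congr rfl fun k _ => (f.map_lact _ _).symm

theorem matRact_map (f : X ⟶ Y) (x : Matrix ι κ X) (A : Matrix κ κ' (Alg M)) :
    matRact (x.map (lin f)) A = (matRact x A).map (lin f) := by
  refine Matrix.ext fun i j => ?_
  simp only [matRact_apply, Matrix.map_apply, _root_.map_sum]
  exact Finset.sum_congr rfl fun k _ => (f.map_ract _ _).symm

theorem matInner_map (f : X ⟶ Y) (x : Matrix ι κ X) (y : Matrix ι κ' Y) :
    matInner (x.map (lin f)) y = matInner x (y.map (lin (dagger f))) := by
  refine Matrix.ext fun i j => ?_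
  simp only [matInner_apply, Matrix.map_apply]
  exact Finset.sum_congr rfl fun k _ => f.inner_adj _ _

theorem matTm_map (f : X ⟶ X') (g : Y ⟶ Y') (x : Matrix ι κ X) (y : Matrix κ κ' Y) :
    matTm (x.map (lin f)) (y.map (lin g)) = (matTm x y).map (lin (tensorMap f g)) := by
  refine Matrix.ext fun i j => ?_
  simp only [matTm_apply, Matrix.map_apply, _root_.map_sum]
  rfl

theorem matLact_one [DecidableEq ι] (x : Matrix ι κ X) : matLact (1 : Matrix ι ι (Alg M)) x = x := by
  refine Matrix.ext fun i j => ?_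
  rw [matLact_apply, Finset.sum_eq_single i]
  · rw [Matrix.one_apply_eq, X.one_lact]
  · intro k _ hk
    rw [Matrix.one_apply_ne hk.symm, _root_.map_zero, LinearMap.zero_apply]
  · simp

theorem matRact_one [DecidableEq κ] (x : Matrix ι κ X) : matRact x (1 : Matrix κ κ (Alg M)) = x := by
  refine Matrix.ext fun i j => ?_
  rw [matRact_apply, Finset.sum_eq_single j]
  · rw [Matrix.one_apply_eq, X.ract_one]
  · intro k _ hk
    rw [Matrix.one_apply_ne hk, _root_.map_zero]
  · simp

theorem matLact_cell (a : Alg M) (x : X) : matLact (cell a) (cell x) = cell (X.lact a x) :=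
  Matrix.ext fun i j => by simp [matLact_apply]

theorem matRact_cell (x : X) (a : Alg M) : matRact (cell x) (cell a) = cell (X.ract x a) :=
  Matrix.ext fun i j => by simp [matRact_apply]

theorem matInner_cell (x y : X) : matInner (cell x) (cell y) = cell (X.inner x y) :=
  Matrix.ext fun i j => by simp [matInner_apply]

theorem matTm_cell (x : X) (y : Y) : matTm (cell x) (cell y) = cell (tm x y) :=
  Matrix.ext fun i j => by simp [matTm_apply]

end

end Bim

namespace Context

variable (c : Context tr tr') {X X' Y Y' Z : Bim M}

theorem map_mem (f : X ⟶ Y) {x : Matrix (Fin c.n) (Fin c.n) X} (hx : x ∈ c.corner X) :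
    x.map (lin f) ∈ c.corner Y :=
  ⟨by rw [matLact_map, hx.1], by rw [matRact_map, hx.2]⟩

/-- The entrywise application of a morphism. -/
def mapLin (f : X ⟶ Y) : c.obj X →ₗ[ℂ] c.obj Y where
  toFun x := ⟨x.1.map (lin f), c.map_mem f x.2⟩
  map_add' x y := Subtype.ext (Matrix.ext fun i j => map_add (lin f) (x.1 i j) (y.1 i j))
  map_smul' z x := Subtype.ext (Matrix.ext fun i j => map_smul (lin f) z (x.1 i j))

/-- The functor from `M`-bimodules to `N`-bimodules given by a Morita context. -/
def functor : Bim M ⥤ Bim N where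
  obj X := c.obj X
  map f :=
    { toLin := c.mapLin f
      adj := c.mapLin (dagger f)
      map_lact := fun a x => Subtype.ext (matLact_map f (c.φ a) x.1).symm
      map_ract := fun x a => Subtype.ext (matRact_map f x.1 (c.φ a)).symm
      inner_adj := fun x y => congrArg c.ρ (matInner_map f x.1 y.1) }
  map_id _ := rfl
  map_comp _ _ := rfl

theorem φ_ψ_one (s t : Fin c.r) : c.φ (c.ψ 1 s t) = c.V s * (c.V t).conjTranspose := by
  rw [c.φ_ψ, cell_one, Matrix.mul_one]

theorem matLact_sum_V {κ : Type} [Fintype κ] (x : Matrix Unit κ X) :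
    ∑ s, matLact (c.V s).conjTranspose (matLact (c.V s) x) = x := by
  simp only [← matLact_mul]
  rw [← LinearMap.sum_apply, ← map_sum, c.sum_V, matLact_one]

theorem matRact_sum_V {κ : Type} [Fintype κ] (x : Matrix κ Unit X) :
    ∑ s, matRact (matRact x (c.V s).conjTranspose) (c.V s) = x := by
  simp only [← matRact_mul]
  rw [← map_sum, c.sum_V, matRact_one]

/-- The matrices `V_s x V_t*`. -/
def unitEntry (x : X) (s t : Fin c.r) : Matrix (Fin c.n) (Fin c.n) X :=
  matRact (matLact (c.V s) (cell x)) (c.V t).conjTranspose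

theorem unitEntry_add (x y : X) (s t : Fin c.r) :
    c.unitEntry (x + y) s t = c.unitEntry x s t + c.unitEntry y s t := by
  rw [unitEntry, show cell (x + y) = cell x + cell y from rfl, map_add, map_add,
    LinearMap.add_apply]
  rfl

theorem unitEntry_smul (z : ℂ) (x : X) (s t : Fin c.r) :
    c.unitEntry (z • x) s t = z • c.unitEntry x s t := by
  rw [unitEntry, show cell (z • x) = z • cell x from rfl, map_smul, map_smul, LinearMap.smul_apply]
  rfl

theorem unitEntry_mem (x : X) (s t : Fin c.r) : c.unitEntry x s t ∈ c.corner X :=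
  ⟨by rw [unitEntry, matLact_matRact, ← matLact_mul, p_mul_V],
    by rw [unitEntry, ← matRact_mul, V_star_mul_p]⟩

theorem sum_lact_unitEntry (a : Alg M) (x : X) (s t : Fin c.r) :
    ∑ k, matLact (c.φ (c.ψ a s k)) (c.unitEntry x k t) = c.unitEntry (X.lact a x) s t := by
  simp only [unitEntry, matLact_matRact, c.φ_ψ, matLact_mul, ← matLact_cell]
  rw [← LinearMap.sum_apply, ← map_sum]
  simp only [← map_sum, matLact_sum_V]

theorem sum_ract_unitEntry (x : X) (a : Alg M) (s t : Fin c.r) :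
    ∑ k, matRact (c.unitEntry x s k) (c.φ (c.ψ a k t)) = c.unitEntry (X.ract x a) s t := by
  simp only [unitEntry, ← matLact_matRact, c.φ_ψ, matRact_mul, ← matRact_cell, ← map_sum]
  rw [← LinearMap.sum_apply, ← map_sum, ← LinearMap.sum_apply, ← map_sum, matRact_sum_V]

theorem sum_inner_unitEntry (x y : X) (s t : Fin c.r) :
    ∑ k, matInner (c.unitEntry x k s) (c.unitEntry y k t) = c.φ (c.ψ (X.inner x y) s t) := by
  simp only [unitEntry, matInner_matRact, matInner_matRact_left, Matrix.conjTranspose_conjTranspose,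
    matInner_matLact, ← Matrix.sum_mul, ← Matrix.mul_sum, ← map_sum, matLact_sum_V, matInner_cell,
    c.φ_ψ]

variable (X) in
/-- The map `x ↦ (V_s x V_t*)` to the double corner. -/
def unitLin : X →ₗ[ℂ] c.swap.obj (c.obj X) where
  toFun x := ⟨Matrix.of fun s t => (⟨c.unitEntry x s t, c.unitEntry_mem x s t⟩ : c.obj X),
    Matrix.ext fun s t => Subtype.ext (by
      change (∑ k, (c.obj X).lact (c.ψ 1 s k) ⟨c.unitEntry x k t, c.unitEntry_mem x k t⟩).1
        = c.unitEntry x s t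
      refine (c.sum_val _).trans ?_
      exact (c.sum_lact_unitEntry 1 x s t).trans (by rw [X.one_lact])),
    Matrix.ext fun s t => Subtype.ext (by
      change (∑ k, (c.obj X).ract ⟨c.unitEntry x s k, c.unitEntry_mem x s k⟩ (c.ψ 1 k t)).1
        = c.unitEntry x s t
      refine (c.sum_val _).trans ?_
      exact (c.sum_ract_unitEntry x 1 s t).trans (by rw [X.ract_one]))⟩
  map_add' x y := Subtype.ext (Matrix.ext fun s t => Subtype.ext (c.unitEntry_add x y s t))
  map_smul' z x := Subtype.ext (Matrix.ext fun s t => Subtype.ext (c.unitEntry_smul z x s t))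

theorem unitLin_surjective : Function.Surjective (c.unitLin X) := fun z => by
  refine ⟨(∑ k, ∑ l, matRact (matLact (c.V k).conjTranspose (z.1 k l).1) (c.V l)) () (),
    Subtype.ext (Matrix.ext fun s t => Subtype.ext ?_)⟩
  have hz := z.2
  have h1 : ∀ s t : Fin c.r, ∑ k, matLact (c.V s * (c.V k).conjTranspose) (z.1 k t).1 = (z.1 s t).1 :=
    fun s t => by
      have := congrArg Subtype.val (congrFun (congrFun hz.1 s) t)
      refine Eq.trans ?_ this
      change _ = (∑ k, (c.obj X).lact (c.ψ 1 s k) (z.1 k t)).1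
      refine Eq.trans ?_ (c.sum_val _).symm
      exact Finset.sum_congr rfl fun k _ => by rw [lact_val, φ_ψ_one]
  have h2 : ∀ s t : Fin c.r, ∑ k, matRact (z.1 s k).1 (c.V k * (c.V t).conjTranspose) = (z.1 s t).1 :=
    fun s t => by
      have := congrArg Subtype.val (congrFun (congrFun hz.2 s) t)
      refine Eq.trans ?_ this
      change _ = (∑ k, (c.obj X).ract (z.1 s k) (c.ψ 1 k t)).1
      refine Eq.trans ?_ (c.sum_val _).symm
      exact Finset.sum_congr rfl fun k _ => by rw [ract_val, φ_ψ_one]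
  change matRact (matLact (c.V s) (∑ k, ∑ l, matRact (matLact (c.V k).conjTranspose (z.1 k l).1)
    (c.V l))) (c.V t).conjTranspose = _
  have h3 : ∀ k l, matRact (matLact (c.V s) (matRact (matLact (c.V k).conjTranspose (z.1 k l).1)
      (c.V l))) (c.V t).conjTranspose = matLact (c.V s * (c.V k).conjTranspose)
        (matRact (z.1 k l).1 (c.V l * (c.V t).conjTranspose)) := fun k l => by
    simp only [matLact_matRact, matRact_mul, matLact_mul]
  simp only [map_sum, LinearMap.sum_apply, h3]
  simp only [← map_sum, h2, h1]

variable (X) in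
/-- The unitary isomorphism of `X` with the double corner. -/
def unitIso : X ≅ c.swap.functor.obj (c.functor.obj X) :=
  isoOfInner (Y := c.swap.obj (c.obj X)) (c.unitLin X)
    (fun a x => Subtype.ext (Matrix.ext fun s t => Subtype.ext (by
      refine (c.sum_lact_unitEntry a x s t).symm.trans ?_
      exact (c.sum_val fun k => (c.obj X).lact (c.ψ a s k)
        ⟨c.unitEntry x k t, c.unitEntry_mem x k t⟩).symm)))
    (fun x a => Subtype.ext (Matrix.ext fun s t => Subtype.ext (by
      refine (c.sum_ract_unitEntry x a s t).symm.trans ?_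
      exact (c.sum_val fun k => (c.obj X).ract
        ⟨c.unitEntry x s k, c.unitEntry_mem x s k⟩ (c.ψ a k t)).symm)))
    (fun x y => c.swap.φ_injective (by
      rw [φ_inner]
      refine Matrix.ext fun s t => c.φ_injective ?_
      refine Eq.trans ?_ (c.sum_inner_unitEntry x y s t)
      rw [matInner_apply, map_sum]
      exact Finset.sum_congr rfl fun k _ => c.φ_inner _ _))
    c.unitLin_surjective

theorem unitIso_naturality (f : X ⟶ Y) :
    f ≫ (c.unitIso Y).hom = (c.unitIso X).hom ≫ c.swap.functor.map (c.functor.map f) :=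
  hom_ext fun x => Subtype.ext (Matrix.ext fun s t => Subtype.ext (by
    change matRact (matLact (c.V s) ((cell x).map (lin f))) (c.V t).conjTranspose
      = (matRact (matLact (c.V s) (cell x)) (c.V t).conjTranspose).map (lin f)
    rw [matLact_map, matRact_map]))

theorem matLact_row_matRact {x : Matrix (Fin c.n) (Fin c.n) X} (hx : x ∈ c.corner X)
    (i j : Fin c.n) : matRact (matLact (c.row i) x) (c.row j).conjTranspose = cell (x i j) :=
  Matrix.ext fun k l => by
    refine Eq.trans ?_ (congrFun (congrFun hx.2 i) j)
    change ∑ m, X.ract (∑ m', X.lact (c.p i m') (x m' m)) (star (c.p j m)) = _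
    refine Finset.sum_congr rfl fun m _ => ?_
    rw [show star (c.p j m) = c.p m j from congrFun (congrFun c.star_p m) j]
    exact congrArg (fun y => X.ract y (c.p m j)) (congrFun (congrFun hx.1 i) m)

theorem unitEntry_eq (x : c.obj X) (i j : Fin c.n) (s t : Fin c.r) :
    c.unitEntry (x.1 i j) s t
      = ((c.obj X).ract ((c.obj X).lact (c.W i s ()) x) (star (c.W j t ()))).1 := by
  rw [ract_val, lact_val, φ_star, c.φ_W, c.φ_W, Matrix.conjTranspose_mul, matRact_mul,
    matLact_mul, unitEntry, ← c.matLact_row_matRact x.2, matLact_matRact]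
  rfl

theorem functor_map_unitIso (X : Bim M) :
    c.functor.map (c.unitIso X).hom = (c.swap.unitIso (c.functor.obj X)).hom :=
  hom_ext fun x => Subtype.ext (Matrix.ext fun i j => Subtype.ext (Matrix.ext fun s t =>
    Subtype.ext ((c.unitEntry_eq x i j s t).trans (congrArg Subtype.val (by
      change _ = matRact (X := c.obj X) (matLact (c.W i) (cell x)) (c.W j).conjTranspose s t
      rw [matRact_apply, Fintype.sum_unique, matLact_apply, Fintype.sum_unique]
      rfl)))))

theorem unitIso_inv_naturality (f : X ⟶ Y) :
    c.swap.functor.map (c.functor.map f) ≫ (c.unitIso Y).inv = (c.unitIso X).inv ≫ f := by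
  rw [Iso.eq_inv_comp, ← Category.assoc, ← unitIso_naturality, Category.assoc, Iso.hom_inv_id,
    Category.comp_id]

/-- The equivalence of bimodule categories given by a Morita context. -/
def equivalence : Bim M ≌ Bim N where
  functor := c.functor
  inverse := c.swap.functor
  unitIso := NatIso.ofComponents (fun X => c.unitIso X) fun f => c.unitIso_naturality f
  counitIso := NatIso.ofComponents (fun X => (c.swap.unitIso X).symm) fun f =>
    c.swap.unitIso_inv_naturality f
  functor_unitIso_comp X := (congrArg (fun f => f ≫ (c.swap.unitIso (c.functor.obj X)).inv)
    (c.functor_map_unitIso X)).trans (c.swap.unitIso (c.functor.obj X)).hom_inv_id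

end Context

end

section

open Filter Topology
variable {K : Type u} [NormedAddCommGroup K] [InnerProductSpace ℂ K] [CompleteSpace K]
variable {N : VonNeumannAlgebra K} {tr : Alg M →ₗ[ℂ] ℂ} {tr' : Alg N →ₗ[ℂ] ℂ}
open Bim MonoidalCategory

/-! ### Monoidality of the functor of a Morita context -/

namespace Context

variable (c : Context tr tr') {X X' Y Y' Z : Bim M}

theorem matTm_mem {x : Matrix (Fin c.n) (Fin c.n) X} {y : Matrix (Fin c.n) (Fin c.n) Y}
    (hx : x ∈ c.corner X) (hy : y ∈ c.corner Y) : matTm x y ∈ c.corner (tensor X Y) :=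
  ⟨by rw [matLact_matTm, hx.1], by rw [matRact_matTm, hy.2]⟩

variable (X Y) in
/-- The matrix product as a map on the relative tensor product of the corners. -/
def tensorLin : tensor (c.obj X) (c.obj Y) →ₗ[ℂ] c.obj (tensor X Y) :=
  liftR (X := c.obj X) (Y := c.obj Y) (V := c.obj (tensor X Y))
    (LinearMap.mk₂ ℂ (fun x y => ⟨matTm x.1 y.1, c.matTm_mem x.2 y.2⟩)
      (fun x x' y => Subtype.ext (LinearMap.map_add₂ matTm x.1 x'.1 y.1))
      (fun z x y => Subtype.ext (LinearMap.map_smul₂ matTm z x.1 y.1))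
      (fun x y y' => Subtype.ext (map_add (matTm x.1) y.1 y'.1))
      (fun z x y => Subtype.ext (map_smul (matTm x.1) z y.1)))
    (fun x a y => Subtype.ext (matTm_balanced x.1 (c.φ a) y.1))

theorem tensorLin_tm (x : c.obj X) (y : c.obj Y) :
    c.tensorLin X Y (tm x y) = (⟨matTm x.1 y.1, c.matTm_mem x.2 y.2⟩ : c.obj (tensor X Y)) := rfl

theorem tensorLin_lact (a : Alg N) (t : tensor (c.obj X) (c.obj Y)) :
    c.tensorLin X Y ((tensor (c.obj X) (c.obj Y)).lact a t)
      = (c.obj (tensor X Y)).lact a (c.tensorLin X Y t) := by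
  refine ind2 (p := fun t => c.tensorLin X Y ((tensor (c.obj X) (c.obj Y)).lact a t)
      = (c.obj (tensor X Y)).lact a (c.tensorLin X Y t)) (fun x y => ?_) ?_
    (fun s t hs ht => ?_) t
  · rw [lact_tm, tensorLin_tm, tensorLin_tm]
    exact Subtype.ext (matLact_matTm (c.φ a) x.1 y.1).symm
  · simp only [map_zero]
  · simp only [map_add, hs, ht]

theorem tensorLin_ract (t : tensor (c.obj X) (c.obj Y)) (a : Alg N) :
    c.tensorLin X Y ((tensor (c.obj X) (c.obj Y)).ract t a)
      = (c.obj (tensor X Y)).ract (c.tensorLin X Y t) a := by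
  refine ind2 (p := fun t => c.tensorLin X Y ((tensor (c.obj X) (c.obj Y)).ract t a)
      = (c.obj (tensor X Y)).ract (c.tensorLin X Y t) a) (fun x y => ?_) ?_
    (fun s t hs ht => ?_) t
  · rw [ract_tm, tensorLin_tm, tensorLin_tm]
    exact Subtype.ext (matRact_matTm x.1 y.1 (c.φ a)).symm
  · simp only [map_zero, LinearMap.zero_apply]
  · simp only [map_add, LinearMap.add_apply, hs, ht]

theorem inner_tensorLin (s t : tensor (c.obj X) (c.obj Y)) :
    (c.obj (tensor X Y)).inner (c.tensorLin X Y s) (c.tensorLin X Y t)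
      = (tensor (c.obj X) (c.obj Y)).inner s t := by
  refine ind2 (p := fun s => (c.obj (tensor X Y)).inner (c.tensorLin X Y s) (c.tensorLin X Y t)
      = (tensor (c.obj X) (c.obj Y)).inner s t) (fun x y => ?_) ?_
    (fun s s' hs hs' => ?_) s
  · refine ind2 (p := fun t => (c.obj (tensor X Y)).inner (c.tensorLin X Y (tm x y))
      (c.tensorLin X Y t) = (tensor (c.obj X) (c.obj Y)).inner (tm x y) t) (fun x' y' => ?_) ?_
      (fun t t' ht ht' => ?_) t
    · rw [inner_tm]
      refine (congrArg c.ρ (matInner_matTm x.1 y.1 x'.1 y'.1)).trans ?_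
      rw [← φ_inner]
      rfl
    · simp only [map_zero]
    · simp only [map_add, ht, ht']
  · simp only [map_zero, LinearMap.zero_apply]
  · simp only [map_add, LinearMap.add_apply, hs, hs']

theorem matLact_row_sum (x : Matrix (Fin c.n) (Fin c.n) X) (hx : x ∈ c.corner X) :
    ∑ i, ∑ j, matRact (matLact (c.row i).conjTranspose (cell (x i j))) (c.row j) = x := by
  have h : ∀ i j, matRact (matLact (c.row i).conjTranspose (cell (x i j))) (c.row j)
      = matLact ((c.row i).conjTranspose * c.row i)
        (matRact x ((c.row j).conjTranspose * c.row j)) := fun i j => by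
    rw [← c.matLact_row_matRact hx]
    simp only [matLact_matRact, matRact_mul, matLact_mul]
  simp only [h, ← map_sum, sum_row, hx.2]
  rw [← LinearMap.sum_apply, ← map_sum, sum_row, hx.1]

theorem row_mem (x : X) (i j : Fin c.n) :
    matRact (matLact (c.row i).conjTranspose (cell x)) (c.row j) ∈ c.corner X :=
  ⟨by rw [matLact_matRact, ← matLact_mul, p_mul_row], by rw [← matRact_mul, row_mul_p]⟩

theorem V_row_mem (x : X) (s : Fin c.r) (j : Fin c.n) :
    matRact (matLact (c.V s) (cell x)) (c.row j) ∈ c.corner X :=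
  ⟨by rw [matLact_matRact, ← matLact_mul, p_mul_V], by rw [← matRact_mul, row_mul_p]⟩

theorem sum_matTm_cornerBasis (x : X) (y : Y) (i j : Fin c.n) :
    ∑ s, matTm (c.cornerBasis x i s) (matRact (matLact (c.V s) (cell y)) (c.row j))
      = matRact (matLact (c.row i).conjTranspose (cell (tm x y))) (c.row j) := by
  simp only [cornerBasis, matTm_balanced, ← matRact_matTm]
  rw [← LinearMap.sum_apply, ← map_sum, ← map_sum, matLact_sum_V, ← matLact_matTm, matTm_cell]

theorem tensorLin_surjective : Function.Surjective (c.tensorLin X Y) := fun z => by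
  let R : Submodule ℂ (Matrix (Fin c.n) (Fin c.n) (tensor X Y)) :=
    LinearMap.range ((c.corner (tensor X Y)).subtype ∘ₗ c.tensorLin X Y)
  have h1 : ∀ (i j : Fin c.n) (t : tensor X Y),
      matRact (matLact (c.row i).conjTranspose (cell t)) (c.row j) ∈ R := by
    intro i j t
    refine ind2 (p := fun t => matRact (matLact (c.row i).conjTranspose (cell t)) (c.row j) ∈ R)
      (fun x y => ?_) ?_ (fun s t hs ht => ?_) t
    · rw [← sum_matTm_cornerBasis]
      exact R.sum_mem fun s _ => ⟨tm (⟨c.cornerBasis x i s, c.cornerBasis_mem x i s⟩ : c.obj X)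
        (⟨_, c.V_row_mem y s j⟩ : c.obj Y), rfl⟩
    · rw [show cell (0 : tensor X Y) = 0 from rfl, map_zero, map_zero, LinearMap.zero_apply]
      exact R.zero_mem
    · rw [show cell (s + t) = cell s + cell t from rfl, map_add, map_add, LinearMap.add_apply]
      exact R.add_mem hs ht
  have h2 : z.1 ∈ R := by
    rw [← c.matLact_row_sum z.1 z.2]
    exact R.sum_mem fun i _ => R.sum_mem fun j _ => h1 i j _
  obtain ⟨t, ht⟩ := h2
  exact ⟨t, Subtype.ext ht⟩

variable (X Y) in
/-- The tensorator of the functor of a Morita context. -/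
def tensorIso : c.functor.obj X ⊗ c.functor.obj Y ≅ c.functor.obj (X ⊗ Y) :=
  isoOfInner (X := tensor (c.obj X) (c.obj Y)) (Y := c.obj (tensor X Y)) (c.tensorLin X Y)
    c.tensorLin_lact c.tensorLin_ract c.inner_tensorLin c.tensorLin_surjective

/-- The unit comparison as a linear map. -/
def unitorLin : unit N →ₗ[ℂ] c.obj (unit M) where
  toFun a := ⟨c.φ a, c.p_mul_φ a, c.φ_mul_p a⟩
  map_add' a b := Subtype.ext (map_add c.φ (show Alg N from a) b)
  map_smul' z a := Subtype.ext (map_smul c.φ z (show Alg N from a))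

/-- The unit comparison of the functor of a Morita context. -/
def unitorIso : 𝟙_ (Bim N) ≅ c.functor.obj (𝟙_ (Bim M)) :=
  isoOfInner (X := unit N) (Y := c.obj (unit M)) c.unitorLin
    (fun a b => Subtype.ext (map_mul c.φ a (show Alg N from b)))
    (fun a b => Subtype.ext (map_mul c.φ (show Alg N from a) b))
    (fun a b => (show ∀ a b : Alg N, c.ρ ((c.φ a).conjTranspose * c.φ b) = star a * b from
      fun a b => by rw [← φ_star, ← map_mul c.φ, ρ_φ]) a b)
    (fun z => ⟨c.ρ z.1, Subtype.ext ((c.φ_ρ z.1).trans (by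
      exact (congrArg (fun y : Matrix (Fin c.n) (Fin c.n) (Alg M) => y * c.p) z.2.1).trans z.2.2))⟩)

/-- The monoidal structure of the functor of a Morita context. -/
def coreMonoidal : c.functor.CoreMonoidal where
  εIso := c.unitorIso
  μIso X Y := c.tensorIso X Y
  μIso_hom_natural_left f X' := hom_ext2 fun x y => Subtype.ext (matTm_map f (𝟙 X') x.1 y.1)
  μIso_hom_natural_right X' f := hom_ext2 fun x y => Subtype.ext (matTm_map (𝟙 X') f x.1 y.1)
  associativity X Y Z := hom_ext3 fun x y z => Subtype.ext (Matrix.ext fun i j => by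
    change lin (α_ X Y Z).hom (∑ k, tm (∑ l, tm (x.1 i l) (y.1 l k)) (z.1 k j))
      = ∑ l, tm (x.1 i l) (∑ k, tm (y.1 l k) (z.1 k j))
    have h1 : ∀ k, tm (∑ l, tm (x.1 i l) (y.1 l k)) (z.1 k j)
        = ∑ l, tm (tm (x.1 i l) (y.1 l k)) (z.1 k j) := fun k => sum_tmul _ _ _
    have h2 : ∀ l, tm (x.1 i l) (∑ k, tm (y.1 l k) (z.1 k j))
        = ∑ k, tm (x.1 i l) (tm (y.1 l k) (z.1 k j)) := fun l => tmul_sum _ _ _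
    simp only [h1, h2, map_sum]
    exact Finset.sum_comm)
  left_unitality X := hom_ext2 fun a x => Subtype.ext (Matrix.ext fun i j => by
    change (∑ k, X.lact (c.φ a i k) (x.1 k j))
      = leftUL X (∑ k, tm (X := unit M) (c.φ a i k) (x.1 k j))
    rw [map_sum]
    rfl)
  right_unitality X := hom_ext2 fun x a => Subtype.ext (Matrix.ext fun i j => by
    change (∑ k, X.ract (x.1 i k) (c.φ a k j))
      = rightUL X (∑ k, tm (Y := unit M) (x.1 i k) (c.φ a k j))
    rw [map_sum]
    rfl)

instance : c.functor.IsEquivalence := c.equivalence.isEquivalence_functor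

theorem exactPairing (h : Nonempty (ExactPairing X Y)) :
    Nonempty (ExactPairing (c.functor.obj X) (c.functor.obj Y)) := by
  obtain ⟨h⟩ := h
  let _ := c.swap.coreMonoidal.toMonoidal
  let _ : ExactPairing (c.swap.functor.obj (c.functor.obj X)) (c.swap.functor.obj (c.functor.obj Y)) :=
    exactPairingCongr (c.unitIso X).symm (c.unitIso Y).symm
  exact ⟨ExactPairing.ofFullyFaithful c.swap.functor _ _⟩

end Context

end

section

open Filter Topology
variable {K : Type u} [NormedAddCommGroup K] [InnerProductSpace ℂ K] [CompleteSpace K]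
variable {N : VonNeumannAlgebra K} {tr : Alg M →ₗ[ℂ] ℂ} {tr' : Alg N →ₗ[ℂ] ℂ}
open Bim MonoidalCategory
variable [hM : Fact (IsIIOneFactor M tr)] [hN : Fact (IsIIOneFactor N tr')]
open scoped RightActions

/-! ### Asymptotics in the corner bimodule -/

namespace Context

set_option linter.unusedSectionVars false

variable (c : Context tr tr') {X Y Z : Bim M}

/-- The entries of an element of the corner. -/
def entry (i j : Fin c.n) : c.obj X →ₗ[ℂ] X where
  toFun x := x.1 i j
  map_add' _ _ := rfl
  map_smul' _ _ := rfl

theorem φ_inner_apply (x y : c.obj X) (i j : Fin c.n) :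
    c.φ ((c.obj X).inner x y) i j = ∑ k, X.inner (c.entry k i x) (c.entry k j y) := by
  rw [φ_inner]; rfl

theorem inner_eq_sum (x y : c.obj X) : (c.obj X).inner x y = ∑ i, ∑ j, ∑ t, ∑ s,
    star (c.W i s ()) * c.ψ (∑ k, X.inner (c.entry k i x) (c.entry k j y)) s t * c.W j t () :=
  c.ρ_apply' _

theorem inner_entry (z : X) (x : c.obj X) (i j : Fin c.n) :
    X.inner z (c.entry i j x) = ∑ s, ∑ l, (∑ k, star (c.V s k ()) *
      c.φ ((c.obj X).inner ⟨c.cornerBasis z i s, c.cornerBasis_mem z i s⟩ x) k l)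
        * star (c.p j l) := by
  have h : ∑ s, (c.V s).conjTranspose *
      matInner (c.cornerBasis z i s) x.1 * (c.row j).conjTranspose
        = cell (X.inner z (x.1 i j)) := by
    simp only [cornerBasis, matInner_matRact_left, Matrix.conjTranspose_conjTranspose,
      ← Matrix.mul_assoc]
    rw [← Matrix.sum_mul, ← Matrix.sum_mul, c.sum_V, Matrix.one_mul, matInner_matLact,
      Matrix.conjTranspose_conjTranspose, ← matInner_matRact, c.matLact_row_matRact x.2,
      matInner_cell]
  have h1 := congrFun (congrFun h ()) ()
  rw [Matrix.sum_apply] at h1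
  refine h1.symm.trans (Finset.sum_congr rfl fun s _ => ?_)
  rw [← c.φ_inner ⟨c.cornerBasis z i s, c.cornerBasis_mem z i s⟩ x]
  rfl

theorem bddX_entry {x : ℕ → c.obj X} (hx : BddX (c.obj X) x) (i j : Fin c.n) :
    BddX X fun n => c.entry i j (x n) := fun z => by
  simp only [inner_entry]
  exact BddA.sum _ fun s => BddA.sum _ fun l => (BddA.sum _ fun k =>
    (BddA.const _).mul (c.bdd_φ (hx _) k l)).mul (BddA.const _)

theorem nullX_entry {x : ℕ → c.obj X} (hx : NullX tr' (c.obj X) x) (i j : Fin c.n) :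
    NullX tr X fun n => c.entry i j (x n) := fun z => by
  have hτ := hM.out.isPosTrace
  simp only [inner_entry]
  exact NullA.sum _ hτ fun s => NullA.sum _ hτ fun l => (NullA.sum _ hτ fun k =>
    NullA.mul_left hτ (BddA.const _) (c.null_φ (hx _) k l)).mul_right hτ (BddA.const _)

theorem bddX_of_entry {x : ℕ → c.obj X} (hx : ∀ i j, BddX X fun n => c.entry i j (x n)) :
    BddX (c.obj X) x := fun y => by
  simp only [inner_eq_sum]
  exact BddA.sum _ fun i => BddA.sum _ fun j => BddA.sum _ fun t => BddA.sum _ fun s =>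
    ((BddA.const _).mul (c.bdd_ψ (BddA.sum _ fun k => hx k j _) s t)).mul (BddA.const _)

theorem nullX_of_entry {x : ℕ → c.obj X} (hx : ∀ i j, NullX tr X fun n => c.entry i j (x n)) :
    NullX tr' (c.obj X) x := fun y => by
  have hτ := hM.out.isPosTrace
  have hτ' := hN.out.isPosTrace
  simp only [inner_eq_sum]
  exact NullA.sum _ hτ' fun i => NullA.sum _ hτ' fun j => NullA.sum _ hτ' fun t =>
    NullA.sum _ hτ' fun s => (NullA.mul_left hτ' (BddA.const _)
      (c.null_ψ (NullA.sum _ hτ fun k => hx k j _) s t)).mul_right hτ' (BddA.const _)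

/-- The entries of a sequence in the corner, as a function. -/
def asyEntryFun (i j : Fin c.n) : Asy tr' (c.obj X) → Asy tr X :=
  Quotient.map (fun x => (⟨fun n => c.entry i j (x.1 n), c.bddX_entry x.2 i j⟩ : bddGrp X))
    (fun x y hxy => Asy.rel_iff.2 (by
      simpa only [map_sub] using c.nullX_entry (Asy.rel_iff.1 hxy) i j))

/-- The entries of a sequence in the corner. -/
def asyEntry (i j : Fin c.n) : Asy tr' (c.obj X) →+ Asy tr X :=
  AddMonoidHom.mk' (c.asyEntryFun i j) (fun x y => by
    induction x using Asy.ind with | _ x hx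
    induction y using Asy.ind with | _ y hy
    rfl)

theorem asyEntry_mk {x : ℕ → c.obj X} (hx : BddX (c.obj X) x) (i j : Fin c.n) :
    c.asyEntry i j (Asy.mk x hx : Asy tr' (c.obj X)) = Asy.mk _ (c.bddX_entry hx i j) := rfl

theorem asyEntry_const (x : c.obj X) (i j : Fin c.n) :
    c.asyEntry i j (Asy.const tr' x) = Asy.const tr (c.entry i j x) := rfl

theorem asyEntry_ext {x y : Asy tr' (c.obj X)} (h : ∀ i j, c.asyEntry i j x = c.asyEntry i j y) :
    x = y := by
  induction x using Asy.ind with | _ x hx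
  induction y using Asy.ind with | _ y hy
  refine Asy.mk_eq.2 (c.nullX_of_entry fun i j => ?_)
  simpa only [map_sub] using Asy.mk_eq.1 (h i j)

theorem asyAlg_mk_sum {ι : Type*} (s : Finset ι) {x : ι → ℕ → Alg M} (hx : ∀ i, BddA (x i)) :
    ∑ i ∈ s, (AsyAlg.mk (x i) (hx i) : AsyAlg tr) = AsyAlg.mk _ (BddA.sum s hx) := by
  classical
  induction s using Finset.induction_on with
  | empty => exact AsyAlg.mk_congr (tr := tr) fun n => by simp
  | insert i s hi ih =>
    rw [Finset.sum_insert hi, ih, AsyAlg.mk_add]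
    exact AsyAlg.mk_congr fun n => by simp [Finset.sum_insert hi]

/-- The extension of the embedding of a corner to sequences. -/
def asyφ (α : AsyAlg tr') : Matrix (Fin c.n) (Fin c.n) (AsyAlg tr) := Matrix.of fun i j =>
  Quotient.map (fun a : bddRing N => (⟨fun n => c.φ (a.1 n) i j, c.bdd_φ a.2 i j⟩ : bddRing M))
    (fun a b (h : NullA tr' fun n => a.1 n - b.1 n) => by
      change NullA tr fun n => c.φ (a.1 n) i j - c.φ (b.1 n) i j
      simpa only [map_sub, Matrix.sub_apply] using c.null_φ h i j) α

theorem asyφ_mk {a : ℕ → Alg N} (ha : BddA a) (i j : Fin c.n) :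
    c.asyφ (AsyAlg.mk a ha) i j = AsyAlg.mk _ (c.bdd_φ ha i j) := rfl

theorem asyφ_const (a : Alg N) : c.asyφ (constA tr' a) = (c.φ a).map (constA tr) := rfl

theorem asyφ_mul (α β : AsyAlg tr') : c.asyφ (α * β) = c.asyφ α * c.asyφ β := by
  induction α using AsyAlg.ind with | _ a ha
  induction β using AsyAlg.ind with | _ b hb
  refine Matrix.ext fun i j => ?_
  rw [AsyAlg.mk_mul, asyφ_mk, Matrix.mul_apply]
  simp only [asyφ_mk, AsyAlg.mk_mul]
  rw [asyAlg_mk_sum _ fun k => (c.bdd_φ ha i k).mul (c.bdd_φ hb k j)]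
  exact AsyAlg.mk_congr fun n => by rw [map_mul, Matrix.mul_apply]

theorem asyEntry_smul (α : AsyAlg tr') (x : Asy tr' (c.obj X)) (i j : Fin c.n) :
    c.asyEntry i j (α • x) = ∑ k, c.asyφ α i k • c.asyEntry k j x := by
  induction x using Asy.ind with | _ x hx
  induction α using AsyAlg.ind with | _ a ha
  simp only [asyφ_mk, asyEntry_mk, Asy.smul_mk]
  rw [Asy.mk_sum _ fun k => (c.bddX_entry hx k j).lact (c.bdd_φ ha i k)]
  rfl

theorem asyEntry_ract (x : Asy tr' (c.obj X)) (α : AsyAlg tr') (i j : Fin c.n) :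
    c.asyEntry i j (x <• α) = ∑ k, c.asyEntry i k x <• c.asyφ α k j := by
  induction x using Asy.ind with | _ x hx
  induction α using AsyAlg.ind with | _ a ha
  simp only [asyφ_mk, asyEntry_mk, Asy.mk_smul]
  rw [Asy.mk_sum _ fun k => (c.bddX_entry hx i k).ract (c.bdd_φ ha k j)]
  rfl

theorem asyφ_inner (x y : Asy tr' (c.obj X)) (i j : Fin c.n) :
    c.asyφ (Asy.inner x y) i j = ∑ k, Asy.inner (c.asyEntry k i x) (c.asyEntry k j y) := by
  induction x using Asy.ind with | _ x hx
  induction y using Asy.ind with | _ y hy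
  simp only [Asy.inner_mk, asyφ_mk, asyEntry_mk]
  rw [asyAlg_mk_sum _ fun k => (c.bddX_entry hx k i).inner (c.bddX_entry hy k j)]
  exact AsyAlg.mk_congr fun n => c.φ_inner_apply _ _ _ _

theorem asyEntry_map (f : X ⟶ Y) (x : Asy tr' (c.obj X)) (i j : Fin c.n) :
    c.asyEntry i j (Asy.map (c.functor.map f) x) = Asy.map f (c.asyEntry i j x) := by
  induction x using Asy.ind with | _ x hx
  rfl

theorem asyEntry_tensorIso (x : Asy tr' (c.obj X)) (y : Asy tr' (c.obj Y)) (i j : Fin c.n) :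
    c.asyEntry i j (Asy.map (c.tensorIso X Y).hom (Asy.tm x y))
      = ∑ k, Asy.tm (c.asyEntry i k x) (c.asyEntry k j y) := by
  induction x using Asy.ind with | _ x hx
  induction y using Asy.ind with | _ y hy
  simp only [asyEntry_mk, Asy.tm_mk]
  rw [Asy.mk_sum _ fun k => (c.bddX_entry hx i k).tm (c.bddX_entry hy k j)]
  rfl

theorem p_smul_asyEntry (x : Asy tr' (c.obj X)) (i j : Fin c.n) :
    ∑ k, constA tr (c.p i k) • c.asyEntry k j x = c.asyEntry i j x := by
  have h := c.asyEntry_smul (constA tr' 1) x i j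
  rw [map_one, one_smul] at h
  exact h.symm

theorem asyEntry_ract_p (x : Asy tr' (c.obj X)) (i j : Fin c.n) :
    ∑ k, c.asyEntry i k x <• constA tr (c.p k j) = c.asyEntry i j x := by
  have h := c.asyEntry_ract x (constA tr' 1) i j
  rw [map_one, MulOpposite.op_one, one_smul] at h
  exact h.symm

/-! ### Approximate innerness -/

theorem exists_compress (ξ : Asy tr X) : ∃ η : Asy tr' (c.obj X), ∀ i j,
    c.asyEntry i j η = ∑ k, (constA tr (c.p i k) • ξ) <• constA tr (c.p k j) := by
  induction ξ using Asy.ind with | _ x hx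
  have hmem : ∀ y : X, (Matrix.of fun i j => ∑ k, X.ract (X.lact (c.p i k) y) (c.p k j) :
      Matrix (Fin c.n) (Fin c.n) X) ∈ c.corner X := fun y => by
    have h : (Matrix.of fun i j => ∑ k, X.ract (X.lact (c.p i k) y) (c.p k j) :
        Matrix (Fin c.n) (Fin c.n) X) = ∑ k, matRact (matLact (c.row k).conjTranspose (cell y)) (c.row k) := by
      refine Matrix.ext fun i j => ?_
      rw [Matrix.sum_apply, Matrix.of_apply]
      refine Finset.sum_congr rfl fun k _ => ?_
      rw [matRact_apply, Fintype.sum_unique, matLact_apply, Fintype.sum_unique]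
      rw [show c.p i k = (c.row k).conjTranspose i () from
        (congrFun (congrFun c.star_p i) k).symm]
      rfl
    rw [h]
    exact (c.corner X).sum_mem fun k _ => c.row_mem y k k
  have hb : ∀ i j, BddX X fun n => ∑ k, X.ract (X.lact (c.p i k) (x n)) (c.p k j) := fun i j =>
    BddX.sum _ fun k => (hx.lact (BddA.const _)).ract (BddA.const _)
  refine ⟨Asy.mk (X := c.obj X) (fun n => ⟨_, hmem (x n)⟩) (c.bddX_of_entry hb), fun i j => ?_⟩
  exact (Asy.mk_sum (tr := tr) Finset.univ fun k =>
    (hx.lact (BddA.const (c.p i k))).ract (BddA.const (c.p k j))).symm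

theorem p_mul_p_apply (i j : Fin c.n) : ∑ k, c.p i k * c.p k j = c.p i j :=
  congrFun (congrFun c.p_mul_p i) j

theorem exists_asyBasis {ι : Type*} [Fintype ι] {β : ι → Asy tr X} (hβ : Asy.IsAsyBasis β) :
    ∃ B : ι → Asy tr' (c.obj X), Asy.IsAsyBasis B ∧
      ∀ q i j, c.asyEntry i j (B q) = constA tr (c.p i j) • β q := by
  choose B hB using fun q => c.exists_compress (β q)
  have hB' : ∀ q i j, c.asyEntry i j (B q) = constA tr (c.p i j) • β q := fun q i j => by
    rw [hB, ← c.p_mul_p_apply i j, map_sum, Finset.sum_smul]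
    refine Finset.sum_congr rfl fun k _ => ?_
    rw [← Asy.smul_ract, ← hβ.comm, smul_smul, map_mul]
  refine ⟨B, ⟨fun q a => c.asyEntry_ext fun i j => ?_, fun x => c.asyEntry_ext fun i j => ?_⟩, hB'⟩
  · rw [asyEntry_smul, asyEntry_ract, asyφ_const]
    simp only [hB', Matrix.map_apply, smul_smul, ← map_mul, ← Asy.smul_ract, ← hβ.comm q (c.φ a _ _)]
    rw [← Finset.sum_smul, ← Finset.sum_smul, ← map_sum, ← map_sum]
    congr 2
    exact (congrFun (congrFun ((c.φ_mul_p a).trans (c.p_mul_φ a).symm) i) j)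
  · have h1 : ∀ q l, c.asyφ (Asy.inner (B q) x) l j = Asy.inner (β q) (c.asyEntry l j x) :=
      fun q l => by
        rw [asyφ_inner, ← c.p_smul_asyEntry x l j, map_sum]
        refine Finset.sum_congr rfl fun k _ => ?_
        rw [hB', Asy.inner_smul, star_constA]
        congr 3
        exact congrFun (congrFun c.star_p l) k
    simp only [map_sum, asyEntry_ract, h1, hB', ← Asy.smul_ract]
    rw [Finset.sum_comm]
    simp only [← Finset.smul_sum, hβ.sum, p_smul_asyEntry]

theorem approximatelyInner (hX : ApproximatelyInner tr X) :
    ApproximatelyInner tr' (c.functor.obj X) := by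
  obtain ⟨K, β, hβ⟩ := Asy.approximatelyInner_iff.1 hX
  obtain ⟨B, hB, -⟩ := c.exists_asyBasis hβ
  exact hB.approximatelyInner

/-! ### Central triviality -/

/-- The sequence in `M` given by a central sequence of `N`. -/
theorem exists_central {α : AsyAlg tr'} (hα : ∀ a, constA tr' a * α = α * constA tr' a) :
    ∃ γ : AsyAlg tr, (∀ a, constA tr a * γ = γ * constA tr a) ∧
      ∀ i j, c.asyφ α i j = γ * constA tr (c.p i j) := by
  have hc : ∀ a, (c.φ a).map (constA tr) * c.asyφ α = c.asyφ α * (c.φ a).map (constA tr) := fun a => by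
    rw [← asyφ_const, ← asyφ_mul, ← asyφ_mul, hα]
  let v : Fin c.r → Matrix (Fin c.n) Unit (AsyAlg tr) := fun s => (c.V s).map (constA tr)
  let v' : Fin c.r → Matrix Unit (Fin c.n) (AsyAlg tr) :=
    fun s => (c.V s).conjTranspose.map (constA tr)
  have hv : ∑ s, v' s * v s = 1 := by
    have h := congrArg (constA tr).mapMatrix c.sum_V
    rw [map_sum, map_one] at h
    simpa only [RingHom.mapMatrix_apply, Matrix.map_mul] using h
  let G : Matrix Unit Unit (AsyAlg tr) := ∑ s, v' s * c.asyφ α * v s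
  have hG : ∀ m : Matrix Unit Unit (AsyAlg tr), (∀ s t, v s * m * v' t * c.asyφ α
      = c.asyφ α * (v s * m * v' t)) → m * G = G * m := fun m hm => by
    calc m * G = (∑ t, v' t * v t) * m * G := by rw [hv, Matrix.one_mul]
      _ = ∑ t, ∑ s, v' t * (v t * m * v' s * c.asyφ α) * v s := by
        simp only [G, Matrix.sum_mul, Matrix.mul_sum, Matrix.mul_assoc]
        exact Finset.sum_comm
      _ = ∑ t, ∑ s, v' t * (c.asyφ α * (v t * m * v' s)) * v s := by simp only [hm]
      _ = G * m * ∑ s, v' s * v s := by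
        simp only [G, Matrix.sum_mul, Matrix.mul_sum, Matrix.mul_assoc]
        exact Finset.sum_comm
      _ = G * m := by rw [hv, Matrix.mul_one]
  refine ⟨G () (), fun a => ?_, fun i j => ?_⟩
  · have h1 := hG (cell (constA tr a)) fun s t => by
      have h2 : v s * cell (constA tr a) * v' t = (c.φ (c.ψ a s t)).map (constA tr) := by
        rw [c.φ_ψ, Matrix.map_mul, Matrix.map_mul]
        rfl
      rw [h2, hc]
    have h3 := congrFun (congrFun h1 ()) ()
    simpa [Matrix.mul_apply] using h3
  · have h1 : ∀ s, c.asyφ α * (v s * (c.row i).map (constA tr))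
        = v s * (c.row i).map (constA tr) * c.asyφ α := fun s => by
      have h2 : v s * (c.row i).map (constA tr) = (c.φ (c.W i s ())).map (constA tr) := by
        rw [c.φ_W, Matrix.map_mul]
        rfl
      rw [h2, hc]
    have h3 : G * (c.row i).map (constA tr) = (c.row i).map (constA tr) * c.asyφ α := by
      calc G * (c.row i).map (constA tr)
          = ∑ s, v' s * (c.asyφ α * (v s * (c.row i).map (constA tr))) := by
            simp only [G, Matrix.sum_mul, Matrix.mul_assoc]
        _ = (∑ s, v' s * v s) * ((c.row i).map (constA tr) * c.asyφ α) := by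
            simp only [h1, Matrix.sum_mul, Matrix.mul_assoc]
        _ = _ := by rw [hv, Matrix.one_mul]
    have h4 : c.asyφ α = (c.φ 1).map (constA tr) * c.asyφ α := by
      rw [← asyφ_const, ← asyφ_mul, map_one, one_mul]
    rw [h4]
    refine (congrFun (congrFun h3 ()) j).symm.trans ?_
    rw [Matrix.mul_apply, Fintype.sum_unique]
    rfl

theorem centrallyTrivial (hX : CentrallyTrivial tr X) :
    CentrallyTrivial tr' (c.functor.obj X) := by
  refine Asy.centrallyTrivial_iff.2 fun α hα x => ?_
  obtain ⟨γ, hγ, h⟩ := c.exists_central hα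
  refine c.asyEntry_ext (X := X) fun i j => ?_
  refine (c.asyEntry_smul α (Asy.const tr' x) i j).trans
    (Eq.trans ?_ (c.asyEntry_ract (Asy.const tr' x) α i j).symm)
  have h1 : ∀ k, c.asyφ α k j = constA tr (c.p k j) * γ := fun k => by rw [h, hγ]
  simp only [h1]
  simp only [h, mul_smul, Asy.ract_mul]
  rw [← Finset.smul_sum, ← Finset.smul_sum]
  rw [p_smul_asyEntry, asyEntry_ract_p]
  exact hX.smul_const hγ (c.entry i j x)

theorem isLocal (hX : IsLocal tr X) : IsLocal tr' (c.functor.obj X) :=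
  ⟨c.approximatelyInner hX.1, c.centrallyTrivial hX.2⟩

theorem chiProp_obj (hX : chiProp tr X) : chiProp tr' (c.functor.obj X) := by
  obtain ⟨h, ⟨Y, hY, pY⟩, Z, hZ, pZ⟩ := hX
  exact ⟨c.isLocal h, ⟨_, c.isLocal hY, c.exactPairing pY⟩, _, c.isLocal hZ, c.exactPairing pZ⟩

/-! ### Compatibility with the braiding -/

theorem tensorIso_braidHom (hX : ApproximatelyInner tr X) (hY : CentrallyTrivial tr Y)
    (hX' : ApproximatelyInner tr' (c.functor.obj X)) (hY' : CentrallyTrivial tr' (c.functor.obj Y)) :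
    (c.tensorIso X Y).hom ≫ c.functor.map (braidHom hX hY)
      = braidHom hX' hY' ≫ (c.tensorIso Y X).hom := by
  obtain ⟨K, β, hβ⟩ := Asy.approximatelyInner_iff.1 hX
  obtain ⟨B, hB, h⟩ := c.exists_asyBasis hβ
  refine hom_ext_commuting (X := c.obj X) (Y := c.obj Y) hB fun q y =>
    c.asyEntry_ext (X := tensor Y X) fun i j => ?_
  refine (congrArg _ (Asy.map_comp (X := tensor (c.obj X) (c.obj Y)) (c.tensorIso X Y).hom
    (c.functor.map (braidHom hX hY)) _)).trans (Eq.trans ?_ (congrArg _ (Asy.map_comp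
      (X := tensor (c.obj X) (c.obj Y)) (braidHom hX' hY') (c.tensorIso Y X).hom _)).symm)
  have h1 : Asy.map (braidHom hX' hY') (Asy.tm (B q) (Asy.const tr' y))
      = Asy.tm (Asy.const tr' y) (B q) := map_braidHom_tm hX' hY' (hB.comm q) y
  have h2 : ∀ l, Asy.map (braidHom hX hY) (Asy.tm (β q) (Asy.const tr (c.entry l j y)))
      = Asy.tm (Asy.const tr (c.entry l j y)) (β q) := fun l => map_braidHom_tm hX hY (hβ.comm q) _
  refine (c.asyEntry_map _ _ i j).trans ?_
  refine (congrArg _ (c.asyEntry_tensorIso (B q) (Asy.const tr' y) i j)).trans (Eq.trans ?_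
    ((congrArg _ (congrArg _ h1)).trans (c.asyEntry_tensorIso (Asy.const tr' y) (B q) i j)).symm)
  simp only [h, map_sum, ← Asy.tm_balanced, ← Asy.smul_tm, Asy.map_smul, asyEntry_const, h2]
  simp only [Asy.smul_tm]
  have h3 := congrArg (fun x => Asy.tm x (β q)) (c.p_smul_asyEntry (Asy.const tr' y) i j)
  have h4 := congrArg (fun x => Asy.tm x (β q)) (c.asyEntry_ract_p (Asy.const tr' y) i j)
  simp only [map_sum, AddMonoidHom.finsetSum_apply] at h3 h4
  exact h3.trans h4.symm

end Context

end

section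

open Filter Topology
variable {K : Type u} [NormedAddCommGroup K] [InnerProductSpace ℂ K] [CompleteSpace K]
variable {N : VonNeumannAlgebra K} {tr : Alg M →ₗ[ℂ] ℂ} {tr' : Alg N →ₗ[ℂ] ℂ}
open Bim MonoidalCategory

/-! ### Matricial embeddings of finite factors -/

theorem IsNormal.map_smul {φ : Alg M → ℂ} (hφ : IsNormal φ) (z : ℂ) (a : Alg M) :
    φ (z • a) = z * φ a := by
  obtain ⟨ι, ξ, η, -, -, h3⟩ := hφ
  refine (h3 (z • a)).unique ?_
  have h := (h3 a).mul_left z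
  simp only [← inner_smul_right] at h
  exact h

theorem IsNormal.exists_bound {φ : Alg M → ℂ} (hφ : IsNormal φ) :
    ∃ B : ℝ, ∀ a, ‖φ a‖ ≤ B * ‖a‖ := by
  obtain ⟨ι, ξ, η, h1, h2, h3⟩ := hφ
  have h4 := h1.add h2
  refine ⟨∑' i, (‖ξ i‖ ^ 2 + ‖η i‖ ^ 2), fun a => ?_⟩
  rw [← (h3 a).tsum_eq]
  refine tsum_of_norm_bounded (h4.hasSum.mul_right ‖a‖) fun i => ?_
  have e1 : ‖inner ℂ (ξ i) ((a : H →L[ℂ] H) (η i))‖ ≤ ‖ξ i‖ * (‖a‖ * ‖η i‖) :=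
    (norm_inner_le_norm _ _).trans (mul_le_mul_of_nonneg_left ((a : H →L[ℂ] H).le_opNorm _)
      (norm_nonneg _))
  have e2 : ‖ξ i‖ * ‖η i‖ ≤ ‖ξ i‖ ^ 2 + ‖η i‖ ^ 2 := by
    nlinarith [sq_nonneg (‖ξ i‖ - ‖η i‖), sq_nonneg ‖ξ i‖, sq_nonneg ‖η i‖]
  calc _ ≤ ‖ξ i‖ * (‖a‖ * ‖η i‖) := e1
    _ = ‖ξ i‖ * ‖η i‖ * ‖a‖ := by ring
    _ ≤ _ := mul_le_mul_of_nonneg_right e2 (norm_nonneg _)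

section Embedding

variable {n : ℕ} (φ : Alg N →⋆ₙₐ[ℂ] Matrix (Fin n) (Fin n) (Alg M))

theorem embedding_star_mul_self_apply (a : Alg N) (j : Fin n) :
    φ (star a * a) j j = ∑ k, star (φ a k j) * φ a k j := by
  rw [map_mul, map_star, Matrix.mul_apply]
  rfl

theorem embedding_star_mul_self_le (a : Alg N) (k j : Fin n) :
    star (φ a k j) * φ a k j ≤ ((‖a‖ ^ 2 : ℝ) : ℂ) • φ 1 j j := by
  obtain ⟨c, hc⟩ := CStarAlgebra.nonneg_iff_eq_star_mul_self.1 (sub_nonneg.2 (star_mul_self_le_norm a))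
  have h1 : φ (star a * a) j j ≤ ((‖a‖ ^ 2 : ℝ) : ℂ) • φ 1 j j := by
    rw [← sub_nonneg, ← Matrix.smul_apply, ← map_smul, ← Matrix.sub_apply, ← map_sub, hc,
      embedding_star_mul_self_apply]
    exact Finset.sum_nonneg fun i _ => star_mul_self_nonneg _
  refine le_trans ?_ h1
  rw [embedding_star_mul_self_apply]
  exact Finset.single_le_sum (f := fun k => star (φ a k j) * φ a k j)
    (fun i _ => star_mul_self_nonneg _) (Finset.mem_univ k)

theorem embedding_norm_le (a : Alg N) (k j : Fin n) :
    ‖φ a k j‖ ≤ Real.sqrt ‖φ 1 j j‖ * ‖a‖ := by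
  have h := CStarAlgebra.norm_le_norm_of_nonneg_of_le (star_mul_self_nonneg _)
    (embedding_star_mul_self_le φ a k j)
  rw [CStarRing.norm_star_mul_self, norm_smul, Complex.norm_real, Real.norm_of_nonneg (sq_nonneg _),
    ← sq] at h
  refine ((le_abs_self _).trans (Real.abs_le_sqrt h)).trans_eq ?_
  rw [mul_comm, Real.sqrt_mul (norm_nonneg _), Real.sqrt_sq (norm_nonneg _)]

theorem embedding_bdd {a : ℕ → Alg N} (ha : BddA a) (k l : Fin n) : BddA fun m => φ (a m) k l := by
  obtain ⟨C, hC⟩ := ha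
  exact ⟨_, fun m => (embedding_norm_le φ (a m) k l).trans
    (mul_le_mul_of_nonneg_left (hC m) (Real.sqrt_nonneg _))⟩

theorem embedding_null (hM : IsIIOneFactor M tr) (hN : IsIIOneFactor N tr') {a : ℕ → Alg N}
    (ha : NullA tr' a) (k l : Fin n) : NullA tr fun m => φ (a m) k l := by
  let τ : Alg N →ₗ[ℂ] ℂ :=
    { toFun := fun a => ∑ i, tr (φ a i i)
      map_add' := fun a b => by
        simp only [map_add, Matrix.add_apply, Finset.sum_add_distrib]
      map_smul' := fun z a => by
        simp only [map_smul, Matrix.smul_apply, Finset.smul_sum, RingHom.id_apply] }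
  have hτ1 : ∀ a, τ (star a * a) = ∑ i, ∑ k, tr (star (φ a k i) * φ a k i) := fun a => by
    change ∑ i, tr (φ (star a * a) i i) = _
    simp only [embedding_star_mul_self_apply, map_sum]
  have hτ : IsPosTrace τ := by
    refine ⟨fun a b => ?_, fun a => ?_⟩
    · change ∑ i, tr (φ (a * b) i i) = ∑ i, tr (φ (b * a) i i)
      simp only [map_mul, Matrix.mul_apply, map_sum]
      rw [Finset.sum_comm]
      simp only [hM.tr_mul_comm]
    · choose r hr h using fun i k => hM.tr_nonneg (φ a k i)
      refine ⟨∑ i, ∑ k, r i k, Finset.sum_nonneg fun i _ => Finset.sum_nonneg fun k _ => hr i k, ?_⟩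
      rw [hτ1]
      simp only [h, Complex.ofReal_sum]
  refine NullA.of_le hM.isPosTrace (f := fun m => (τ 1).re * twoSq tr' (a m))
    (by simpa using Tendsto.const_mul _ ha) fun m => ?_
  rw [twoSq, twoSq, ← hN.trace_unique hτ (star_mul_self_nonneg (a m)), hτ1]
  simp only [Complex.re_sum]
  have h1 : ∀ i k, 0 ≤ (tr (star (φ (a m) k i) * φ (a m) k i)).re := fun i k =>
    hM.isPosTrace.twoSq_nonneg _
  refine le_trans ?_ (Finset.single_le_sum (fun i _ => Finset.sum_nonneg fun k _ => h1 i k)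
    (Finset.mem_univ l))
  exact Finset.single_le_sum (f := fun k => (tr (star (φ (a m) k l) * φ (a m) k l)).re)
    (fun k _ => h1 l k) (Finset.mem_univ k)

theorem embedding_normal (hM : IsIIOneFactor M tr) (hN : IsIIOneFactor N tr') {g : Alg M → ℂ}
    (hg : IsNormal g) (k l : Fin n) : IsNormal fun a => g (φ a k l) := by
  obtain ⟨B, hB⟩ := hg.exists_bound
  let f : Alg N →ₗ[ℂ] ℂ :=
    { toFun := fun a => g (φ a k l)
      map_add' := fun a b => by rw [map_add, Matrix.add_apply, hg.map_add]
      map_smul' := fun z a => by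
        rw [map_smul, Matrix.smul_apply, hg.map_smul, RingHom.id_apply, smul_eq_mul] }
  refine hN.isNormal_of_tendsto (f := f) (B := |B| * Real.sqrt ‖φ 1 l l‖) (fun a => ?_)
    fun a hb h0 => ?_
  · refine (hB _).trans ((mul_le_mul_of_nonneg_right (le_abs_self B) (norm_nonneg _)).trans ?_)
    rw [mul_assoc]
    exact mul_le_mul_of_nonneg_left (embedding_norm_le φ a k l) (abs_nonneg _)
  · obtain ⟨C, hC⟩ := embedding_bdd φ hb k l
    exact hM.tendsto_normal hg hC (embedding_null φ hM hN h0 k l)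

end Embedding

/-! ### The Morita context of a stable isomorphism -/

section StableIsomorphism

variable {n r : ℕ} {φ : Alg N →⋆ₙₐ[ℂ] Matrix (Fin n) (Fin n) (Alg M)}

theorem embedding_one_mul (a : Alg N) : φ 1 * φ a = φ a := by rw [← map_mul, one_mul]

theorem embedding_mul_one (a : Alg N) : φ a * φ 1 = φ a := by rw [← map_mul, mul_one]

variable (φ) in
/-- The rows of the image of the unit. -/
def oneRow (i : Fin n) : Matrix Unit (Fin n) (Alg M) := Matrix.of fun _ j => φ 1 i j

theorem conjTranspose_embedding_one : (φ 1).conjTranspose = φ 1 := by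
  rw [← Matrix.star_eq_conjTranspose, ← map_star, star_one]

theorem oneRow_mul {κ : Type} (i : Fin n) {A : Matrix (Fin n) κ (Alg M)} (hA : φ 1 * A = A) :
    oneRow φ i * A = Matrix.of fun _ j => A i j :=
  Matrix.ext fun _ j => congrFun (congrFun hA i) j

theorem oneRow_mul_mul (i j : Fin n) (a : Alg N) :
    oneRow φ i * φ a * (oneRow φ j).conjTranspose = cell (φ a i j) := by
  rw [oneRow_mul i (embedding_one_mul a)]
  refine Matrix.ext fun k l => Eq.trans ?_ (congrFun (congrFun (embedding_mul_one a) i) j)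
  change ∑ m, φ a i m * star (φ 1 j m) = ∑ m, φ a i m * φ 1 m j
  refine Finset.sum_congr rfl fun m _ => ?_
  exact congrArg (φ a i m * ·) (congrFun (congrFun conjTranspose_embedding_one m) j)

theorem sum_oneRow : ∑ i, (oneRow φ i).conjTranspose * oneRow φ i = φ 1 := by
  refine Matrix.ext fun k l => ?_
  rw [Matrix.sum_apply]
  refine Eq.trans ?_ (congrFun (congrFun (embedding_one_mul (φ := φ) 1) k) l)
  refine Finset.sum_congr rfl fun i _ => ?_
  rw [Matrix.mul_apply, Fintype.sum_unique]
  exact congrArg (· * φ 1 i l) (congrFun (congrFun conjTranspose_embedding_one k) i)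

theorem exists_columns (hM : IsIIOneFactor M tr) (h1 : φ 1 ≠ 0) :
    ∃ (r : ℕ) (V : Fin r → Matrix (Fin n) Unit (Alg M)), (∀ s, φ 1 * V s = V s) ∧
      ∑ s, (V s).conjTranspose * V s = 1 := by
  have h2 : ∀ j, φ 1 j j = ∑ k, star (φ 1 k j) * φ 1 k j := fun j => by
    have := embedding_star_mul_self_apply φ 1 j
    rwa [star_one, one_mul] at this
  have h3 : ∃ j, φ 1 j j ≠ 0 := by
    by_contra! h
    refine h1 (Matrix.ext fun k j => ?_)
    have h4 := (h2 j).symm.trans (h j)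
    rw [Finset.sum_eq_zero_iff_of_nonneg fun k _ => star_mul_self_nonneg _] at h4
    exact CStarRing.star_mul_self_eq_zero_iff _ |>.1 (h4 k (Finset.mem_univ k))
  obtain ⟨j, hj⟩ := h3
  obtain ⟨r, a, ha⟩ := hM.exists_sum_eq_one
    (show 0 ≤ φ 1 j j by rw [h2]; exact Finset.sum_nonneg fun k _ => star_mul_self_nonneg _) hj
  refine ⟨r, fun s => Matrix.of fun i _ => φ 1 i j * a s, fun s => ?_, ?_⟩
  · refine Matrix.ext fun i _ => ?_
    simp only [Matrix.mul_apply, Matrix.of_apply, ← mul_assoc, ← Finset.sum_mul]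
    exact congrArg (· * a s) (congrFun (congrFun (embedding_one_mul (φ := φ) 1) i) j)
  · refine Matrix.ext fun i k => ?_
    rw [Subsingleton.elim k i, Matrix.one_apply_eq, ← ha, Matrix.sum_apply]
    refine Finset.sum_congr rfl fun s _ => ?_
    simp only [Matrix.mul_apply, Matrix.conjTranspose_apply, Matrix.of_apply, star_mul]
    rw [h2 j]
    simp only [Finset.mul_sum, Finset.sum_mul, mul_assoc]

theorem exists_context (hM : IsIIOneFactor M tr) (hN : IsIIOneFactor N tr')
    (h : StablyIsomorphic M N) : Nonempty (Context tr tr') := by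
  obtain ⟨n, φ, hinj, hφ⟩ := h
  have h1 : φ 1 ≠ 0 := fun h => by
    have h2 : (1 : Alg N) = 0 := hinj (h.trans (map_zero φ).symm)
    have h3 := hN.tr_one
    rw [h2, map_zero] at h3
    exact zero_ne_one h3
  obtain ⟨r, V, hpV, hV⟩ := exists_columns hM h1
  have hVp : ∀ s, (V s).conjTranspose * φ 1 = (V s).conjTranspose := fun s => by
    have := congrArg Matrix.conjTranspose (hpV s)
    rwa [Matrix.conjTranspose_mul, conjTranspose_embedding_one] at this
  have hrp : ∀ i, oneRow φ i * φ 1 = oneRow φ i := fun i => oneRow_mul i (embedding_one_mul 1)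
  choose ψ hψ using fun (m : Alg M) (s t : Fin r) =>
    (hφ (V s * cell m * (V t).conjTranspose)).2 (by
      rw [← Matrix.mul_assoc, ← Matrix.mul_assoc, hpV, Matrix.mul_assoc, hVp])
  choose W hW using fun (i : Fin n) (s : Fin r) => (hφ (V s * oneRow φ i)).2 (by
      rw [← Matrix.mul_assoc, hpV, Matrix.mul_assoc, hrp])
  let Ψ : Alg M →⋆ₙₐ[ℂ] Matrix (Fin r) (Fin r) (Alg N) :=
    { toFun := fun m => Matrix.of (ψ m)
      map_smul' := fun z m => Matrix.ext fun s t => hinj (by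
        simp only [Matrix.of_apply, Matrix.smul_apply, map_smul, hψ, MonoidHom.id_apply]
        rw [show cell (z • m) = z • cell m from rfl, Matrix.mul_smul, Matrix.smul_mul])
      map_zero' := Matrix.ext fun s t => hinj (by
        simp only [Matrix.of_apply, Matrix.zero_apply, map_zero, hψ]
        rw [show cell (0 : Alg M) = 0 from rfl, Matrix.mul_zero, Matrix.zero_mul])
      map_add' := fun m m' => Matrix.ext fun s t => hinj (by
        simp only [Matrix.of_apply, Matrix.add_apply, map_add, hψ]
        rw [show cell (m + m') = cell m + cell m' from rfl, Matrix.mul_add, Matrix.add_mul])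
      map_mul' := fun m m' => Matrix.ext fun s t => hinj (by
        simp only [Matrix.of_apply, Matrix.mul_apply, map_sum, map_mul, hψ]
        have e1 : cell (m * m') = cell m * (∑ k, (V k).conjTranspose * V k) * cell m' := by
          rw [hV, Matrix.mul_one]
          exact Matrix.ext fun i j => by simp [Matrix.mul_apply]
        rw [e1]
        simp only [Matrix.mul_sum, Matrix.sum_mul, Matrix.mul_assoc])
      map_star' := fun m => Matrix.ext fun s t => hinj (by
        rw [Matrix.star_apply, map_star, Matrix.star_eq_conjTranspose]
        simp only [Matrix.of_apply, hψ, Matrix.conjTranspose_mul, Matrix.conjTranspose_conjTranspose,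
          Matrix.mul_assoc]
        rfl) }
  have hcell : ∀ a i j, ψ (φ a i j) = fun s t => W i s * a * star (W j t) := fun a i j =>
    funext fun s => funext fun t => hinj (by
      rw [hψ, ← oneRow_mul_mul, map_mul, map_mul, map_star, hW, hW, Matrix.star_eq_conjTranspose,
        Matrix.conjTranspose_mul]
      simp only [Matrix.mul_assoc])
  have hsum : ∑ i, ∑ s, star (W i s) * W i s = 1 := hinj (by
    simp only [map_sum, map_mul, map_star, hW, Matrix.star_eq_conjTranspose,
      Matrix.conjTranspose_mul]
    refine Eq.trans (Finset.sum_congr rfl fun i _ => ?_) sum_oneRow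
    calc _ = (oneRow φ i).conjTranspose * (∑ s, (V s).conjTranspose * V s) * oneRow φ i := by
          simp only [Matrix.mul_sum, Matrix.sum_mul, Matrix.mul_assoc]
      _ = _ := by rw [hV, Matrix.mul_one])
  have hcol : ∀ s i, ψ (V s i ()) = fun k t => W i k * ψ 1 s t := fun s i =>
    funext fun k => funext fun t => hinj (by
      rw [map_mul, hψ, hW, hψ, cell_one, Matrix.mul_one,
        show cell (V s i ()) = oneRow φ i * V s from (oneRow_mul i (hpV s)).symm]
      simp only [Matrix.mul_assoc])
  exact ⟨{
    n := n
    r := r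
    φ := φ
    ψ := Ψ
    V := V
    W := fun i => Matrix.of fun s _ => W i s
    φ_ψ := hψ
    ψ_φ := fun a i j => Matrix.ext fun s t => by
      refine (congrFun (congrFun (hcell a i j) s) t).trans ?_
      simp [Matrix.mul_apply]
    sum_V := hV
    sum_W := Matrix.ext fun k l => by
      rw [Subsingleton.elim l k, Matrix.one_apply_eq, ← hsum, Matrix.sum_apply]
      rfl
    φ_W := fun i s => hW i s
    ψ_V := fun s i => Matrix.ext fun k t => by
      refine (congrFun (congrFun (hcol s i) k) t).trans ?_
      rw [Matrix.mul_apply, Fintype.sum_unique]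
      rfl
    normal_φ := fun hg k l => embedding_normal φ hM hN hg k l
    normal_ψ := fun hg k l => embedding_normal Ψ hN hM hg k l
    bdd_φ := fun ha k l => embedding_bdd φ ha k l
    bdd_ψ := fun ha k l => embedding_bdd Ψ ha k l
    null_φ := fun ha k l => embedding_null φ hM hN ha k l
    null_ψ := fun ha k l => embedding_null Ψ hN hM ha k l }⟩

end StableIsomorphism

end

section

open Filter Topology
variable {K : Type u} [NormedAddCommGroup K] [InnerProductSpace ℂ K] [CompleteSpace K]
variable {N : VonNeumannAlgebra K} {tr : Alg M →ₗ[ℂ] ℂ} {tr' : Alg N →ₗ[ℂ] ℂ}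
open Bim MonoidalCategory
variable [hM : Fact (IsIIOneFactor M tr)] [hN : Fact (IsIIOneFactor N tr')]
open scoped RightActions

/-! ### The braided equivalence -/

attribute [local instance] chiProp_isMonoidal

namespace Context

variable (c : Context tr tr')

/-- The functor of a Morita context on the categories `χ̃`. -/
def chiFunctor : Chi tr ⥤ Chi tr' :=
  (chiProp tr').lift ((chiProp tr).ι ⋙ c.functor) fun X => c.chiProp_obj X.2

/-- The equivalence of the categories `χ̃` given by a Morita context. -/
def chiEquivalence : Chi tr ≌ Chi tr' where
  functor := c.chiFunctor
  inverse := c.swap.chiFunctor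
  unitIso := NatIso.ofComponents (fun X => (chiProp tr).isoMk (c.unitIso X.obj)) fun f =>
    ObjectProperty.hom_ext _ (c.unitIso_naturality f.hom)
  counitIso := NatIso.ofComponents (fun X => (chiProp tr').isoMk (c.swap.unitIso X.obj).symm) fun f =>
    ObjectProperty.hom_ext _ (c.swap.unitIso_inv_naturality f.hom)
  functor_unitIso_comp X := ObjectProperty.hom_ext _ (c.equivalence.functor_unitIso_comp X.obj)

/-- The monoidal structure of the functor of a Morita context on the categories `χ̃`. -/
def chiCoreMonoidal : c.chiFunctor.CoreMonoidal where
  εIso := (chiProp tr').isoMk c.unitorIso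
  μIso X Y := (chiProp tr').isoMk (c.tensorIso X.obj Y.obj)
  μIso_hom_natural_left f X' := ObjectProperty.hom_ext _
    (c.coreMonoidal.μIso_hom_natural_left f.hom X'.obj)
  μIso_hom_natural_right X' f := ObjectProperty.hom_ext _
    (c.coreMonoidal.μIso_hom_natural_right X'.obj f.hom)
  associativity X Y Z := ObjectProperty.hom_ext _ (c.coreMonoidal.associativity X.obj Y.obj Z.obj)
  left_unitality X := ObjectProperty.hom_ext _ (c.coreMonoidal.left_unitality X.obj)
  right_unitality X := ObjectProperty.hom_ext _ (c.coreMonoidal.right_unitality X.obj)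

attribute [local instance] chiBraiding

/-- The functor of a Morita context on the categories `χ̃` is braided. -/
@[reducible]
def chiBraided : c.chiFunctor.Braided where
  toMonoidal := c.chiCoreMonoidal.toMonoidal
  braided X Y := ObjectProperty.hom_ext _
    (c.tensorIso_braidHom X.2.1.1 Y.2.1.2 (c.chiProp_obj X.2).1.1 (c.chiProp_obj Y.2).1.2)

theorem unitarilyBraidedEquivalent (c : Context tr tr') :
    UnitarilyBraidedEquivalent (chiBraiding (tr := tr)) (chiBraiding (tr := tr')) :=
  ⟨c.chiEquivalence, c.chiBraided, fun _ _ => rfl, fun _ _ => rfl, fun _ => rfl, fun _ => rfl,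
    fun _ => rfl, fun _ => rfl, rfl, fun _ _ => rfl⟩

end Context

end

end PopaChi

end

theorem theoremA {H : Type u} [NormedAddCommGroup H] [InnerProductSpace ℂ H] [CompleteSpace H]
    [TopologicalSpace.SeparableSpace H] (M : VonNeumannAlgebra H)
    (tr : PopaChi.Alg M →ₗ[ℂ] ℂ) (hM : PopaChi.IsIIOneFactor M tr) :
    ∃ (_ : (PopaChi.chiProp tr).IsMonoidal) (β : CategoryTheory.BraidedCategory (PopaChi.Chi tr)),
      PopaChi.IsCanonicalBraiding β ∧
      ∀ {K : Type u} [NormedAddCommGroup K] [InnerProductSpace ℂ K] [CompleteSpace K]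
        [TopologicalSpace.SeparableSpace K] (N : VonNeumannAlgebra K)
        (tr' : PopaChi.Alg N →ₗ[ℂ] ℂ), PopaChi.IsIIOneFactor N tr' →
        PopaChi.StablyIsomorphic M N →
        ∃ (_ : (PopaChi.chiProp tr').IsMonoidal)
          (γ : CategoryTheory.BraidedCategory (PopaChi.Chi tr')),
          PopaChi.IsCanonicalBraiding γ ∧ PopaChi.UnitarilyBraidedEquivalent β γ := by
  have : Fact (PopaChi.IsIIOneFactor M tr) := ⟨hM⟩
  refine ⟨PopaChi.chiProp_isMonoidal, PopaChi.chiBraiding,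
    PopaChi.isCanonicalBraiding_chiBraiding, ?_⟩
  intro K _ _ _ _ N tr' hN h
  have : Fact (PopaChi.IsIIOneFactor N tr') := ⟨hN⟩
  obtain ⟨c⟩ := PopaChi.exists_context hM hN h
  exact ⟨PopaChi.chiProp_isMonoidal, PopaChi.chiBraiding,
    PopaChi.isCanonicalBraiding_chiBraiding, c.unitarilyBraidedEquivalent⟩
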